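/- **Setting.** Let $\mathbf H$ be a real Hilbert space with inner product $(\cdot,\cdot)$ and norm $\|\cdot\|$, let $m\ge 1$, $\alpha_1,\dots,\alpha_m\in(0,1)$, $\alpha=\min_j\alpha_j$, $\kappa\ge 0$, $0<T<\infty$, $\gamma\ge 1$. Let $\lambda,M,c_\gamma,C_\gamma>0$ and $\theta\in(0,1)$ be constants. *Operators.* $A$ is a densely defined self-adjoint operator in $\mathbf H$ with compact inverse and $(Aw,w)\ge\lambda\|w\|^2$ for $w\in D(A)$. Each $B_j$ ($1\le j\le m$) is self-adjoint with $(B_jw,w)\ge 0$ for $w\in D(B_j)$, $D(A)\subseteq D(B_j)$, and $|(B_jw,v)|\le M\|w\|_q\|v\|_\vartheta$ for $w,v\in D(A)$, $\vartheta\in\{0,1,2\}$, $\vartheta+q=2$, where $\|w\|_0=\|w\|$, $\|w\|_1=(Aw,w)^{1/2}$, $\|w\|_2=\|Aw\|$. *Continuous problem.* $u\in C([0,T];\mathbf H)$ satisfies $u(0)=u_0$ and, for $0<t<T$, $u(t)\in D(A)$, $u$ is differentiable at $t$, and $$u'(t)+Au(t)+\sum_{j=1}^m\int_0^t\beta_j(t-s)B_ju(s)\,ds=f(t),\qquad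 \beta_j(t)=\frac{e^{-\kappa t}t^{\alpha_j-1}}{\Gamma(\alpha_j)} .$$ Put $v(t)=e^{\kappa t}u(t)$ and $g(t)=e^{\kappa t}f(t)$. On $(0,T)$ both $v$ and $g$ are twice differentiable, $v'(t),v''(t)\in D(A)$, and $$t\|Av''(t)\|+\|v''(t)\|+\|Av'(t)\|\le Mt^{\alpha-1},\qquad t\|g'(t)\|+t^2\|g''(t)\|\le Mt^{\alpha}.$$ *Mesh.* $N\ge1$, $k>0$, $0=t_0<t_1<\dots<t_N\le T$, $k_n=t_n-t_{n-1}$, and $$k_n\le C_\gamma k\min\{1,t_n^{1-1/\gamma}\}\ (1\le n\le N),\qquad t_1\ge c_\gamma k^\gamma,\qquad t_n\le C_\gamma t_{n-1}\ (2\le n\le N),$$ $$0\le k_{n+1}-k_n\le C_\gamma k^2\,t_n^{1-2/\gamma}\quad(2\le n\le N-1).$$ Moreover $\kappa k_n\le\theta$ for $1\le n\le N$ and, if $\gamma=2/(1+\alpha)$, also $t_1\le\theta t_N$. *Scheme.* Let $g^{n-1/2}\in\mathbf H$ ($1\le n\le N$) satisfy $$\Big\|k_1g^{1/2}-\int_0^{t_1}g\Big\|\le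 M\int_0^{t_1}t\|g'(t)\|\,dt,\qquad \Big\|k_ng^{n-1/2}-\int_{t_{n-1}}^{t_n}g\Big\|\le Mk_n^2\int_{t_{n-1}}^{t_n}\|g''(t)\|\,dt\quad(n\ge2).$$ For a sequence $(V^n)$ put $\bar V^1=V^1$ and $\bar V^n=\tfrac12(V^n+V^{n-1})$ for $n\ge2$. Let $V^0=u_0$, let $V^1,\dots,V^N\in D(A)$ and suppose that, for $1\le n\le N$, $$\frac{V^n-V^{n-1}}{k_n}+A\bar V^n+\sum_{j=1}^m\sum_{p=1}^n w^{(j)}_{np}k_p\,B_j\bar V^p-\kappa\bar V^n=g^{n-1/2},$$ $$w^{(j)}_{np}=\frac1{k_nk_p}\int_{t_{n-1}}^{t_n}\int_{t_{p-1}}^{\min\{r,t_p\}}\frac{(r-s)^{\alpha_j-1}}{\Gamma(\alpha_j)}\,ds\,dr .$$ Put $U^n=e^{-\kappa t_n}V^n$. **Theorem.** There is a constant $C>0$ depending only on $m,\alpha,\kappa,\gamma,T,c_\gamma,C_\gamma,\lambda,M,\theta$ such that, for all data as above (in particular for all such meshes), $$\max_{1\le n\le N}\|V^n-v(t_n)\|\le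 C\,\Xi,\qquad \max_{1\le n\le N}\|U^n-u(t_n)\|\le C\,\Xi,$$ where $$\Xi=\begin{cases}k^{\gamma(1+\alpha)},&1\le\gamma<2/(1+\alpha),\\ k^2\log(t_N/t_1),&\gamma=2/(1+\alpha),\\ k^2,&\gamma>2/(1+\alpha).\end{cases}$$ In particular the scheme is second-order accurate in time for $\gamma>2/(1+\alpha)$. -/

import Mathlib

open Set MeasureTheory
open scoped InnerProductSpace

universe u

namespace TemperedVolterra

noncomputable section

variable {H : Type u} [NormedAddCommGroup H] [InnerProductSpace ℝ H]

/-! ### Unbounded operators -/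

open Classical in
/-- `app A x` is `A x` for `x ∈ D(A)`. The value `0` off `D(A)` is never used: wherever `app`
occurs below, membership in the domain is required or follows. -/
def app (A : H →ₗ.[ℝ] H) (x : H) : H :=
  if h : x ∈ A.domain then A ⟨x, h⟩ else 0

/-- `A` has a compact (everywhere defined) inverse. -/
def HasCompactInverse (A : H →ₗ.[ℝ] H) : Prop :=
  ∃ K : H →L[ℝ] H, IsCompactOperator K ∧
    (∀ y : H, K y ∈ A.domain ∧ app A (K y) = y) ∧ ∀ x ∈ A.domain, K (app A x) = x

/-- `A` is self-adjoint, positive definite with lower bound `lam`, and has a compact inverse. -/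
structure IsElliptic [CompleteSpace H] (A : H →ₗ.[ℝ] H) (lam : ℝ) : Prop where
  selfAdjoint : IsSelfAdjoint A
  lower_bound : ∀ x ∈ A.domain, lam * ‖x‖ ^ 2 ≤ ⟪app A x, x⟫_ℝ
  compactInverse : HasCompactInverse A

/-- `B` is self-adjoint and nonnegative, `D(A) ⊆ D(B)`, and `A` dominates `B`, i.e.
`|(B w, v)| ≤ M ‖w‖_q ‖v‖_ϑ` for `(ϑ, q) = (0, 2), (1, 1), (2, 0)`, where `‖x‖₀ = ‖x‖`,
`‖x‖₁ = (A x, x)^{1/2}` and `‖x‖₂ = ‖A x‖`. -/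
structure IsDominated [CompleteSpace H] (A B : H →ₗ.[ℝ] H) (M : ℝ) : Prop where
  selfAdjoint : IsSelfAdjoint B
  nonneg : ∀ x ∈ B.domain, 0 ≤ ⟪app B x, x⟫_ℝ
  domain_le : A.domain ≤ B.domain
  bound_zero : ∀ w ∈ A.domain, ∀ v ∈ A.domain, |⟪app B w, v⟫_ℝ| ≤ M * ‖app A w‖ * ‖v‖
  bound_one : ∀ w ∈ A.domain, ∀ v ∈ A.domain,
    |⟪app B w, v⟫_ℝ| ≤ M * √⟪app A w, w⟫_ℝ * √⟪app A v, v⟫_ℝ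
  bound_two : ∀ w ∈ A.domain, ∀ v ∈ A.domain, |⟪app B w, v⟫_ℝ| ≤ M * ‖w‖ * ‖app A v‖

/-! ### The continuous problem -/

/-- The Abel kernel `ω_a(t) = t^{a-1} / Γ(a)`. -/
def abelKernel (a t : ℝ) : ℝ := t ^ (a - 1) / Real.Gamma a

/-- The tempered kernel `β(t) = e^{-κ t} t^{a-1} / Γ(a)`. -/
def temperedKernel (κ a t : ℝ) : ℝ := Real.exp (-κ * t) * t ^ (a - 1) / Real.Gamma a

/-- `w ↦ e^{κ t} w(t)`, which turns `u` into `v` and `f` into `g`. -/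
def untemper (κ : ℝ) (w : ℝ → H) (t : ℝ) : H := Real.exp (κ * t) • w t

/-- `u` is a (strong) solution on `(0, T)` of
`u' + A u + ∑ⱼ ∫₀ᵗ βⱼ(t - s) Bⱼ u(s) ds = f`, `u(0) = u₀`. -/
structure IsSolution {m : ℕ} (A : H →ₗ.[ℝ] H) (B : Fin m → H →ₗ.[ℝ] H) (a : Fin m → ℝ)
    (κ T : ℝ) (f : ℝ → H) (u₀ : H) (u : ℝ → H) : Prop where
  initial : u 0 = u₀
  continuousOn : ContinuousOn u (Icc 0 T)
  mem_domain : ∀ t ∈ Ioo 0 T, u t ∈ A.domain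
  equation : ∀ t ∈ Ioo 0 T, HasDerivAt u
    (f t - app A (u t)
      - ∑ j, ∫ s in (0 : ℝ)..t, temperedKernel κ (a j) (t - s) • app (B j) (u s)) t

/-- Regularity of `v`: on `(0, T)`, `v` is twice differentiable, `v'` and `v''` take values in
`D(A)`, and `t ‖A v''(t)‖ + ‖v''(t)‖ + ‖A v'(t)‖ ≤ M t^{α-1}`. -/
structure IsRegularSolution (A : H →ₗ.[ℝ] H) (α T M : ℝ) (v : ℝ → H) : Prop where
  differentiable : ∀ t ∈ Ioo 0 T, DifferentiableAt ℝ v t ∧ DifferentiableAt ℝ (deriv v) t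
  mem_domain : ∀ t ∈ Ioo 0 T, deriv v t ∈ A.domain ∧ deriv (deriv v) t ∈ A.domain
  bound : ∀ t ∈ Ioo 0 T, t * ‖app A (deriv (deriv v) t)‖ + ‖deriv (deriv v) t‖
    + ‖app A (deriv v t)‖ ≤ M * t ^ (α - 1)

/-- Regularity of `g`: on `(0, T)`, `g` is twice differentiable and
`t ‖g'(t)‖ + t² ‖g''(t)‖ ≤ M t^α`. -/
structure IsRegularSource (α T M : ℝ) (g : ℝ → H) : Prop where
  differentiable : ∀ t ∈ Ioo 0 T, DifferentiableAt ℝ g t ∧ DifferentiableAt ℝ (deriv g) t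
  bound : ∀ t ∈ Ioo 0 T, t * ‖deriv g t‖ + t ^ 2 * ‖deriv (deriv g) t‖ ≤ M * t ^ α

/-! ### The mesh and the time-discrete scheme -/

/-- The step `k_n = t_n - t_{n-1}` (used for `n ≥ 1`). -/
def step (t : ℕ → ℝ) (n : ℕ) : ℝ := t n - t (n - 1)

/-- Graded meshes `0 = t_0 < t_1 < ⋯ < t_N ≤ T` with mesh parameter `k` and grading `γ`. -/
structure IsGradedMesh (γ T cγ Cγ k : ℝ) (N : ℕ) (t : ℕ → ℝ) : Prop where
  one_le : 1 ≤ N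
  k_pos : 0 < k
  start : t 0 = 0
  increasing : ∀ n, 1 ≤ n → n ≤ N → t (n - 1) < t n
  final : t N ≤ T
  step_le : ∀ n, 1 ≤ n → n ≤ N → step t n ≤ Cγ * k * min 1 (t n ^ (1 - 1 / γ))
  first_ge : cγ * k ^ γ ≤ t 1
  ratio_le : ∀ n, 2 ≤ n → n ≤ N → t n ≤ Cγ * t (n - 1)
  step_mono : ∀ n, 2 ≤ n → n + 1 ≤ N → 0 ≤ step t (n + 1) - step t n
  step_diff_le : ∀ n, 2 ≤ n → n + 1 ≤ N →
    step t (n + 1) - step t n ≤ Cγ * k ^ 2 * t n ^ (1 - 2 / γ)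

/-- The value on `(t_{n-1}, t_n)` of the piecewise constant approximation of `V`:
`V^1` for `n = 1` and `V^{n-1/2} = (V^n + V^{n-1}) / 2` for `n ≥ 2`. -/
def stage (V : ℕ → H) (n : ℕ) : H :=
  if n = 1 then V 1 else (1 / 2 : ℝ) • (V n + V (n - 1))

/-- The product-integration weight
`w_{np} = (k_n k_p)⁻¹ ∫_{t_{n-1}}^{t_n} ∫_{t_{p-1}}^{min(r, t_p)} ω_a(r - s) ds dr`, `p ≤ n`. -/
def piWeight (a : ℝ) (t : ℕ → ℝ) (n p : ℕ) : ℝ :=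
  1 / (step t n * step t p) *
    ∫ r in (t (n - 1))..(t n), ∫ s in (t (p - 1))..(min r (t p)), abelKernel a (r - s)

/-- The discrete fractional integral `I^{(a)} (B V)^{n-1/2}`, that is
`w_{n1} B V^1 k_1 + ∑_{p=2}^n w_{np} B V^{p-1/2} k_p`. -/
def discreteFracInt (a : ℝ) (t : ℕ → ℝ) (B : H →ₗ.[ℝ] H) (V : ℕ → H) (n : ℕ) : H :=
  ∑ p ∈ Finset.Icc 1 n, (piWeight a t n p * step t p) • app B (stage V p)

/-- `G n` is an admissible approximation `g^{n-1/2}` of the mean of `g` over `[t_{n-1}, t_n]`. -/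
structure IsSourceQuadrature (M : ℝ) (N : ℕ) (t : ℕ → ℝ) (g : ℝ → H) (G : ℕ → H) : Prop where
  first : ‖step t 1 • G 1 - ∫ s in (t 0)..(t 1), g s‖
    ≤ M * ∫ s in (t 0)..(t 1), s * ‖deriv g s‖
  next : ∀ n, 2 ≤ n → n ≤ N → ‖step t n • G n - ∫ s in (t (n - 1))..(t n), g s‖
    ≤ M * step t n ^ 2 * ∫ s in (t (n - 1))..(t n), ‖deriv (deriv g) s‖

/-- `V` solves the Crank–Nicolson / product-integration scheme with data `u₀` and `G`: `V^0 = u₀`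
and, for `1 ≤ n ≤ N`,
`(V^n - V^{n-1}) / k_n + A S^n + ∑ⱼ I^{(αⱼ)} Bⱼ V^{n-1/2} - κ S^n = g^{n-1/2}`,
where `S^n` is `stage V n`. -/
structure IsDiscreteSolution {m : ℕ} (A : H →ₗ.[ℝ] H) (B : Fin m → H →ₗ.[ℝ] H)
    (a : Fin m → ℝ) (κ : ℝ) (N : ℕ) (t : ℕ → ℝ) (G : ℕ → H) (u₀ : H) (V : ℕ → H) : Prop where
  initial : V 0 = u₀
  mem_domain : ∀ n, 1 ≤ n → n ≤ N → V n ∈ A.domain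
  equation : ∀ n, 1 ≤ n → n ≤ N →
    (1 / step t n) • (V n - V (n - 1)) + app A (stage V n)
      + ∑ j, discreteFracInt (a j) t (B j) V n - κ • stage V n = G n

/-- The approximation `U^n = e^{-κ t_n} V^n` of `u(t_n)`. -/
def retemper (κ : ℝ) (t : ℕ → ℝ) (V : ℕ → H) (n : ℕ) : H := Real.exp (-κ * t n) • V n

/-- The error bound `Ξ`. -/
def errorBound (k α γ t₁ tN : ℝ) : ℝ :=
  if γ < 2 / (1 + α) then k ^ (γ * (1 + α))
  else if γ = 2 / (1 + α) then k ^ 2 * Real.log (tN / t₁)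
  else k ^ 2

end

end TemperedVolterra

/-!
The error `e^n = V^n - v(t_n)` solves the scheme with the residuals `ρ^n` of the exact solution
`v = e^{κ t} u` as data, and the proof is stability plus consistency: `max ‖e^n‖ ≤ C ∑ ‖ρ^n‖` and
`∑ ‖ρ^n‖ ≤ C Ξ`.

*Stability* (`norm_le_sum_norm_residual`). The error equation is tested with the stages and summed.
The memory terms are nonnegative because the product-integration weights are mixed second
differences of `-|r - s|^{1+a}`, and `|x|^{1+a}` is a positive multiple of
`∫₀^∞ (1 - cos (y x)) y^{-2-a} dy`; hence the weights form a positive semidefinite array, and so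
does its Schur product with `(B s^p, s^n)` (`sum_piWeight_mul_nonneg`). The term with `κ` is absorbed
by `κ k_n ≤ θ < 1` and a discrete Grönwall inequality.

*Regularity* (`isGradedSmooth_comp`). The bounds on `A v'` and `A v''` enter only through the scalar
functions `(v(t), A z)` with `z ∈ D(A)`. The mean value theorem turns them into estimates for first
and second divided differences of `A v`, of `B_j v` and of `v`, so no vector-valued derivative of
`A v` is needed.

*Consistency.* The residual of the source is bounded through the quadrature hypothesis; those of
`A v` and `κ v` are errors of the trapezoidal rule, or of the right rectangle rule on the first
interval. The residual of a memory term is the increment `Ψ_n - Ψ_{n-1}` of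
`Ψ_n = ∫₀^{t_n} ω_{a+1}(t_n - s) (b - b̄)(s) ds`, where `b = B_j v` and `b̄` is its piecewise constant
approximation (`memory_error_eq`). Now `b - b̄` is the sum of the interpolation error of `b`, which is
of second order, and of a sawtooth with slopes `d_p`, which is only of first order. For the first
part the increments telescope, as `ω_{a+1}` increases (`sum_norm_residualDefect_sub_le`). The second
part equals `-∑_p c_{n,p} d_p` with `c_{n,p} ≥ 0` and `∑_n c_{n,p} ≤ C k_p²`. Since the steps
increase slowly, `c_{n,p}` exceeds its diagonal neighbour `c_{n-1,p-1}` by at most a small multiple of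
itself, and the negative part of the difference telescopes against the decreasing bound
`L t_{p-1}^{α-1}` for `d_p` (`sum_norm_sub_le_of_diagonal`). What remains are Riemann sums of
`k² t^{α-2/γ}` over `(t_1, t_N)`, which together with `t_1^{1+α}` produce the three regimes of the
error bound (`exists_mesh_sums_le`).
-/

namespace TemperedVolterra

noncomputable section

/-! ### The Abel kernel -/

lemma abelKernel_nonneg {a x : ℝ} (ha : 0 < a) (hx : 0 ≤ x) : 0 ≤ abelKernel a x :=
  div_nonneg (Real.rpow_nonneg hx _) (Real.Gamma_pos_of_pos ha).le

lemma abelKernel_add_one_zero {a : ℝ} (ha : 0 < a) : abelKernel (a + 1) 0 = 0 := by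
  simp [abelKernel, Real.zero_rpow ha.ne']

lemma hasDerivAt_abelKernel {a x : ℝ} (ha : 0 < a) (h : x ≠ 0 ∨ 1 ≤ a) :
    HasDerivAt (abelKernel (a + 1)) (abelKernel a x) x := by
  have h1 : HasDerivAt (fun y : ℝ => y ^ a) (a * x ^ (a - 1)) x := Real.hasDerivAt_rpow_const h
  have h2 := h1.div_const (Real.Gamma (a + 1))
  have hΓ := (Real.Gamma_pos_of_pos ha).ne'
  have e : a * x ^ (a - 1) / Real.Gamma (a + 1) = abelKernel a x := by
    rw [Real.Gamma_add_one ha.ne', abelKernel]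
    field_simp
  rw [e] at h2
  refine h2.congr_of_eventuallyEq (Filter.Eventually.of_forall fun y => ?_)
  simp [abelKernel]

lemma intervalIntegrable_abelKernel {a : ℝ} (ha : 0 < a) (x y : ℝ) :
    IntervalIntegrable (abelKernel a) volume x y :=
  (intervalIntegral.intervalIntegrable_rpow' (by linarith : -1 < a - 1)).div_const _

lemma integral_abelKernel {a : ℝ} (ha : 0 < a) (x y : ℝ) :
    ∫ s in x..y, abelKernel a s = abelKernel (a + 1) y - abelKernel (a + 1) x := by
  have hΓ := (Real.Gamma_pos_of_pos ha).ne'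
  simp only [abelKernel]
  rw [intervalIntegral.integral_div, integral_rpow (Or.inl (by linarith)),
    Real.Gamma_add_one ha.ne']
  have : a - 1 + 1 = a := by ring
  rw [this, add_sub_cancel_right]
  field_simp

lemma integral_abelKernel_sub_left {a : ℝ} (ha : 0 < a) (c x y : ℝ) :
    ∫ s in x..y, abelKernel a (c - s)
      = abelKernel (a + 1) (c - x) - abelKernel (a + 1) (c - y) := by
  rw [intervalIntegral.integral_comp_sub_left (fun s => abelKernel a s) c, integral_abelKernel ha]

lemma integral_abelKernel_sub_right {a : ℝ} (ha : 0 < a) (c x y : ℝ) :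
    ∫ s in x..y, abelKernel a (s - c)
      = abelKernel (a + 1) (y - c) - abelKernel (a + 1) (x - c) := by
  rw [intervalIntegral.integral_comp_sub_right (fun s => abelKernel a s) c, integral_abelKernel ha]

lemma intervalIntegrable_abelKernel_sub_left {a : ℝ} (ha : 0 < a) (c x y : ℝ) :
    IntervalIntegrable (fun s => abelKernel a (c - s)) volume x y := by
  simpa using (intervalIntegrable_abelKernel ha (c - x) (c - y)).comp_sub_left c

lemma abelKernel_mono {a x y : ℝ} (ha : 1 ≤ a) (hx : 0 ≤ x) (hxy : x ≤ y) :
    abelKernel a x ≤ abelKernel a y :=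
  div_le_div_of_nonneg_right (Real.rpow_le_rpow hx hxy (by linarith))
    (Real.Gamma_pos_of_pos (by linarith)).le

lemma abelKernel_anti {a x y : ℝ} (ha : 0 < a) (ha1 : a ≤ 1) (hx : 0 < x) (hxy : x ≤ y) :
    abelKernel a y ≤ abelKernel a x :=
  div_le_div_of_nonneg_right (Real.rpow_le_rpow_of_nonpos hx hxy (by linarith))
    (Real.Gamma_pos_of_pos ha).le

lemma continuous_abelKernel {a : ℝ} (ha : 1 ≤ a) : Continuous (abelKernel a) :=
  (Real.continuous_rpow_const (by linarith)).div_const _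

/-- The tangent-line inequality for the concave function `ω_{a+1}`, `0 < a ≤ 1`. -/
lemma mul_abelKernel_le_sub {a x k : ℝ} (ha : 0 < a) (ha1 : a ≤ 1) (hk : 0 ≤ k) (hkx : k ≤ x) :
    k * abelKernel a x ≤ abelKernel (a + 1) x - abelKernel (a + 1) (x - k) := by
  rw [← integral_abelKernel ha]
  have h : ∫ _ in (x - k)..x, abelKernel a x = k * abelKernel a x := by simp
  rw [← h]
  refine intervalIntegral.integral_mono_on_of_le_Ioo (by linarith) (by simp)
    (intervalIntegrable_abelKernel ha _ _) fun s hs => ?_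
  exact abelKernel_anti ha ha1 (by linarith [hs.1]) hs.2.le

/-- `ω_{a+1}` is bounded on `[0, T]`, uniformly in the order `a ∈ (0, 1)`. -/
lemma exists_abelKernel_add_one_le (T : ℝ) :
    ∃ K : ℝ, 0 < K ∧ ∀ a x : ℝ, 0 < a → a < 1 → 0 ≤ x → x ≤ T → abelKernel (a + 1) x ≤ K := by
  obtain ⟨z, hz, hmin⟩ := isCompact_Icc.exists_isMinOn (nonempty_Icc.2 (by norm_num : (1 : ℝ) ≤ 2))
    (f := Real.Gamma) fun y hy => (Real.differentiableAt_Gamma fun n => by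
      have : (0 : ℝ) ≤ n := n.cast_nonneg
      linarith [hy.1]).continuousAt.continuousWithinAt
  have hz0 : 0 < Real.Gamma z := Real.Gamma_pos_of_pos (by linarith [hz.1])
  refine ⟨max 1 T / Real.Gamma z, by positivity, fun a x ha ha1 hx hxT => ?_⟩
  have h1 : Real.Gamma z ≤ Real.Gamma (a + 1) :=
    hmin (show a + 1 ∈ Icc (1 : ℝ) 2 from ⟨by linarith, by linarith⟩)
  have h2 : x ^ (a + 1 - 1) ≤ max 1 T := by
    rw [add_sub_cancel_right]
    calc x ^ a ≤ (max 1 T) ^ a := Real.rpow_le_rpow hx (hxT.trans (le_max_right _ _)) ha.le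
      _ ≤ (max 1 T) ^ (1 : ℝ) := Real.rpow_le_rpow_of_exponent_le (le_max_left _ _) ha1.le
      _ = max 1 T := Real.rpow_one _
  exact div_le_div₀ (by positivity) h2 hz0 h1

/-- The closed form of the product-integration weights: a mixed second difference of `ω_{a+2}`.
For `p = n` the two terms at `t_{n-1}` are dropped. -/
lemma piWeight_eq_of_lt {a : ℝ} (ha : 0 < a) {t : ℕ → ℝ} {n p : ℕ} (hp : t p ≤ t (n - 1))
    (hn : t (n - 1) < t n) (hp' : t (p - 1) < t p) :
    step t n * (piWeight a t n p * step t p)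
      = (abelKernel (a + 2) (t n - t (p - 1)) - abelKernel (a + 2) (t n - t p))
        - (abelKernel (a + 2) (t (n - 1) - t (p - 1)) - abelKernel (a + 2) (t (n - 1) - t p)) := by
  have h1 : step t n ≠ 0 := by simp only [step]; linarith
  have h2 : step t p ≠ 0 := by simp only [step]; linarith
  have e : ∀ z : ℝ, abelKernel (a + 2) z = abelKernel (a + 1 + 1) z := fun z => by
    congr 1; ring
  have hint : ∫ r in (t (n - 1))..(t n), ∫ s in (t (p - 1))..(min r (t p)), abelKernel a (r - s)
      = ∫ r in (t (n - 1))..(t n), (abelKernel (a + 1) (r - t (p - 1))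
          - abelKernel (a + 1) (r - t p)) := by
    refine intervalIntegral.integral_congr fun r hr => ?_
    rw [uIcc_of_le hn.le] at hr
    simp only [min_eq_right (hp.trans hr.1)]
    exact integral_abelKernel_sub_left ha _ _ _
  have hc : ∀ c : ℝ, IntervalIntegrable (fun r => abelKernel (a + 1) (r - c)) volume
      (t (n - 1)) (t n) := fun c =>
    ((continuous_abelKernel (by linarith)).comp (continuous_id.sub continuous_const)
      ).intervalIntegrable _ _
  rw [piWeight, hint, intervalIntegral.integral_sub (hc _) (hc _),
    integral_abelKernel_sub_right (by linarith), integral_abelKernel_sub_right (by linarith)]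
  simp only [e]
  field_simp
  ring

lemma piWeight_self {a : ℝ} (ha : 0 < a) {t : ℕ → ℝ} {n : ℕ} (hn : t (n - 1) < t n) :
    step t n * (piWeight a t n n * step t n) = abelKernel (a + 2) (t n - t (n - 1)) := by
  have h1 : step t n ≠ 0 := by simp only [step]; linarith
  have e : ∀ z : ℝ, abelKernel (a + 2) z = abelKernel (a + 1 + 1) z := fun z => by
    congr 1; ring
  have hint : ∫ r in (t (n - 1))..(t n), ∫ s in (t (n - 1))..(min r (t n)), abelKernel a (r - s)
      = ∫ r in (t (n - 1))..(t n), abelKernel (a + 1) (r - t (n - 1)) := by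
    refine intervalIntegral.integral_congr fun r hr => ?_
    rw [uIcc_of_le hn.le] at hr
    simp only [min_eq_left hr.2]
    rw [integral_abelKernel_sub_left ha, sub_self, abelKernel_add_one_zero ha, sub_zero]
  rw [piWeight, hint, integral_abelKernel_sub_right (by linarith), sub_self,
    abelKernel_add_one_zero (by linarith), e]
  field_simp
  ring

/-! ### Moments of the kernel against a sawtooth -/

/-- `sawWeight a x k = (k³ / 2) ∫₀¹ ω_a(x + k τ) τ (1 - τ) dτ`. Up to sign this is the integral of
`ω_{a+1}(c - ·)` against the sawtooth `s - (p + q) / 2` on the interval `(p, q)` of length `k` with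
`x = c - q`; see `integral_abelKernel_mul_saw`. -/
def sawWeight (a x k : ℝ) : ℝ :=
  k ^ 3 / 2 * ∫ τ in (0 : ℝ)..1, abelKernel a (x + k * τ) * (τ * (1 - τ))

lemma intervalIntegrable_abelKernel_affine {a : ℝ} (ha : 0 < a) (x : ℝ) {k : ℝ} (hk : k ≠ 0) :
    IntervalIntegrable (fun τ => abelKernel a (x + k * τ)) volume 0 1 := by
  have h := ((intervalIntegrable_abelKernel ha (x) (x + k)).comp_add_left x).comp_mul_left (c := k)
  simpa [hk] using h

lemma intervalIntegrable_abelKernel_affine_mul {a : ℝ} (ha : 0 < a) (x : ℝ) {k : ℝ} (hk : k ≠ 0) :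
    IntervalIntegrable (fun τ => abelKernel a (x + k * τ) * (τ * (1 - τ))) volume 0 1 :=
  (intervalIntegrable_abelKernel_affine ha x hk).mul_continuousOn (by fun_prop)

lemma sawWeight_nonneg {a x k : ℝ} (ha : 0 < a) (hx : 0 ≤ x) (hk : 0 ≤ k) :
    0 ≤ sawWeight a x k := by
  refine mul_nonneg (by positivity) (intervalIntegral.integral_nonneg zero_le_one fun τ hτ => ?_)
  exact mul_nonneg (abelKernel_nonneg ha (by nlinarith [hτ.1]))
    (mul_nonneg hτ.1 (by linarith [hτ.2]))

lemma integral_abelKernel_mul_saw {a c p q : ℝ} (ha : 0 < a) (hpq : p < q) (hqc : q ≤ c) :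
    ∫ s in p..q, abelKernel (a + 1) (c - s) * (s - (p + q) / 2)
      = -sawWeight a (c - q) (q - p) := by
  have hk : q - p ≠ 0 := by linarith
  have key := intervalIntegral.integral_mul_deriv_eq_deriv_mul_of_hasDerivAt
    (u := fun s => abelKernel (a + 1) (c - s)) (v := fun s => (s - p) * (s - q) / 2)
    (u' := fun s => -abelKernel a (c - s)) (v' := fun s => s - (p + q) / 2) (a := p) (b := q)
    ((continuous_abelKernel (by linarith)).comp (continuous_const.sub continuous_id)).continuousOn
    (by fun_prop)
    (fun s hs => by
      rw [min_eq_left hpq.le, max_eq_right hpq.le] at hs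
      have := HasDerivAt.comp s (hasDerivAt_abelKernel (x := c - s) ha
        (Or.inl (by linarith [hs.2]))) ((hasDerivAt_id' s).const_sub c)
      rw [mul_neg_one] at this
      exact this)
    (fun s hs => by
      have := (((hasDerivAt_id' s).sub_const p).mul ((hasDerivAt_id' s).sub_const q)).div_const 2
      have e : (1 * (s - q) + (s - p) * 1) / 2 = s - (p + q) / 2 := by ring
      rw [e] at this
      exact this)
    (intervalIntegrable_abelKernel_sub_left ha c p q).neg
    ((continuous_id.sub continuous_const).intervalIntegrable _ _)
  rw [key]
  have sub := intervalIntegral.integral_comp_sub_mul (a := 0) (b := 1)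
    (fun s => -abelKernel a (c - s) * ((s - p) * (s - q) / 2)) hk q
  have e : ∀ τ : ℝ, -abelKernel a (c - (q - (q - p) * τ))
      * ((q - (q - p) * τ - p) * (q - (q - p) * τ - q) / 2)
      = (q - p) ^ 2 / 2 * (abelKernel a (c - q + (q - p) * τ) * (τ * (1 - τ))) := fun τ => by
    have : c - (q - (q - p) * τ) = c - q + (q - p) * τ := by ring
    rw [this]; ring
  simp only [e, intervalIntegral.integral_const_mul] at sub
  rw [mul_one, mul_zero, sub_zero, sub_sub_cancel, smul_eq_mul, eq_inv_mul_iff_mul_eq₀ hk] at sub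
  rw [← sub, sawWeight]
  ring

/-- `sawWeight a x k / k³` decreases in `x` and in `k`. -/
lemma sawWeight_mul_le {a x x' k k' : ℝ} (ha : 0 < a) (ha1 : a ≤ 1) (hx' : 0 ≤ x') (hx : x' ≤ x)
    (hk' : 0 < k') (hk : k' ≤ k) : sawWeight a x k * k' ^ 3 ≤ sawWeight a x' k' * k ^ 3 := by
  have h : ∫ τ in (0 : ℝ)..1, abelKernel a (x + k * τ) * (τ * (1 - τ))
      ≤ ∫ τ in (0 : ℝ)..1, abelKernel a (x' + k' * τ) * (τ * (1 - τ)) := by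
    refine intervalIntegral.integral_mono_on_of_le_Ioo zero_le_one
      (intervalIntegrable_abelKernel_affine_mul ha _ (by linarith))
      (intervalIntegrable_abelKernel_affine_mul ha _ hk'.ne') fun τ hτ => ?_
    refine mul_le_mul_of_nonneg_right (abelKernel_anti ha ha1 ?_ ?_)
      (mul_nonneg hτ.1.le (by linarith [hτ.2]))
    · have := mul_pos hk' hτ.1; linarith
    · have := mul_le_mul_of_nonneg_right hk hτ.1.le; linarith
  have h0 : 0 ≤ k ^ 3 * k' ^ 3 / 2 := by
    have : 0 ≤ k := hk'.le.trans hk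
    positivity
  have := mul_le_mul_of_nonneg_left h h0
  simp only [sawWeight]
  linarith

lemma sawWeight_le {a x k : ℝ} (ha : 0 < a) (ha1 : a ≤ 1) (hx : 0 < x) (hk : 0 < k) :
    sawWeight a x k ≤ k ^ 3 * abelKernel a x := by
  have h : ∫ τ in (0 : ℝ)..1, abelKernel a (x + k * τ) * (τ * (1 - τ))
      ≤ ∫ _ in (0 : ℝ)..1, abelKernel a x := by
    refine intervalIntegral.integral_mono_on zero_le_one
      (intervalIntegrable_abelKernel_affine_mul ha _ hk.ne') (by simp) fun τ hτ => ?_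
    have h1 : 0 ≤ k * τ := mul_nonneg hk.le hτ.1
    have h2 : abelKernel a (x + k * τ) ≤ abelKernel a x :=
      abelKernel_anti ha ha1 hx (by linarith)
    have h3 := abelKernel_nonneg (x := x + k * τ) ha (by linarith)
    have h4 : τ * (1 - τ) ≤ 1 := by nlinarith [hτ.1, hτ.2]
    nlinarith
  have h0 := abelKernel_nonneg ha hx.le
  rw [intervalIntegral.integral_const, sub_zero, one_smul] at h
  calc sawWeight a x k ≤ k ^ 3 / 2 * abelKernel a x :=
        mul_le_mul_of_nonneg_left h (by positivity)
    _ ≤ k ^ 3 * abelKernel a x := mul_le_mul_of_nonneg_right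
        (by linarith [pow_pos hk 3]) h0

lemma sawWeight_zero_le {a k : ℝ} (ha : 0 < a) (hk : 0 < k) :
    sawWeight a 0 k ≤ k ^ 2 * abelKernel (a + 1) k := by
  have h : ∫ τ in (0 : ℝ)..1, abelKernel a (0 + k * τ) * (τ * (1 - τ))
      ≤ ∫ τ in (0 : ℝ)..1, abelKernel a (0 + k * τ) := by
    refine intervalIntegral.integral_mono_on zero_le_one
      (intervalIntegrable_abelKernel_affine_mul ha _ hk.ne')
      (intervalIntegrable_abelKernel_affine ha _ hk.ne') fun τ hτ => ?_
    have h1 : 0 ≤ k * τ := mul_nonneg hk.le hτ.1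
    have h3 := abelKernel_nonneg (x := 0 + k * τ) ha (by linarith)
    have h4 : τ * (1 - τ) ≤ 1 := by nlinarith [hτ.1, hτ.2]
    nlinarith
  have e : ∫ τ in (0 : ℝ)..1, abelKernel a (0 + k * τ) = k⁻¹ * abelKernel (a + 1) k := by
    simp only [zero_add]
    rw [intervalIntegral.integral_comp_mul_left (fun s => abelKernel a s) hk.ne',
      integral_abelKernel ha, mul_zero, mul_one, abelKernel_add_one_zero ha, sub_zero, smul_eq_mul]
  have h0 := abelKernel_nonneg (a := a + 1) (by linarith) hk.le
  calc sawWeight a 0 k ≤ k ^ 3 / 2 * (k⁻¹ * abelKernel (a + 1) k) :=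
        mul_le_mul_of_nonneg_left (h.trans e.le) (by positivity)
    _ = k ^ 2 / 2 * abelKernel (a + 1) k := by field_simp
    _ ≤ k ^ 2 * abelKernel (a + 1) k := mul_le_mul_of_nonneg_right
        (by linarith [pow_pos hk 2]) h0

/-! ### Positivity of the product-integration weights -/

lemma integrableOn_one_sub_cos {q : ℝ} (hq : 0 < q) (hq2 : q < 2) :
    IntegrableOn (fun y : ℝ => (1 - Real.cos y) * y ^ (-q - 1)) (Ioi 0) := by
  have hm : ∀ s : Set ℝ, AEStronglyMeasurable (fun y : ℝ => (1 - Real.cos y) * y ^ (-q - 1))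
      (volume.restrict s) := fun s => by
    have : Measurable (fun y : ℝ => (1 - Real.cos y) * y ^ (-q - 1)) := by fun_prop
    exact this.aestronglyMeasurable
  rw [← Ioc_union_Ioi_eq_Ioi (zero_le_one (α := ℝ)), integrableOn_union]
  constructor
  · have h : IntegrableOn (fun y : ℝ => y ^ (1 - q) / 2) (Ioc 0 1) := by
      have := (intervalIntegral.intervalIntegrable_rpow' (a := 0) (b := 1)
        (by linarith : -1 < 1 - q)).div_const 2
      rwa [intervalIntegrable_iff_integrableOn_Ioc_of_le zero_le_one] at this
    refine h.mono' (hm _) ((ae_restrict_iff' measurableSet_Ioc).2 (.of_forall fun y hy => ?_))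
    have h1 := Real.one_sub_sq_div_two_le_cos (x := y)
    have h2 : y ^ (1 - q) = y ^ 2 * y ^ (-q - 1) := by
      rw [← Real.rpow_natCast y 2, ← Real.rpow_add hy.1]; congr 1; push_cast; ring
    have h3 : 0 ≤ y ^ (-q - 1) := Real.rpow_nonneg hy.1.le _
    rw [Real.norm_of_nonneg (mul_nonneg (by linarith [Real.cos_le_one y]) h3), h2]
    nlinarith
  · have h : IntegrableOn (fun y : ℝ => 2 * y ^ (-q - 1)) (Ioi 1) :=
      (integrableOn_Ioi_rpow_of_lt (by linarith) one_pos).const_mul 2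
    refine h.mono' (hm _) ((ae_restrict_iff' measurableSet_Ioi).2 (.of_forall fun y hy => ?_))
    have h3 : 0 ≤ y ^ (-q - 1) := Real.rpow_nonneg (zero_le_one.trans (le_of_lt hy)) _
    rw [Real.norm_of_nonneg (mul_nonneg (by linarith [Real.cos_le_one y]) h3)]
    exact mul_le_mul_of_nonneg_right (by linarith [Real.neg_one_le_cos y]) h3

lemma integral_one_sub_cos_pos {q : ℝ} (hq : 0 < q) (hq2 : q < 2) :
    0 < ∫ y in Ioi (0 : ℝ), (1 - Real.cos y) * y ^ (-q - 1) := by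
  have hnn : ∀ y ∈ Ioi (0 : ℝ), 0 ≤ (1 - Real.cos y) * y ^ (-q - 1) := fun y hy =>
    mul_nonneg (by linarith [Real.cos_le_one y]) (Real.rpow_nonneg (le_of_lt hy) _)
  rw [setIntegral_pos_iff_support_of_nonneg_ae
    ((ae_restrict_iff' measurableSet_Ioi).2 (.of_forall hnn)) (integrableOn_one_sub_cos hq hq2)]
  refine lt_of_lt_of_le (?_ : (0 : ENNReal) < volume (Ioo (0 : ℝ) 1)) (measure_mono ?_)
  · simp
  · intro y hy
    refine ⟨?_, hy.1⟩
    have h1 : Real.cos y < 1 := by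
      rw [← Real.cos_zero]
      exact Real.cos_lt_cos_of_nonneg_of_le_pi le_rfl (by linarith [Real.pi_gt_three, hy.2]) hy.1
    have h2 := Real.rpow_pos_of_pos hy.1 (-q - 1)
    exact (mul_pos (by linarith) h2).ne'

lemma one_sub_cos_scaled {q x : ℝ} (hx : 0 < x) {y : ℝ} (hy : y ∈ Ioi (0 : ℝ)) :
    (1 - Real.cos (y * x)) * y ^ (-q - 1)
      = x ^ (q + 1) * ((1 - Real.cos (x * y)) * (x * y) ^ (-q - 1)) := by
  have h1 : x ^ (q + 1) * x ^ (-q - 1) = 1 := by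
    rw [← Real.rpow_add hx]; simp
  rw [Real.mul_rpow hx.le (le_of_lt hy), mul_comm y x]
  linear_combination (-(1 - Real.cos (x * y)) * y ^ (-q - 1)) * h1

/-- The spectral representation of `|x|^q`, `0 < q < 2`, which shows that `-|r - s|^q` is
conditionally positive definite. -/
lemma integral_one_sub_cos_mul {q : ℝ} (hq : 0 < q) (hq2 : q < 2) (x : ℝ) :
    IntegrableOn (fun y : ℝ => (1 - Real.cos (y * x)) * y ^ (-q - 1)) (Ioi 0) ∧
    ∫ y in Ioi (0 : ℝ), (1 - Real.cos (y * x)) * y ^ (-q - 1)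
      = |x| ^ q * ∫ y in Ioi (0 : ℝ), (1 - Real.cos y) * y ^ (-q - 1) := by
  have pos : ∀ x : ℝ, 0 < x →
      IntegrableOn (fun y : ℝ => (1 - Real.cos (y * x)) * y ^ (-q - 1)) (Ioi 0) ∧
      ∫ y in Ioi (0 : ℝ), (1 - Real.cos (y * x)) * y ^ (-q - 1)
        = x ^ q * ∫ y in Ioi (0 : ℝ), (1 - Real.cos y) * y ^ (-q - 1) := by
    intro x hx
    constructor
    · rw [integrableOn_congr_fun (fun y hy => one_sub_cos_scaled hx hy) measurableSet_Ioi]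
      refine Integrable.const_mul ?_ _
      have := (integrableOn_Ioi_comp_mul_left_iff
        (fun y : ℝ => (1 - Real.cos y) * y ^ (-q - 1)) 0 hx).2
      rw [mul_zero] at this
      exact this (integrableOn_one_sub_cos hq hq2)
    · rw [setIntegral_congr_fun measurableSet_Ioi (fun y hy => one_sub_cos_scaled hx hy),
        integral_const_mul,
        integral_comp_mul_left_Ioi (fun y : ℝ => (1 - Real.cos y) * y ^ (-q - 1)) 0 hx,
        mul_zero, smul_eq_mul, ← mul_assoc, Real.rpow_add_one hx.ne']
      field_simp
  rcases lt_trichotomy x 0 with h | h | h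
  · have := pos (-x) (by linarith)
    simpa only [mul_neg, Real.cos_neg, abs_of_neg h] using this
  · subst h
    simp [Real.zero_rpow hq.ne']
  · rw [abs_of_pos h]; exact pos x h

/-- If `c ↦ ∑ c_n c_p G_{np}` is positive semidefinite, then so is its Schur product with the
second differences of `-|r - s|^q`, `0 < q < 2`. -/
lemma sum_secondDifference_mul_nonneg {q : ℝ} (hq : 0 < q) (hq2 : q < 2) (t : ℕ → ℝ)
    (s : Finset ℕ) (G : ℕ → ℕ → ℝ)
    (hG : ∀ c : ℕ → ℝ, 0 ≤ ∑ n ∈ s, ∑ p ∈ s, c n * c p * G n p) :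
    0 ≤ ∑ n ∈ s, ∑ p ∈ s, (|t n - t (p - 1)| ^ q + |t (n - 1) - t p| ^ q
      - |t n - t p| ^ q - |t (n - 1) - t (p - 1)| ^ q) * G n p := by
  set I := ∫ y in Ioi (0 : ℝ), (1 - Real.cos y) * y ^ (-q - 1) with hI
  have hIpos : 0 < I := integral_one_sub_cos_pos hq hq2
  set f : ℝ → ℝ → ℝ := fun x y => (1 - Real.cos (y * x)) * y ^ (-q - 1) with hf
  have hfi : ∀ x, IntegrableOn (f x) (Ioi 0) := fun x => (integral_one_sub_cos_mul hq hq2 x).1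
  have hfI : ∀ x, ∫ y in Ioi (0 : ℝ), f x y = |x| ^ q * I := fun x =>
    (integral_one_sub_cos_mul hq hq2 x).2
  set F : ℕ → ℕ → ℝ → ℝ := fun n p y => (f (t n - t (p - 1)) y + f (t (n - 1) - t p) y
      - f (t n - t p) y - f (t (n - 1) - t (p - 1)) y) * G n p with hF
  have hFi : ∀ n p, IntegrableOn (F n p) (Ioi 0) := fun n p =>
    ((((hfi _).add (hfi _)).sub (hfi _)).sub (hfi _)).mul_const _
  have hFI : ∀ n p, ∫ y in Ioi (0 : ℝ), F n p y = I * ((|t n - t (p - 1)| ^ q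
      + |t (n - 1) - t p| ^ q - |t n - t p| ^ q - |t (n - 1) - t (p - 1)| ^ q) * G n p) := by
    intro n p
    have h2 : IntegrableOn (fun y => f (t n - t (p - 1)) y + f (t (n - 1) - t p) y) (Ioi 0) :=
      (hfi _).add (hfi _)
    have h3 : IntegrableOn (fun y => f (t n - t (p - 1)) y + f (t (n - 1) - t p) y
        - f (t n - t p) y) (Ioi 0) := h2.sub (hfi _)
    simp only [hF]
    rw [integral_mul_const, integral_sub h3 (hfi _), integral_sub h2 (hfi _),
      integral_add (hfi _) (hfi _)]
    simp only [hfI]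
    ring
  have hsum : ∫ y in Ioi (0 : ℝ), ∑ n ∈ s, ∑ p ∈ s, F n p y = I * ∑ n ∈ s, ∑ p ∈ s,
      (|t n - t (p - 1)| ^ q + |t (n - 1) - t p| ^ q
        - |t n - t p| ^ q - |t (n - 1) - t (p - 1)| ^ q) * G n p := by
    rw [integral_finsetSum _ fun n _ => integrable_finsetSum _ fun p _ => hFi n p, Finset.mul_sum]
    refine Finset.sum_congr rfl fun n _ => ?_
    rw [integral_finsetSum _ fun p _ => hFi n p, Finset.mul_sum]
    exact Finset.sum_congr rfl fun p _ => hFI n p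
  refine nonneg_of_mul_nonneg_right (?_ : 0 ≤ I * _) hIpos
  rw [← hsum]
  refine setIntegral_nonneg measurableSet_Ioi fun y hy => ?_
  -- The second difference of `cos (y (r - s))` splits into two rank-one terms.
  have e : ∑ n ∈ s, ∑ p ∈ s, F n p y = y ^ (-q - 1) *
      (∑ n ∈ s, ∑ p ∈ s, (Real.cos (y * t n) - Real.cos (y * t (n - 1)))
          * (Real.cos (y * t p) - Real.cos (y * t (p - 1))) * G n p
        + ∑ n ∈ s, ∑ p ∈ s, (Real.sin (y * t n) - Real.sin (y * t (n - 1)))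
          * (Real.sin (y * t p) - Real.sin (y * t (p - 1))) * G n p) := by
    rw [← Finset.sum_add_distrib, Finset.mul_sum]
    refine Finset.sum_congr rfl fun n _ => ?_
    rw [← Finset.sum_add_distrib, Finset.mul_sum]
    refine Finset.sum_congr rfl fun p _ => ?_
    simp only [hF, hf, mul_sub, Real.cos_sub]
    ring
  rw [e]
  exact mul_nonneg (Real.rpow_nonneg (le_of_lt hy) _) (add_nonneg (hG _) (hG _))

lemma sum_Icc_sum_Icc_of_symm (f : ℕ → ℕ → ℝ) (hf : ∀ n p, f n p = f p n) (m : ℕ) :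
    ∑ n ∈ Finset.Icc 1 m, ∑ p ∈ Finset.Icc 1 m, f n p
      = ∑ n ∈ Finset.Icc 1 m, (2 * ∑ p ∈ Finset.Ico 1 n, f n p + f n n) := by
  induction m with
  | zero => simp
  | succ m ih =>
    have h : ∑ n ∈ Finset.Icc 1 m, f n (m + 1) = ∑ n ∈ Finset.Icc 1 m, f (m + 1) n :=
      Finset.sum_congr rfl fun n _ => hf _ _
    have h2 : Finset.Ico 1 (m + 1) = Finset.Icc 1 m := by ext; simp
    simp only [Finset.sum_Icc_succ_top (show 1 ≤ m + 1 by omega), Finset.sum_add_distrib, ih, h, h2]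
    ring

/-- The quadratic form of the product-integration weights against a symmetric positive semidefinite
array is nonnegative. This is the discrete analogue of the positivity of the Riemann–Liouville
integral. -/
theorem sum_piWeight_mul_nonneg {a : ℝ} (ha : 0 < a) (ha1 : a < 1) {t : ℕ → ℝ} {m : ℕ}
    (ht : ∀ n, 1 ≤ n → n ≤ m → t (n - 1) < t n) (G : ℕ → ℕ → ℝ) (hsymm : ∀ n p, G n p = G p n)
    (hG : ∀ c : ℕ → ℝ, 0 ≤ ∑ n ∈ Finset.Icc 1 m, ∑ p ∈ Finset.Icc 1 m, c n * c p * G n p) :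
    0 ≤ ∑ n ∈ Finset.Icc 1 m, ∑ p ∈ Finset.Icc 1 n,
      step t n * (piWeight a t n p * step t p) * G n p := by
  have hmono : ∀ i j, i ≤ j → j ≤ m → t i ≤ t j := by
    intro i j hij
    induction j, hij using Nat.le_induction with
    | base => intro; exact le_rfl
    | succ j hj ih =>
      intro hm
      have := ht (j + 1) (by omega) hm
      rw [Nat.add_sub_cancel] at this
      exact (ih (by omega)).trans this.le
  have key := sum_secondDifference_mul_nonneg (q := a + 1) (by linarith) (by linarith) t
    (Finset.Icc 1 m) G hG
  have hΓ : 0 < Real.Gamma (a + 2) := Real.Gamma_pos_of_pos (by linarith)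
  rw [sum_Icc_sum_Icc_of_symm] at key
  · have e : ∑ n ∈ Finset.Icc 1 m, ∑ p ∈ Finset.Icc 1 n,
        step t n * (piWeight a t n p * step t p) * G n p
        = 1 / (2 * Real.Gamma (a + 2)) * ∑ n ∈ Finset.Icc 1 m,
          (2 * ∑ p ∈ Finset.Ico 1 n, (|t n - t (p - 1)| ^ (a + 1) + |t (n - 1) - t p| ^ (a + 1)
            - |t n - t p| ^ (a + 1) - |t (n - 1) - t (p - 1)| ^ (a + 1)) * G n p
          + (|t n - t (n - 1)| ^ (a + 1) + |t (n - 1) - t n| ^ (a + 1)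
            - |t n - t n| ^ (a + 1) - |t (n - 1) - t (n - 1)| ^ (a + 1)) * G n n) := by
      rw [Finset.mul_sum]
      refine Finset.sum_congr rfl fun n hn => ?_
      obtain ⟨hn1, hnm⟩ := Finset.mem_Icc.1 hn
      have hlt := ht n hn1 hnm
      have hIcc : Finset.Icc 1 n = insert n (Finset.Ico 1 n) := by
        ext; simp; omega
      have ak : ∀ z : ℝ, abelKernel (a + 2) z = z ^ (a + 1) / Real.Gamma (a + 2) := fun z => by
        rw [abelKernel]; congr 2; ring
      rw [hIcc, Finset.sum_insert (by simp), piWeight_self ha hlt]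
      have e2 : ∑ p ∈ Finset.Ico 1 n, step t n * (piWeight a t n p * step t p) * G n p
          = 1 / Real.Gamma (a + 2) * ∑ p ∈ Finset.Ico 1 n,
            (|t n - t (p - 1)| ^ (a + 1) + |t (n - 1) - t p| ^ (a + 1)
            - |t n - t p| ^ (a + 1) - |t (n - 1) - t (p - 1)| ^ (a + 1)) * G n p := by
        rw [Finset.mul_sum]
        refine Finset.sum_congr rfl fun p hp => ?_
        obtain ⟨hp1, hpn⟩ := Finset.mem_Ico.1 hp
        have g1 := hmono p (n - 1) (by omega) (by omega)
        have g2 := ht p hp1 (by omega)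
        rw [piWeight_eq_of_lt ha g1 hlt g2, abs_of_nonneg (by linarith : 0 ≤ t n - t (p - 1)),
          abs_of_nonneg (by linarith : 0 ≤ t (n - 1) - t p),
          abs_of_nonneg (by linarith : 0 ≤ t n - t p),
          abs_of_nonneg (by linarith : 0 ≤ t (n - 1) - t (p - 1))]
        simp only [ak]
        ring
      rw [e2, ak, abs_sub_comm (t (n - 1)) (t n), abs_of_pos (by linarith : 0 < t n - t (n - 1))]
      simp only [sub_self, abs_zero, Real.zero_rpow (by linarith : a + 1 ≠ 0)]
      field_simp
      ring
    rw [e]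
    exact mul_nonneg (by positivity) key
  · intro n p
    rw [hsymm n p, abs_sub_comm (t n) (t (p - 1)), abs_sub_comm (t (n - 1)) (t p),
      abs_sub_comm (t n) (t p), abs_sub_comm (t (n - 1)) (t (p - 1))]
    ring

/-! ### Stability of the scheme -/

/-- Discrete Grönwall inequality in summed form. -/
lemma le_mul_exp_of_le_add_sum {y μ : ℕ → ℝ} {K : ℝ} {N : ℕ} (hK : 0 ≤ K) (hμ : ∀ n, 0 ≤ μ n)
    (h : ∀ n, 1 ≤ n → n ≤ N → y n ≤ K + ∑ i ∈ Finset.Ico 1 n, μ i * y i) {n : ℕ} (hn : 1 ≤ n)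
    (hnN : n ≤ N) : y n ≤ K * Real.exp (∑ i ∈ Finset.Ico 1 n, μ i) := by
  have main : ∀ j, 1 ≤ j → j ≤ N →
      K + ∑ i ∈ Finset.Ico 1 j, μ i * y i ≤ K * Real.exp (∑ i ∈ Finset.Ico 1 j, μ i) := by
    intro j hj
    induction j, hj using Nat.le_induction with
    | base => simp
    | succ j hj ih =>
      intro hjN
      have h1 := ih (by omega)
      have h2 := h j hj (by omega)
      rw [Finset.sum_Ico_succ_top hj, Finset.sum_Ico_succ_top hj, Real.exp_add]
      have h3 := Real.add_one_le_exp (μ j)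
      have h4 : 0 ≤ K * Real.exp (∑ i ∈ Finset.Ico 1 j, μ i) := by positivity
      have h5 := mul_le_mul_of_nonneg_left (h2.trans h1) (hμ j)
      have h6 := mul_le_mul_of_nonneg_left h3 h4
      nlinarith
  exact (h n hn hnN).trans (main n hn hnN)

lemma sum_Icc_sub_pred (S : ℕ → ℝ) (n : ℕ) :
    ∑ i ∈ Finset.Icc 1 n, (S i - S (i - 1)) = S n - S 0 := by
  induction n with
  | zero => simp
  | succ n ih => rw [Finset.sum_Icc_succ_top (by omega), ih, Nat.add_sub_cancel]; ring

lemma sum_step_eq (t : ℕ → ℝ) (n : ℕ) : ∑ i ∈ Finset.Icc 1 n, step t i = t n - t 0 :=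
  sum_Icc_sub_pred t n

variable {H : Type u} [NormedAddCommGroup H] [InnerProductSpace ℝ H]

lemma stage_one (e : ℕ → H) : stage e 1 = e 1 := by simp [stage]

lemma stage_of_two_le (e : ℕ → H) {n : ℕ} (hn : 2 ≤ n) :
    stage e n = (1 / 2 : ℝ) • (e n + e (n - 1)) := by
  rw [stage, if_neg (by omega)]

lemma norm_stage_le {e : ℕ → H} {n : ℕ} {X : ℝ} (h1 : ‖e n‖ ≤ X) (h2 : ‖e (n - 1)‖ ≤ X) :
    ‖stage e n‖ ≤ X := by
  rw [stage]
  split_ifs with h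
  · rwa [h] at h1
  · rw [norm_smul, Real.norm_of_nonneg (by norm_num)]
    linarith [norm_add_le (e n) (e (n - 1))]

lemma norm_stage_sq_le (e : ℕ → H) {n : ℕ} (hn : 2 ≤ n) :
    ‖stage e n‖ ^ 2 ≤ (‖e n‖ ^ 2 + ‖e (n - 1)‖ ^ 2) / 2 := by
  have h : ‖stage e n‖ ≤ (‖e n‖ + ‖e (n - 1)‖) / 2 := by
    rw [stage_of_two_le e hn, norm_smul, Real.norm_of_nonneg (by norm_num)]
    linarith [norm_add_le (e n) (e (n - 1))]
  have h0 := norm_nonneg (stage e n)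
  nlinarith [sq_nonneg (‖e n‖ - ‖e (n - 1)‖)]

lemma half_norm_sq_le_sum_inner {e : ℕ → H} (he : e 0 = 0) {m : ℕ} (hm : 1 ≤ m) :
    (‖e m‖ ^ 2 + ‖e 1‖ ^ 2) / 2
      = ∑ n ∈ Finset.Icc 1 m, ⟪e n - e (n - 1), stage e n⟫_ℝ := by
  induction m, hm using Nat.le_induction with
  | base => simp [stage_one, he]
  | succ m hm ih =>
    rw [Finset.sum_Icc_succ_top (by omega), ← ih, stage_of_two_le e (by omega),
      Nat.add_sub_cancel, inner_smul_right, inner_add_right, inner_sub_left, inner_sub_left,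
      real_inner_self_eq_norm_sq, real_inner_self_eq_norm_sq, real_inner_comm (e (m + 1)) (e m)]
    ring

/-- Energy stability: if the operator terms `x n` are nonnegative in the summed sense, then the
maximal error is bounded by the sum of the residuals. -/
theorem norm_le_sum_norm_residual {κ θ T : ℝ} (hκ : 0 ≤ κ) (hθ1 : θ < 1) {N : ℕ} {t : ℕ → ℝ}
    (ht0 : t 0 = 0) (htT : t N ≤ T) (hstep : ∀ n, 1 ≤ n → n ≤ N → t (n - 1) < t n)
    (hκθ : ∀ n, 1 ≤ n → n ≤ N → κ * step t n ≤ θ) {e x ρ : ℕ → H} (he : e 0 = 0)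
    (heq : ∀ n, 1 ≤ n → n ≤ N →
      e n - e (n - 1) + x n - (κ * step t n) • stage e n = ρ n)
    (hx : ∀ m, 1 ≤ m → m ≤ N → 0 ≤ ∑ n ∈ Finset.Icc 1 m, ⟪x n, stage e n⟫_ℝ)
    {n : ℕ} (hn : 1 ≤ n) (hnN : n ≤ N) :
    ‖e n‖ ≤ 2 / (1 - θ) * Real.exp (3 * κ * T / (1 - θ)) * ∑ n ∈ Finset.Icc 1 N, ‖ρ n‖ := by
  have hk : ∀ i, 1 ≤ i → i ≤ N → 0 < step t i := fun i h1 h2 => sub_pos.2 (hstep i h1 h2)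
  have hθ' : 0 < 1 - θ := by linarith
  obtain ⟨M, hM, hmax⟩ := (Finset.Icc 1 N).exists_max_image (fun i => ‖e i‖)
    ⟨n, Finset.mem_Icc.2 ⟨hn, hnN⟩⟩
  obtain ⟨hM1, hMN⟩ := Finset.mem_Icc.1 hM
  set X := ‖e M‖ with hX
  set R := ∑ n ∈ Finset.Icc 1 N, ‖ρ n‖ with hR
  have hX0 : 0 ≤ X := norm_nonneg _
  have hR0 : 0 ≤ R := Finset.sum_nonneg fun _ _ => norm_nonneg _
  have heX : ∀ i, i ≤ N → ‖e i‖ ≤ X := by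
    intro i hi
    rcases Nat.eq_zero_or_pos i with h | h
    · rw [h, he, norm_zero]; exact hX0
    · exact hmax i (Finset.mem_Icc.2 ⟨h, hi⟩)
  -- The Grönwall weights: `‖e i‖²` enters the stages `i` and `i + 1`, the latter only if `i < N`.
  set μ : ℕ → ℝ := fun i => if i ∈ Finset.Icc 1 N then
    κ * (2 * step t i + if i + 1 ≤ N then step t (i + 1) else 0) / (1 - θ) else 0 with hμ
  have hμ0 : ∀ i, 0 ≤ μ i := by
    intro i
    simp only [hμ]
    split_ifs with h1 h2
    · obtain ⟨h3, h4⟩ := Finset.mem_Icc.1 h1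
      have := hk i h3 h4
      have := hk (i + 1) (by omega) h2
      positivity
    · obtain ⟨h3, h4⟩ := Finset.mem_Icc.1 h1
      have := hk i h3 h4
      positivity
    · exact le_rfl
  have hmain : ∀ m, 1 ≤ m → m ≤ N →
      ‖e m‖ ^ 2 ≤ 2 * R * X / (1 - θ) + ∑ i ∈ Finset.Ico 1 m, μ i * ‖e i‖ ^ 2 := by
    intro m hm hmN
    -- The scheme tested with the stages and summed; the nonnegative operator terms are dropped.
    have henergy : (‖e m‖ ^ 2 + ‖e 1‖ ^ 2) / 2
        ≤ ∑ n ∈ Finset.Icc 1 m, κ * step t n * ‖stage e n‖ ^ 2 + R * X := by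
      rw [half_norm_sq_le_sum_inner he hm]
      have h1 : ∑ n ∈ Finset.Icc 1 m, ⟪e n - e (n - 1), stage e n⟫_ℝ
          = ∑ n ∈ Finset.Icc 1 m, κ * step t n * ‖stage e n‖ ^ 2
            - ∑ n ∈ Finset.Icc 1 m, ⟪x n, stage e n⟫_ℝ
            + ∑ n ∈ Finset.Icc 1 m, ⟪ρ n, stage e n⟫_ℝ := by
        rw [← Finset.sum_sub_distrib, ← Finset.sum_add_distrib]
        refine Finset.sum_congr rfl fun i hi => ?_
        obtain ⟨h1, h2⟩ := Finset.mem_Icc.1 hi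
        rw [← heq i h1 (h2.trans hmN)]
        simp only [inner_sub_left, inner_add_left, real_inner_smul_left,
          real_inner_self_eq_norm_sq]
        ring
      have h2 : ∑ n ∈ Finset.Icc 1 m, ⟪ρ n, stage e n⟫_ℝ ≤ R * X := by
        rw [hR, Finset.sum_mul]
        calc ∑ n ∈ Finset.Icc 1 m, ⟪ρ n, stage e n⟫_ℝ ≤ ∑ n ∈ Finset.Icc 1 m, ‖ρ n‖ * X := by
              refine Finset.sum_le_sum fun i hi => (real_inner_le_norm _ _).trans ?_
              obtain ⟨h1, h2⟩ := Finset.mem_Icc.1 hi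
              exact mul_le_mul_of_nonneg_left
                (norm_stage_le (heX _ (by omega)) (heX _ (by omega))) (norm_nonneg _)
          _ ≤ ∑ n ∈ Finset.Icc 1 N, ‖ρ n‖ * X :=
              Finset.sum_le_sum_of_subset_of_nonneg (Finset.Icc_subset_Icc_right hmN)
                fun _ _ _ => mul_nonneg (norm_nonneg _) hX0
      linarith [hx m hm hmN]
    -- The term with `‖e m‖²` on the right carries the factor `κ k_m ≤ θ` and is absorbed.
    have hdiv : (1 - θ) * ‖e m‖ ^ 2 ≤ 2 * R * X
        + ∑ i ∈ Finset.Ico 1 m, κ * (2 * step t i + step t (i + 1)) * ‖e i‖ ^ 2 := by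
      rcases hm.eq_or_lt with h | h
      · subst h
        have := mul_le_mul_of_nonneg_right (hκθ 1 le_rfl hmN) (sq_nonneg ‖e 1‖)
        simp only [Finset.Icc_self, Finset.sum_singleton, stage_one] at henergy
        have hRX : 0 ≤ R * X := mul_nonneg hR0 hX0
        simp only [Finset.Ico_self, Finset.sum_empty]
        nlinarith
      · obtain ⟨j, rfl⟩ : ∃ j, m = j + 1 := ⟨m - 1, by omega⟩
        have hj : 1 ≤ j := by omega
        have claim : ∀ j, 1 ≤ j → j + 1 ≤ N →
            ∑ n ∈ Finset.Icc 1 (j + 1), κ * step t n * ‖stage e n‖ ^ 2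
            ≤ κ * step t (j + 1) * ‖e (j + 1)‖ ^ 2 / 2
              + (∑ i ∈ Finset.Ico 1 (j + 1), κ * (2 * step t i + step t (i + 1)) * ‖e i‖ ^ 2) / 2 := by
          intro j hj
          induction j, hj using Nat.le_induction with
          | base =>
            intro h
            have h2 := norm_stage_sq_le e (le_refl 2)
            have h3 := mul_nonneg hκ (hk 2 (by omega) h).le
            have := mul_le_mul_of_nonneg_left h2 h3
            rw [Finset.sum_Icc_succ_top (by omega)]
            simp only [Finset.Icc_self, Finset.sum_singleton, stage_one, Nat.Ico_succ_singleton,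
              Nat.reduceAdd, Nat.add_one_sub_one] at this ⊢
            linarith
          | succ j hj ih =>
            intro h
            have h2 := norm_stage_sq_le e (n := j + 1 + 1) (by omega)
            have h3 := mul_nonneg hκ (hk (j + 1 + 1) (by omega) h).le
            have h4 := mul_le_mul_of_nonneg_left h2 h3
            have h5 := ih (by omega)
            have h6 : 0 ≤ κ * step t (j + 1) * ‖e (j + 1)‖ ^ 2 :=
              mul_nonneg (mul_nonneg hκ (hk (j + 1) (by omega) (by omega)).le) (sq_nonneg _)
            rw [Nat.add_sub_cancel] at h4
            rw [Finset.sum_Icc_succ_top (by omega), Finset.sum_Ico_succ_top (by omega)]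
            linarith
        have h1 := claim j hj hmN
        have h2 := mul_le_mul_of_nonneg_right (hκθ (j + 1) hm hmN) (sq_nonneg ‖e (j + 1)‖)
        have h3 := sq_nonneg ‖e 1‖
        linarith
    have hsum : ∑ i ∈ Finset.Ico 1 m, μ i * ‖e i‖ ^ 2
        = (∑ i ∈ Finset.Ico 1 m, κ * (2 * step t i + step t (i + 1)) * ‖e i‖ ^ 2) / (1 - θ) := by
      rw [Finset.sum_div]
      refine Finset.sum_congr rfl fun i hi => ?_
      obtain ⟨h1, h2⟩ := Finset.mem_Ico.1 hi
      simp only [hμ]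
      rw [if_pos (Finset.mem_Icc.2 ⟨h1, by omega⟩), if_pos (by omega)]
      ring
    rw [hsum, ← add_div, le_div_iff₀ hθ']
    linarith
  have hgron := le_mul_exp_of_le_add_sum (by positivity) hμ0 hmain hM1 hMN
  have hμsum : ∑ i ∈ Finset.Ico 1 M, μ i ≤ 3 * κ * T / (1 - θ) := by
    have hk' : ∀ i ∈ Finset.Icc 1 N, 0 ≤ step t i := fun i hi =>
      (hk i (Finset.mem_Icc.1 hi).1 (Finset.mem_Icc.1 hi).2).le
    have hT : ∑ i ∈ Finset.Icc 1 N, step t i ≤ T := by rw [sum_step_eq, ht0]; linarith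
    have h1 : ∑ i ∈ Finset.Ico 1 M, step t i ≤ ∑ i ∈ Finset.Icc 1 N, step t i :=
      Finset.sum_le_sum_of_subset_of_nonneg
        (fun i hi => by simp only [Finset.mem_Ico, Finset.mem_Icc] at *; omega)
        fun i hi _ => hk' i hi
    have h2 : ∑ i ∈ Finset.Ico 1 M, step t (i + 1) ≤ ∑ i ∈ Finset.Icc 1 N, step t i := by
      rw [Finset.sum_Ico_add' (fun i => step t i) 1 M 1]
      exact Finset.sum_le_sum_of_subset_of_nonneg
        (fun i hi => by simp only [Finset.mem_Ico, Finset.mem_Icc] at *; omega)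
        fun i hi _ => hk' i hi
    have h3 : ∑ i ∈ Finset.Ico 1 M, μ i
        = κ * (2 * ∑ i ∈ Finset.Ico 1 M, step t i + ∑ i ∈ Finset.Ico 1 M, step t (i + 1))
          / (1 - θ) := by
      rw [Finset.mul_sum, ← Finset.sum_add_distrib, Finset.mul_sum, Finset.sum_div]
      refine Finset.sum_congr rfl fun i hi => ?_
      obtain ⟨h1, h2⟩ := Finset.mem_Ico.1 hi
      simp only [hμ]
      rw [if_pos (Finset.mem_Icc.2 ⟨h1, by omega⟩), if_pos (by omega)]
    rw [h3]
    refine div_le_div_of_nonneg_right ?_ hθ'.le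
    rw [mul_comm 3 κ, mul_assoc]
    exact mul_le_mul_of_nonneg_left (by linarith) hκ
  set E := Real.exp (3 * κ * T / (1 - θ)) with hE
  have hfin : X * X ≤ 2 / (1 - θ) * E * R * X := by
    have h1 : X ^ 2 ≤ 2 * R * X / (1 - θ) * E :=
      hgron.trans (mul_le_mul_of_nonneg_left (Real.exp_le_exp.2 hμsum) (by positivity))
    calc X * X = X ^ 2 := by ring
      _ ≤ _ := h1
      _ = _ := by ring
  refine (heX n hnN).trans ?_
  rcases hX0.eq_or_lt with h | h
  · rw [← h]; positivity
  · exact le_of_mul_le_mul_right hfin h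

/-! ### Unbounded operators as total functions -/

lemma app_of_mem (A : H →ₗ.[ℝ] H) {x : H} (hx : x ∈ A.domain) : app A x = A ⟨x, hx⟩ := dif_pos hx

lemma app_add (A : H →ₗ.[ℝ] H) {x y : H} (hx : x ∈ A.domain) (hy : y ∈ A.domain) :
    app A (x + y) = app A x + app A y := by
  rw [app_of_mem A hx, app_of_mem A hy, app_of_mem A (add_mem hx hy), ← A.map_add]
  rfl

lemma app_sub (A : H →ₗ.[ℝ] H) {x y : H} (hx : x ∈ A.domain) (hy : y ∈ A.domain) :
    app A (x - y) = app A x - app A y := by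
  rw [app_of_mem A hx, app_of_mem A hy, app_of_mem A (sub_mem hx hy), ← A.map_sub]
  rfl

lemma app_smul (A : H →ₗ.[ℝ] H) (c : ℝ) {x : H} (hx : x ∈ A.domain) :
    app A (c • x) = c • app A x := by
  rw [app_of_mem A hx, app_of_mem A (A.domain.smul_mem c hx), ← A.map_smul]
  rfl

lemma app_sum (A : H →ₗ.[ℝ] H) {s : Finset ℕ} {x : ℕ → H} (hx : ∀ i ∈ s, x i ∈ A.domain) :
    app A (∑ i ∈ s, x i) = ∑ i ∈ s, app A (x i) := by
  induction s using Finset.cons_induction with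
  | empty =>
    have h := app_smul A 0 (A.domain.zero_mem)
    rw [zero_smul, zero_smul] at h
    simpa using h
  | cons i s hi ih =>
    have h1 : ∀ j ∈ s, x j ∈ A.domain := fun j hj => hx j (Finset.mem_cons_of_mem hj)
    rw [Finset.sum_cons, Finset.sum_cons, app_add A (hx i (Finset.mem_cons_self i s))
      (sum_mem h1), ih h1]

lemma stage_mem {D : Submodule ℝ H} {V : ℕ → H} {n : ℕ} (hn : 1 ≤ n)
    (hV : ∀ i, 1 ≤ i → i ≤ n → V i ∈ D) : stage V n ∈ D := by
  rcases hn.eq_or_lt with h | h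
  · rw [← h, stage_one]; exact hV 1 le_rfl hn
  · rw [stage_of_two_le V h]
    exact D.smul_mem _ (add_mem (hV n hn le_rfl) (hV (n - 1) (by omega) (by omega)))

lemma app_stage (A : H →ₗ.[ℝ] H) {V : ℕ → H} {n : ℕ} (hn : 1 ≤ n)
    (hV : ∀ i, 1 ≤ i → i ≤ n → V i ∈ A.domain) :
    app A (stage V n) = stage (fun i => app A (V i)) n := by
  rcases hn.eq_or_lt with h | h
  · rw [← h, stage_one, stage_one]
  · have h1 := hV n hn le_rfl
    have h2 := hV (n - 1) (by omega) (by omega)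
    rw [stage_of_two_le V h, stage_of_two_le _ h, app_smul A _ (add_mem h1 h2), app_add A h1 h2]

lemma stage_sub (V W : ℕ → H) (n : ℕ) :
    stage (fun i => V i - W i) n = stage V n - stage W n := by
  simp only [stage]
  split_ifs
  · rfl
  · rw [← smul_sub]; congr 1; abel

lemma norm_le_of_abs_inner_le {D : Set H} (hD : Dense D) {y : H} {C : ℝ} (hC : 0 ≤ C)
    (h : ∀ z ∈ D, |⟪y, z⟫_ℝ| ≤ C * ‖z‖) : ‖y‖ ≤ C := by
  have h1 : ⟪y, y⟫_ℝ ≤ C * ‖y‖ := hD.induction (P := fun z => ⟪y, z⟫_ℝ ≤ C * ‖z‖)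
    (fun z hz => (le_abs_self _).trans (h z hz)) (isClosed_le (by fun_prop) (by fun_prop)) y
  rw [real_inner_self_eq_norm_sq] at h1
  rcases (norm_nonneg y).eq_or_lt with h0 | h0
  · rwa [← h0]
  · nlinarith

section SelfAdjoint

variable [CompleteSpace H]

lemma app_symm {A : H →ₗ.[ℝ] H} (hA : IsSelfAdjoint A) {x y : H} (hx : x ∈ A.domain)
    (hy : y ∈ A.domain) : ⟪app A x, y⟫_ℝ = ⟪x, app A y⟫_ℝ := by
  have h := LinearPMap.adjoint_isFormalAdjoint hA.dense_domain
  rw [LinearPMap.isSelfAdjoint_def.1 hA] at h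
  rw [app_of_mem A hx, app_of_mem A hy]
  exact h ⟨x, hx⟩ ⟨y, hy⟩

/-- The domain of a self-adjoint operator consists of the `w` for which `z ↦ (w, A z)` is bounded. -/
lemma mem_domain_of_abs_inner_le {A : H →ₗ.[ℝ] H} (hA : IsSelfAdjoint A) {w : H} {C : ℝ}
    (h : ∀ z ∈ A.domain, |⟪w, app A z⟫_ℝ| ≤ C * ‖z‖) : w ∈ A.domain := by
  rw [← LinearPMap.isSelfAdjoint_def.1 hA, LinearPMap.mem_adjoint_domain_iff]
  refine AddMonoidHomClass.continuous_of_bound _ C fun z => ?_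
  have := h z z.2
  rw [app_of_mem A z.2] at this
  exact this

lemma norm_app_le_of_abs_inner_le {A : H →ₗ.[ℝ] H} (hA : IsSelfAdjoint A) {w : H} {C : ℝ} (hC : 0 ≤ C)
    (hw : w ∈ A.domain) (h : ∀ z ∈ A.domain, |⟪w, app A z⟫_ℝ| ≤ C * ‖z‖) : ‖app A w‖ ≤ C :=
  norm_le_of_abs_inner_le hA.dense_domain hC fun z hz => by
    rw [app_symm hA hw hz]; exact h z hz

/-- Operators dominated by `A` are bounded relative to `A`. -/
lemma IsDominated.norm_app_le {A B : H →ₗ.[ℝ] H} {M : ℝ} (hB : IsDominated A B M)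
    (hA : IsSelfAdjoint A) (hM : 0 ≤ M) {w : H} (hw : w ∈ A.domain) :
    ‖app B w‖ ≤ M * ‖app A w‖ :=
  norm_le_of_abs_inner_le hA.dense_domain (by positivity) fun z hz => hB.bound_zero w hw z hz

lemma IsElliptic.norm_le {A : H →ₗ.[ℝ] H} {lam : ℝ} (hA : IsElliptic A lam) (hlam : 0 < lam)
    {w : H} (hw : w ∈ A.domain) : ‖w‖ ≤ 1 / lam * ‖app A w‖ := by
  have h1 := (hA.lower_bound w hw).trans (real_inner_le_norm _ _)
  rw [one_div, ← div_eq_inv_mul, le_div_iff₀ hlam]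
  rcases (norm_nonneg w).eq_or_lt with h | h
  · rw [← h, zero_mul]; exact norm_nonneg _
  · refine le_of_mul_le_mul_right ?_ h
    linarith

end SelfAdjoint

/-! ### Regularity of the exact solution -/

/-- The integrated form of `‖b'(t)‖ ≤ L t^{α-1}`, `‖b''(t)‖ ≤ L t^{α-2}` on `(0, T)`: a Hölder
and a Lipschitz estimate, and an estimate for second divided differences. No derivative of `b` is
required to exist. -/
structure IsGradedSmooth (α T L : ℝ) (b : ℝ → H) : Prop where
  holder : ∀ s t, 0 ≤ s → s ≤ t → t ≤ T → ‖b t - b s‖ ≤ L * (t ^ α - s ^ α)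
  lipschitz : ∀ s t, 0 < s → s ≤ t → t ≤ T → ‖b t - b s‖ ≤ L * (t - s) * s ^ (α - 1)
  three_point : ∀ s τ t, 0 < s → s ≤ τ → τ ≤ t → t ≤ T →
    ‖(t - s) • b τ - (t - τ) • b s - (τ - s) • b t‖ ≤ L * ((t - s) * (t - τ) * (τ - s)) * s ^ (α - 2)

lemma IsGradedSmooth.continuousOn {α T L : ℝ} (hα : 0 < α) {b : ℝ → H}
    (hb : IsGradedSmooth α T L b) : ContinuousOn b (Icc 0 T) := by
  intro x hx
  have h1 : ∀ s ∈ Icc 0 T, ‖b s - b x‖ ≤ |L| * |s ^ α - x ^ α| := by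
    intro s hs
    rw [← abs_mul]
    rcases le_total s x with h | h
    · rw [norm_sub_rev, ← abs_neg, ← mul_neg, neg_sub]
      exact (hb.holder s x hs.1 h hx.2).trans (le_abs_self _)
    · exact (hb.holder x s hx.1 h hs.2).trans (le_abs_self _)
  have h2 : Filter.Tendsto (fun s : ℝ => |L| * |s ^ α - x ^ α|) (nhdsWithin x (Icc 0 T))
      (nhds 0) := by
    have : Continuous fun s : ℝ => |L| * |s ^ α - x ^ α| :=
      continuous_const.mul ((Real.continuous_rpow_const hα.le).sub continuous_const).abs
    have h := this.tendsto x
    simp only [sub_self, abs_zero, mul_zero] at h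
    exact h.mono_left nhdsWithin_le_nhds
  have h3 : Filter.Tendsto (fun s => b s - b x) (nhdsWithin x (Icc 0 T)) (nhds 0) :=
    squeeze_zero_norm' (Filter.eventually_of_mem self_mem_nhdsWithin h1) h2
  exact tendsto_sub_nhds_zero_iff.1 h3

lemma abs_sub_le_rpow {α T C : ℝ} (hα : 0 < α) {φ φ' : ℝ → ℝ}
    (hcont : ContinuousOn φ (Icc 0 T)) (hφ : ∀ t ∈ Ioo 0 T, HasDerivAt φ (φ' t) t)
    (hφ' : ∀ t ∈ Ioo 0 T, |φ' t| ≤ C * t ^ (α - 1)) {s t : ℝ} (hs : 0 ≤ s) (hst : s ≤ t)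
    (ht : t ≤ T) : |φ t - φ s| ≤ C / α * (t ^ α - s ^ α) := by
  rcases hst.eq_or_lt with rfl | hst
  · simp
  obtain ⟨ξ, hξ, h⟩ := exists_ratio_hasDerivAt_eq_ratio_slope φ φ' hst
    (hcont.mono (Icc_subset_Icc hs ht)) (fun x hx => hφ x ⟨hs.trans_lt hx.1, hx.2.trans_le ht⟩)
    (fun x => x ^ α) (fun x => α * x ^ (α - 1)) (Real.continuous_rpow_const hα.le).continuousOn
    (fun x hx => Real.hasDerivAt_rpow_const (Or.inl (hs.trans_lt hx.1).ne'))
  have hξ0 : 0 < ξ := hs.trans_lt hξ.1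
  have h1 := Real.rpow_pos_of_pos hξ0 (α - 1)
  have h2 : s ^ α ≤ t ^ α := Real.rpow_le_rpow hs hst.le hα.le
  have h3 := hφ' ξ ⟨hξ0, hξ.2.trans_le ht⟩
  have h4 : |φ t - φ s| * (α * ξ ^ (α - 1)) ≤ C / α * (t ^ α - s ^ α) * (α * ξ ^ (α - 1)) := by
    have h5 := congrArg abs h
    rw [abs_mul, abs_mul, abs_of_nonneg (by linarith : (0 : ℝ) ≤ t ^ α - s ^ α),
      abs_of_pos (by positivity : (0 : ℝ) < α * ξ ^ (α - 1))] at h5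
    rw [← h5]
    have h6 := mul_le_mul_of_nonneg_left h3 (by linarith : (0 : ℝ) ≤ t ^ α - s ^ α)
    calc _ ≤ _ := h6
      _ = _ := by field_simp
  exact le_of_mul_le_mul_right h4 (by positivity)

lemma abs_sub_le_mul_rpow {α T C : ℝ} (hα1 : α ≤ 1) (hC : 0 ≤ C) {φ φ' : ℝ → ℝ}
    (hcont : ContinuousOn φ (Icc 0 T)) (hφ : ∀ t ∈ Ioo 0 T, HasDerivAt φ (φ' t) t)
    (hφ' : ∀ t ∈ Ioo 0 T, |φ' t| ≤ C * t ^ (α - 1)) {s t : ℝ} (hs : 0 < s) (hst : s ≤ t)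
    (ht : t ≤ T) : |φ t - φ s| ≤ C * (t - s) * s ^ (α - 1) := by
  rcases hst.eq_or_lt with rfl | hst
  · simp
  obtain ⟨ξ, hξ, h⟩ := exists_hasDerivAt_eq_slope φ φ' hst
    (hcont.mono (Icc_subset_Icc hs.le ht)) (fun x hx => hφ x ⟨hs.trans hx.1, hx.2.trans_le ht⟩)
  have h0 : 0 < t - s := by linarith
  have h1 : φ t - φ s = φ' ξ * (t - s) := by rw [h]; field_simp
  have h2 := hφ' ξ ⟨hs.trans hξ.1, hξ.2.trans_le ht⟩
  have h3 : ξ ^ (α - 1) ≤ s ^ (α - 1) := Real.rpow_le_rpow_of_nonpos hs hξ.1.le (by linarith)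
  rw [h1, abs_mul, abs_of_pos h0]
  calc |φ' ξ| * (t - s) ≤ C * s ^ (α - 1) * (t - s) :=
        mul_le_mul_of_nonneg_right (h2.trans (mul_le_mul_of_nonneg_left h3 hC)) h0.le
    _ = _ := by ring

lemma abs_three_point_le {α T C : ℝ} (hα : α ≤ 2) (hC : 0 ≤ C) {φ φ' φ'' : ℝ → ℝ}
    (hcont : ContinuousOn φ (Icc 0 T)) (hφ : ∀ t ∈ Ioo 0 T, HasDerivAt φ (φ' t) t)
    (hφ' : ∀ t ∈ Ioo 0 T, HasDerivAt φ' (φ'' t) t)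
    (hφ'' : ∀ t ∈ Ioo 0 T, |φ'' t| ≤ C * t ^ (α - 2)) {s τ t : ℝ} (hs : 0 < s) (hsτ : s ≤ τ)
    (hτt : τ ≤ t) (ht : t ≤ T) :
    |(t - s) * φ τ - (t - τ) * φ s - (τ - s) * φ t|
      ≤ C * ((t - s) * (t - τ) * (τ - s)) * s ^ (α - 2) := by
  rcases hsτ.eq_or_lt with rfl | hsτ
  · simp
  rcases hτt.eq_or_lt with rfl | hτt
  · simp
  obtain ⟨ξ, hξ, h⟩ := exists_hasDerivAt_eq_slope φ φ' hsτ
    (hcont.mono (Icc_subset_Icc hs.le (by linarith)))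
    (fun x hx => hφ x ⟨hs.trans hx.1, by linarith [hx.2]⟩)
  obtain ⟨η, hη, h'⟩ := exists_hasDerivAt_eq_slope φ φ' hτt
    (hcont.mono (Icc_subset_Icc (by linarith) (by linarith)))
    (fun x hx => hφ x ⟨by linarith [hx.1], by linarith [hx.2]⟩)
  have hξη : ξ < η := hξ.2.trans hη.1
  obtain ⟨ζ, hζ, h''⟩ := exists_hasDerivAt_eq_slope φ' φ'' hξη
    (fun x hx => (hφ' x ⟨by linarith [hx.1, hξ.1], by linarith [hx.2, hη.2]⟩
      ).continuousAt.continuousWithinAt)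
    (fun x hx => hφ' x ⟨by linarith [hx.1, hξ.1], by linarith [hx.2, hη.2]⟩)
  have e1 : φ τ - φ s = φ' ξ * (τ - s) := by
    have : τ - s ≠ 0 := by linarith
    rw [h]; field_simp
  have e2 : φ t - φ τ = φ' η * (t - τ) := by
    have : t - τ ≠ 0 := by linarith
    rw [h']; field_simp
  have e3 : φ' η - φ' ξ = φ'' ζ * (η - ξ) := by
    have : η - ξ ≠ 0 := by linarith
    rw [h'']; field_simp
  have e : (t - s) * φ τ - (t - τ) * φ s - (τ - s) * φ t
      = -((t - τ) * (τ - s) * (φ'' ζ * (η - ξ))) := by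
    linear_combination (t - τ) * e1 - (τ - s) * e2 - (t - τ) * (τ - s) * e3
  have b1 := hφ'' ζ ⟨by linarith [hζ.1, hξ.1], by linarith [hζ.2, hη.2]⟩
  have b2 : ζ ^ (α - 2) ≤ s ^ (α - 2) :=
    Real.rpow_le_rpow_of_nonpos hs (by linarith [hζ.1, hξ.1]) (by linarith)
  have p1 : 0 ≤ (t - τ) * (τ - s) := mul_nonneg (by linarith) (by linarith)
  have p2 : 0 ≤ η - ξ := by linarith
  have p3 : 0 ≤ C * s ^ (α - 2) := mul_nonneg hC (Real.rpow_nonneg hs.le _)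
  rw [e, abs_neg, abs_mul, abs_mul (φ'' ζ), abs_of_nonneg p1, abs_of_nonneg p2]
  calc (t - τ) * (τ - s) * (|φ'' ζ| * (η - ξ))
      ≤ (t - τ) * (τ - s) * (C * s ^ (α - 2) * (t - s)) := by
        refine mul_le_mul_of_nonneg_left ?_ p1
        exact mul_le_mul (b1.trans (mul_le_mul_of_nonneg_left b2 hC))
          (by linarith [hξ.1, hη.2]) p2 p3
    _ = _ := by ring

section Regularity

variable {A : H →ₗ.[ℝ] H} {α T M lam : ℝ} {v : ℝ → H}

lemma hasDerivAt_inner_right {w : ℝ → H} {t : ℝ} (hw : DifferentiableAt ℝ w t) (y : H) :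
    HasDerivAt (fun τ => ⟪w τ, y⟫_ℝ) ⟪deriv w t, y⟫_ℝ t := by
  simpa using hw.hasDerivAt.inner ℝ (hasDerivAt_const t y)

lemma norm_app_deriv_le (hv : IsRegularSolution A α T M v) {t : ℝ} (ht : t ∈ Ioo 0 T) :
    ‖app A (deriv v t)‖ ≤ M * t ^ (α - 1) := by
  have h1 := hv.bound t ht
  have h2 := mul_nonneg ht.1.le (norm_nonneg (app A (deriv (deriv v) t)))
  linarith [norm_nonneg (deriv (deriv v) t)]

lemma norm_app_deriv_deriv_le (hv : IsRegularSolution A α T M v) {t : ℝ} (ht : t ∈ Ioo 0 T) :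
    ‖app A (deriv (deriv v) t)‖ ≤ M * t ^ (α - 2) := by
  have h1 := hv.bound t ht
  have h2 : t * ‖app A (deriv (deriv v) t)‖ ≤ t * (M * t ^ (α - 2)) := by
    have e : t * (M * t ^ (α - 2)) = M * t ^ (α - 1) := by
      have : α - 1 = α - 2 + 1 := by ring
      rw [this, Real.rpow_add_one ht.1.ne']; ring
    rw [e]
    linarith [norm_nonneg (deriv (deriv v) t), norm_nonneg (app A (deriv v t))]
  exact le_of_mul_le_mul_left h2 ht.1

lemma continuousOn_inner_right (hcont : ContinuousOn v (Icc 0 T)) (y : H) :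
    ContinuousOn (fun τ => ⟪v τ, y⟫_ℝ) (Icc 0 T) := hcont.inner continuousOn_const

variable [CompleteSpace H]

lemma abs_inner_deriv_le (hA : IsSelfAdjoint A) (hv : IsRegularSolution A α T M v) {z : H}
    (hz : z ∈ A.domain) {t : ℝ} (ht : t ∈ Ioo 0 T) :
    |⟪deriv v t, app A z⟫_ℝ| ≤ M * ‖z‖ * t ^ (α - 1) := by
  rw [← app_symm hA (hv.mem_domain t ht).1 hz]
  have h1 := mul_le_mul_of_nonneg_right (norm_app_deriv_le hv ht) (norm_nonneg z)
  linarith [abs_real_inner_le_norm (app A (deriv v t)) z]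

lemma abs_inner_deriv_deriv_le (hA : IsSelfAdjoint A) (hv : IsRegularSolution A α T M v) {z : H}
    (hz : z ∈ A.domain) {t : ℝ} (ht : t ∈ Ioo 0 T) :
    |⟪deriv (deriv v) t, app A z⟫_ℝ| ≤ M * ‖z‖ * t ^ (α - 2) := by
  rw [← app_symm hA (hv.mem_domain t ht).2 hz]
  have h1 := mul_le_mul_of_nonneg_right (norm_app_deriv_deriv_le hv ht) (norm_nonneg z)
  linarith [abs_real_inner_le_norm (app A (deriv (deriv v) t)) z]

/-- The exact solution stays in `D(A)` up to the end points, because `A v'` is integrable. -/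
lemma mem_domain_of_mem_Icc (hA : IsSelfAdjoint A) (hα : 0 < α) (hM : 0 ≤ M) (hT : 0 < T)
    (hcont : ContinuousOn v (Icc 0 T)) (hmem : ∀ t ∈ Ioo 0 T, v t ∈ A.domain)
    (hv : IsRegularSolution A α T M v) {t : ℝ} (ht : t ∈ Icc 0 T) : v t ∈ A.domain := by
  have hmid : v (T / 2) ∈ A.domain := hmem _ ⟨by linarith, by linarith⟩
  have key : v t - v (T / 2) ∈ A.domain := by
    refine mem_domain_of_abs_inner_le hA (C := M / α * T ^ α) fun z hz => ?_
    have h1 : ∀ s t : ℝ, 0 ≤ s → s ≤ t → t ≤ T →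
        |⟪v t, app A z⟫_ℝ - ⟪v s, app A z⟫_ℝ| ≤ M / α * T ^ α * ‖z‖ := by
      intro s t hs hst htT
      have h := abs_sub_le_rpow hα (continuousOn_inner_right hcont (app A z))
        (fun t ht => hasDerivAt_inner_right (hv.differentiable t ht).1 (app A z))
        (fun t ht => abs_inner_deriv_le hA hv hz ht) hs hst htT
      refine h.trans ?_
      have h2 : t ^ α - s ^ α ≤ T ^ α := by
        have := Real.rpow_le_rpow (hs.trans hst) htT hα.le
        linarith [Real.rpow_nonneg hs α]
      calc M * ‖z‖ / α * (t ^ α - s ^ α) ≤ M * ‖z‖ / α * T ^ α :=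
            mul_le_mul_of_nonneg_left h2 (by positivity)
        _ = _ := by ring
    rw [inner_sub_left]
    rcases le_total t (T / 2) with h | h
    · rw [abs_sub_comm]; exact h1 t (T / 2) ht.1 h (by linarith)
    · exact h1 (T / 2) t (by linarith) h ht.2
  simpa using add_mem key hmid

/-- Every operator dominated by `A`, applied to the exact solution, yields a function that behaves
as if its derivatives of order one and two were bounded by `t^{α-1}` and `t^{α-2}`. -/
theorem isGradedSmooth_comp (hA : IsSelfAdjoint A) (hα : 0 < α) (hα1 : α < 1) (hM : 0 ≤ M)
    (hcont : ContinuousOn v (Icc 0 T)) (hmem : ∀ t ∈ Icc 0 T, v t ∈ A.domain)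
    (hv : IsRegularSolution A α T M v) {F : H → H} {K : ℝ} (hK : 0 ≤ K)
    (hsub : ∀ x ∈ A.domain, ∀ y ∈ A.domain, F (x - y) = F x - F y)
    (hsmul : ∀ (c : ℝ), ∀ x ∈ A.domain, F (c • x) = c • F x)
    (hF : ∀ x ∈ A.domain, ‖F x‖ ≤ K * ‖app A x‖) :
    IsGradedSmooth α T (K * (M / α)) fun t => F (v t) := by
  have hMα : M ≤ M / α := le_div_self hM hα hα1.le
  have hMα0 : 0 ≤ M / α := by positivity
  have bound : ∀ {w : H} {C : ℝ}, w ∈ A.domain → 0 ≤ C →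
      (∀ z ∈ A.domain, |⟪w, app A z⟫_ℝ| ≤ C * ‖z‖) → ‖F w‖ ≤ K * C := fun hw hC h =>
    (hF _ hw).trans (mul_le_mul_of_nonneg_left (norm_app_le_of_abs_inner_le hA hC hw h) hK)
  refine ⟨fun s t hs hst ht => ?_, fun s t hs hst ht => ?_, fun s τ t hs hsτ hτt ht => ?_⟩
  · have ms := hmem s ⟨hs, by linarith⟩
    have mt := hmem t ⟨by linarith, ht⟩
    have h0 : 0 ≤ t ^ α - s ^ α := sub_nonneg.2 (Real.rpow_le_rpow hs hst hα.le)
    rw [← hsub _ mt _ ms, mul_assoc]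
    refine bound (sub_mem mt ms) (by positivity) fun z hz => ?_
    have h := abs_sub_le_rpow hα (continuousOn_inner_right hcont (app A z))
      (fun t ht => hasDerivAt_inner_right (hv.differentiable t ht).1 (app A z))
      (fun t ht => abs_inner_deriv_le hA hv hz ht) hs hst ht
    rw [inner_sub_left]
    calc _ ≤ _ := h
      _ = _ := by ring
  · have ms := hmem s ⟨hs.le, by linarith⟩
    have mt := hmem t ⟨by linarith, ht⟩
    have h0 : 0 ≤ (t - s) * s ^ (α - 1) :=
      mul_nonneg (by linarith) (Real.rpow_nonneg hs.le _)
    rw [← hsub _ mt _ ms, mul_assoc, mul_assoc]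
    refine bound (sub_mem mt ms) (by positivity) fun z hz => ?_
    have h := abs_sub_le_mul_rpow hα1.le (by positivity)
      (continuousOn_inner_right hcont (app A z))
      (fun t ht => hasDerivAt_inner_right (hv.differentiable t ht).1 (app A z))
      (fun t ht => abs_inner_deriv_le hA hv hz ht) hs hst ht
    rw [inner_sub_left]
    calc _ ≤ M * ‖z‖ * (t - s) * s ^ (α - 1) := h
      _ = M * ((t - s) * s ^ (α - 1) * ‖z‖) := by ring
      _ ≤ M / α * ((t - s) * s ^ (α - 1) * ‖z‖) :=
          mul_le_mul_of_nonneg_right hMα (mul_nonneg h0 (norm_nonneg z))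
      _ = _ := by ring
  · have ms := hmem s ⟨hs.le, by linarith⟩
    have mτ := hmem τ ⟨by linarith, by linarith⟩
    have mt := hmem t ⟨by linarith, ht⟩
    have h0 : 0 ≤ ((t - s) * (t - τ) * (τ - s)) * s ^ (α - 2) :=
      mul_nonneg (mul_nonneg (mul_nonneg (by linarith) (by linarith)) (by linarith))
        (Real.rpow_nonneg hs.le _)
    have m1 := A.domain.smul_mem (t - s) mτ
    have m2 := A.domain.smul_mem (t - τ) ms
    have m3 := A.domain.smul_mem (τ - s) mt
    rw [← hsmul _ _ mτ, ← hsmul _ _ ms, ← hsmul _ _ mt, ← hsub _ m1 _ m2,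
      ← hsub _ (sub_mem m1 m2) _ m3, mul_assoc, mul_assoc]
    refine bound (sub_mem (sub_mem m1 m2) m3) (by positivity) fun z hz => ?_
    have h := abs_three_point_le (by linarith) (by positivity)
      (continuousOn_inner_right hcont (app A z))
      (fun t ht => hasDerivAt_inner_right (hv.differentiable t ht).1 (app A z))
      (fun t ht => hasDerivAt_inner_right (hv.differentiable t ht).2 (app A z))
      (fun t ht => abs_inner_deriv_deriv_le hA hv hz ht) hs hsτ hτt ht
    rw [inner_sub_left, inner_sub_left, real_inner_smul_left, real_inner_smul_left,
      real_inner_smul_left]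
    calc _ ≤ M * ‖z‖ * ((t - s) * (t - τ) * (τ - s)) * s ^ (α - 2) := h
      _ = M * ((t - s) * (t - τ) * (τ - s) * s ^ (α - 2) * ‖z‖) := by ring
      _ ≤ M / α * ((t - s) * (t - τ) * (τ - s) * s ^ (α - 2) * ‖z‖) :=
          mul_le_mul_of_nonneg_right hMα (mul_nonneg h0 (norm_nonneg z))
      _ = _ := by ring

end Regularity

/-! ### Elementary properties of graded meshes -/

section Mesh

variable {γ T cγ Cγ k : ℝ} {N : ℕ} {t : ℕ → ℝ}

namespace IsGradedMesh

lemma mono (h : IsGradedMesh γ T cγ Cγ k N t) {i j : ℕ} (hij : i ≤ j) (hj : j ≤ N) :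
    t i ≤ t j := by
  induction j, hij using Nat.le_induction with
  | base => exact le_rfl
  | succ j hij ih =>
    have := h.increasing (j + 1) (by omega) hj
    rw [Nat.add_sub_cancel] at this
    exact (ih (by omega)).trans this.le

lemma nonneg (h : IsGradedMesh γ T cγ Cγ k N t) {n : ℕ} (hn : n ≤ N) : 0 ≤ t n :=
  h.start ▸ h.mono (Nat.zero_le n) hn

lemma le_final (h : IsGradedMesh γ T cγ Cγ k N t) {n : ℕ} (hn : n ≤ N) : t n ≤ T :=
  (h.mono hn le_rfl).trans h.final

lemma mem_Icc (h : IsGradedMesh γ T cγ Cγ k N t) {n : ℕ} (hn : n ≤ N) : t n ∈ Icc 0 T :=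
  ⟨h.nonneg hn, h.le_final hn⟩

lemma step_pos (h : IsGradedMesh γ T cγ Cγ k N t) {n : ℕ} (h1 : 1 ≤ n) (hn : n ≤ N) :
    0 < step t n := sub_pos.2 (h.increasing n h1 hn)

lemma pos (h : IsGradedMesh γ T cγ Cγ k N t) {n : ℕ} (h1 : 1 ≤ n) (hn : n ≤ N) : 0 < t n :=
  (h.nonneg (by omega)).trans_lt (h.increasing n h1 hn)

lemma step_le_step (h : IsGradedMesh γ T cγ Cγ k N t) {p n : ℕ} (hp : 2 ≤ p) (hpn : p ≤ n)
    (hn : n ≤ N) : step t p ≤ step t n := by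
  induction n, hpn using Nat.le_induction with
  | base => exact le_rfl
  | succ n hpn ih =>
    linarith [ih (by omega), h.step_mono n (by omega) hn]

end IsGradedMesh

end Mesh

/-! ### The fractional integral of a continuous function -/

section Fubini

lemma integrable_abel_convolution {a T : ℝ} (ha : 0 < a) {φ : ℝ → H}
    (hφ : ContinuousOn φ (Icc 0 T)) :
    Integrable (fun p : ℝ × ℝ => (Ioc 0 T).indicator (abelKernel a) (p.1 - p.2) •
      (Ioc 0 T).indicator φ p.2) (volume.prod volume) := by
  have h1 : Integrable ((Ioc 0 T).indicator φ) :=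
    (integrable_indicator_iff measurableSet_Ioc).2
      (hφ.integrableOn_Icc.mono_set Ioc_subset_Icc_self)
  have h2 : Integrable ((Ioc 0 T).indicator (abelKernel a)) := by
    rw [integrable_indicator_iff measurableSet_Ioc]
    exact (intervalIntegrable_abelKernel ha 0 T).1
  exact h1.convolution_integrand ((ContinuousLinearMap.lsmul ℝ ℝ).flip : H →L[ℝ] ℝ →L[ℝ] H) h2

lemma integral_abel_convolution {a T : ℝ} {φ : ℝ → H} {r : ℝ} (hr : r ∈ Ioc 0 T) :
    ∫ s, (Ioc 0 T).indicator (abelKernel a) (r - s) • (Ioc 0 T).indicator φ s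
      = ∫ s in (0 : ℝ)..r, abelKernel a (r - s) • φ s := by
  rw [intervalIntegral.integral_of_le hr.1.le, integral_Ioc_eq_integral_Ioo,
    ← integral_indicator measurableSet_Ioo]
  congr 1
  ext s
  by_cases hs : s ∈ Ioo 0 r
  · rw [indicator_of_mem hs, indicator_of_mem (show s ∈ Ioc 0 T from ⟨hs.1, hs.2.le.trans hr.2⟩),
      indicator_of_mem (show r - s ∈ Ioc 0 T from ⟨by linarith [hs.2], by linarith [hs.1, hr.2]⟩)]
  · rw [indicator_of_notMem hs]
    by_cases h1 : s ∈ Ioc 0 T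
    · rw [indicator_of_notMem (show r - s ∉ Ioc 0 T from fun h => hs ⟨h1.1, by linarith [h.1]⟩),
        zero_smul]
    · rw [indicator_of_notMem h1, smul_zero]

lemma intervalIntegrable_fracInt {a T : ℝ} (ha : 0 < a) (hT : 0 ≤ T) {φ : ℝ → H}
    (hφ : ContinuousOn φ (Icc 0 T)) :
    IntervalIntegrable (fun r => ∫ s in (0 : ℝ)..r, abelKernel a (r - s) • φ s) volume 0 T := by
  rw [intervalIntegrable_iff_integrableOn_Ioc_of_le hT]
  exact ((integrable_abel_convolution ha hφ).integral_prod_left.integrableOn).congr_fun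
    (fun r hr => integral_abel_convolution hr) measurableSet_Ioc

variable [CompleteSpace H]

/-- Integrating the fractional integral of order `a` gives the one of order `a + 1`. -/
lemma integral_fracInt {a T : ℝ} (ha : 0 < a) {φ : ℝ → H} (hφ : ContinuousOn φ (Icc 0 T)) {t : ℝ}
    (ht : t ∈ Icc 0 T) :
    ∫ r in (0 : ℝ)..t, ∫ s in (0 : ℝ)..r, abelKernel a (r - s) • φ s
      = ∫ s in (0 : ℝ)..t, abelKernel (a + 1) (t - s) • φ s := by
  have h1 : ∫ r in (0 : ℝ)..t, ∫ s in (0 : ℝ)..r, abelKernel a (r - s) • φ s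
      = ∫ r in Ioc 0 t, ∫ s, (Ioc 0 T).indicator (abelKernel a) (r - s) •
          (Ioc 0 T).indicator φ s := by
    rw [intervalIntegral.integral_of_le ht.1]
    exact setIntegral_congr_fun measurableSet_Ioc fun r hr =>
      (integral_abel_convolution ⟨hr.1, hr.2.trans ht.2⟩).symm
  have hint : Integrable (Function.uncurry fun r s : ℝ =>
      (Ioc 0 T).indicator (abelKernel a) (r - s) • (Ioc 0 T).indicator φ s)
      ((volume.restrict (Ioc 0 t)).prod volume) := by
    have := (integrable_abel_convolution ha hφ).integrableOn (s := Ioc 0 t ×ˢ univ)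
    rw [IntegrableOn, ← Measure.prod_restrict, Measure.restrict_univ] at this
    exact this
  rw [h1, integral_integral_swap hint, intervalIntegral.integral_of_le ht.1,
    integral_Ioc_eq_integral_Ioo, ← integral_indicator measurableSet_Ioo]
  congr 1
  ext s
  by_cases hs : s ∈ Ioo 0 t
  · rw [indicator_of_mem hs, indicator_of_mem (show s ∈ Ioc 0 T from ⟨hs.1, hs.2.le.trans ht.2⟩),
      integral_smul_const]
    congr 1
    have e : ∫ r in Ioc 0 t, (Ioc 0 T).indicator (abelKernel a) (r - s)
        = ∫ r in s..t, abelKernel a (r - s) := by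
      rw [intervalIntegral.integral_of_le hs.2.le, ← integral_indicator measurableSet_Ioc,
        ← integral_indicator measurableSet_Ioc]
      congr 1
      ext r
      by_cases hr : r ∈ Ioc s t
      · rw [indicator_of_mem hr, indicator_of_mem (show r ∈ Ioc 0 t from ⟨hs.1.trans hr.1, hr.2⟩),
          indicator_of_mem (show r - s ∈ Ioc 0 T from
            ⟨by linarith [hr.1], by linarith [hs.1, hr.2, ht.2]⟩)]
      · rw [indicator_of_notMem hr]
        by_cases hr' : r ∈ Ioc 0 t
        · rw [indicator_of_mem hr',
            indicator_of_notMem fun h => hr ⟨by linarith [h.1], hr'.2⟩]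
        · rw [indicator_of_notMem hr']
    rw [e, integral_abelKernel_sub_right ha, sub_self, abelKernel_add_one_zero ha, sub_zero]
  · rw [indicator_of_notMem hs]
    by_cases h1 : s ∈ Ioc 0 T
    · have hts : t ≤ s := by
        by_contra h
        exact hs ⟨h1.1, not_le.1 h⟩
      rw [setIntegral_congr_fun (g := fun _ => (0 : H)) measurableSet_Ioc fun r hr => by
        simp only
        rw [indicator_of_notMem fun h => by linarith [h.1, hr.2], zero_smul]]
      simp
    · simp [indicator_of_notMem h1]

end Fubini

/-! ### Linear interpolation on the mesh -/

/-- The slope of the piecewise linear interpolant of `b`, set to `0` on the first interval, where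
`b` is compared with the constant `b(t_1)`. -/
def meshSlope (b : ℝ → H) (t : ℕ → ℝ) (p : ℕ) : H :=
  if p = 1 then 0 else (1 / step t p) • (b (t p) - b (t (p - 1)))

/-- The interpolation error: `b(s) - b(t_1)` on the first interval, and `b` minus its linear
interpolant, written about the midpoint, on the others. -/
def meshResidual (b : ℝ → H) (t : ℕ → ℝ) (p : ℕ) (s : ℝ) : H :=
  b s - stage (fun i => b (t i)) p - (s - (t (p - 1) + t p) / 2) • meshSlope b t p

/-- The bound for `meshResidual` on the `p`-th interval. -/
def residualBound (α L : ℝ) (t : ℕ → ℝ) (p : ℕ) : ℝ :=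
  if p = 1 then L * t 1 ^ α else L * step t p ^ 2 * t (p - 1) ^ (α - 2)

section Interpolation

variable {α γ T L cγ Cγ k : ℝ} {N : ℕ} {t : ℕ → ℝ} {b : ℝ → H}

lemma residualBound_nonneg (hL : 0 ≤ L) (hm : IsGradedMesh γ T cγ Cγ k N t) {p : ℕ} (h1 : 1 ≤ p)
    (hp : p ≤ N) : 0 ≤ residualBound α L t p := by
  rw [residualBound]
  split_ifs with h
  · exact mul_nonneg hL (Real.rpow_nonneg (hm.nonneg (by omega)) _)
  · exact mul_nonneg (mul_nonneg hL (sq_nonneg _)) (Real.rpow_nonneg (hm.nonneg (by omega)) _)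

lemma norm_meshResidual_le (hL : 0 ≤ L) (hb : IsGradedSmooth α T L b)
    (hm : IsGradedMesh γ T cγ Cγ k N t) {p : ℕ} (h1 : 1 ≤ p) (hp : p ≤ N) {s : ℝ}
    (hs : s ∈ Icc (t (p - 1)) (t p)) : ‖meshResidual b t p s‖ ≤ residualBound α L t p := by
  rw [residualBound, meshResidual, meshSlope]
  rcases h1.eq_or_lt with h | h
  · subst h
    have hs0 : 0 ≤ s := hm.start ▸ hs.1
    rw [if_pos rfl, if_pos rfl, smul_zero, sub_zero, stage_one, norm_sub_rev]
    refine (hb.holder s (t 1) hs0 hs.2 (hm.le_final hp)).trans ?_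
    exact mul_le_mul_of_nonneg_left (by linarith [Real.rpow_nonneg hs0 α]) hL
  · rw [if_neg (by omega), if_neg (by omega), stage_of_two_le _ h]
    have hk := hm.step_pos h1 hp
    have ht0 : 0 < t (p - 1) := hm.pos (by omega) (by omega)
    have h3 := hb.three_point (t (p - 1)) s (t p) ht0 hs.1 hs.2 (hm.le_final hp)
    have e : step t p • (b s - (1 / 2 : ℝ) • (b (t p) + b (t (p - 1)))
        - (s - (t (p - 1) + t p) / 2) • (1 / step t p) • (b (t p) - b (t (p - 1))))
        = (t p - t (p - 1)) • b s - (t p - s) • b (t (p - 1)) - (s - t (p - 1)) • b (t p) := by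
      rw [smul_sub, smul_comm (step t p) (s - (t (p - 1) + t p) / 2), smul_smul (step t p) (1 / _),
        mul_one_div_cancel hk.ne', step]
      module
    have h4 : step t p * ‖b s - (1 / 2 : ℝ) • (b (t p) + b (t (p - 1)))
        - (s - (t (p - 1) + t p) / 2) • (1 / step t p) • (b (t p) - b (t (p - 1)))‖
        ≤ step t p * (L * step t p ^ 2 * t (p - 1) ^ (α - 2)) := by
      rw [← Real.norm_of_nonneg hk.le, ← norm_smul, Real.norm_of_nonneg hk.le, e]
      refine h3.trans ?_
      have h5 : (t p - s) * (s - t (p - 1)) ≤ step t p * step t p :=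
        mul_le_mul (by simp only [step]; linarith [hs.1]) (by simp only [step]; linarith [hs.2])
          (by linarith [hs.1]) hk.le
      have h6 := mul_le_mul_of_nonneg_left h5 (mul_nonneg (mul_nonneg hL hk.le)
        (Real.rpow_nonneg ht0.le (α - 2)))
      simp only [step] at h6 ⊢
      linarith
    exact le_of_mul_le_mul_left h4 hk

lemma norm_meshSlope_le (hb : IsGradedSmooth α T L b)
    (hm : IsGradedMesh γ T cγ Cγ k N t) {p : ℕ} (h2 : 2 ≤ p) (hp : p ≤ N) :
    ‖meshSlope b t p‖ ≤ L * t (p - 1) ^ (α - 1) := by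
  have hk := hm.step_pos (by omega) hp
  have h := hb.lipschitz (t (p - 1)) (t p) (hm.pos (by omega) (by omega))
    (hm.mono (by omega) hp) (hm.le_final hp)
  rw [meshSlope, if_neg (by omega), norm_smul, Real.norm_of_nonneg (by positivity),
    one_div, inv_mul_le_iff₀ hk]
  calc _ ≤ _ := h
    _ = _ := by rw [step]; ring

lemma norm_meshSlope_sub_le (hL : 0 ≤ L) (hb : IsGradedSmooth α T L b)
    (hm : IsGradedMesh γ T cγ Cγ k N t) {p : ℕ} (h3 : 3 ≤ p) (hp : p ≤ N) :
    ‖meshSlope b t p - meshSlope b t (p - 1)‖ ≤ 2 * L * step t p * t (p - 2) ^ (α - 2) := by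
  have hk := hm.step_pos (by omega) hp
  have hk' : 0 < step t (p - 1) := hm.step_pos (by omega) (by omega)
  have hkk : step t (p - 1) ≤ step t p := hm.step_le_step (by omega) (by omega) hp
  have ht0 : 0 < t (p - 2) := hm.pos (by omega) (by omega)
  have h := hb.three_point (t (p - 2)) (t (p - 1)) (t p) ht0 (hm.mono (by omega) (by omega))
    (hm.mono (by omega) hp) (hm.le_final hp)
  have es : step t p = t p - t (p - 1) := rfl
  have es' : step t (p - 1) = t (p - 1) - t (p - 2) := by
    rw [step, show p - 1 - 1 = p - 2 by omega]
  have e : (t p - t (p - 2)) • b (t (p - 1)) - (t p - t (p - 1)) • b (t (p - 2))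
      - (t (p - 1) - t (p - 2)) • b (t p)
      = -((step t p * step t (p - 1)) • (meshSlope b t p - meshSlope b t (p - 1))) := by
    rw [meshSlope, meshSlope, if_neg (by omega), if_neg (by omega), smul_sub, smul_smul, smul_smul,
      show p - 1 - 1 = p - 2 by omega,
      show step t p * step t (p - 1) * (1 / step t p) = step t (p - 1) by field_simp,
      show step t p * step t (p - 1) * (1 / step t (p - 1)) = step t p by field_simp, es, es']
    module
  rw [e, norm_neg, norm_smul, Real.norm_of_nonneg (by positivity), ← es, ← es'] at h
  have h4 : step t p * step t (p - 1) * ‖meshSlope b t p - meshSlope b t (p - 1)‖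
      ≤ step t p * step t (p - 1) * (2 * L * step t p * t (p - 2) ^ (α - 2)) := by
    refine h.trans ?_
    have h5 : t p - t (p - 2) ≤ 2 * step t p := by linarith
    have h6 := mul_le_mul_of_nonneg_left h5 (mul_nonneg (mul_nonneg hL
      (mul_pos hk hk').le) (Real.rpow_nonneg ht0.le (α - 2)))
    linarith
  exact le_of_mul_le_mul_left h4 (mul_pos hk hk')

end Interpolation

/-! ### Quadrature error of the memory term -/

/-- The fractional integral of order `a + 1` at `t_n` of the difference between `b` and its piecewise
constant approximation. -/
def memoryDefect (a : ℝ) (t : ℕ → ℝ) (b : ℝ → H) (n : ℕ) : H :=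
  ∑ p ∈ Finset.Icc 1 n, ∫ s in (t (p - 1))..(t p),
    abelKernel (a + 1) (t n - s) • (b s - stage (fun i => b (t i)) p)

/-- The part of `memoryDefect` that comes from the interpolation error. -/
def residualDefect (a : ℝ) (t : ℕ → ℝ) (b : ℝ → H) (n : ℕ) : H :=
  ∑ p ∈ Finset.Icc 1 n, ∫ s in (t (p - 1))..(t p),
    abelKernel (a + 1) (t n - s) • meshResidual b t p s

/-- The part of `memoryDefect`, up to sign, that comes from the sawtooth between the linear
interpolant and the piecewise constant approximation. -/
def sawDefect (a : ℝ) (t : ℕ → ℝ) (b : ℝ → H) (n : ℕ) : H :=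
  ∑ p ∈ Finset.Icc 2 n, sawWeight a (t n - t p) (step t p) • meshSlope b t p

section Decomposition

variable {a α γ T L cγ Cγ k : ℝ} {N : ℕ} {t : ℕ → ℝ} {b : ℝ → H}

lemma continuousOn_cell {E : Type*} [TopologicalSpace E] {b : ℝ → E}
    (hb : ContinuousOn b (Icc 0 T)) (hm : IsGradedMesh γ T cγ Cγ k N t)
    {p : ℕ} (hp : p ≤ N) : ContinuousOn b (uIcc (t (p - 1)) (t p)) := by
  rw [uIcc_of_le (hm.mono (by omega) hp)]
  exact hb.mono (Icc_subset_Icc (hm.nonneg (by omega)) (hm.le_final hp))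

lemma continuous_abelKernel_sub (ha : 0 < a) (c : ℝ) :
    Continuous fun s => abelKernel (a + 1) (c - s) :=
  (continuous_abelKernel (by linarith)).comp (continuous_const.sub continuous_id)

lemma intervalIntegrable_smul {h : ℝ → ℝ} {f : ℝ → H} {x y : ℝ} (hh : Continuous h)
    (hf : ContinuousOn f (uIcc x y)) : IntervalIntegrable (fun s => h s • f s) volume x y :=
  (hh.continuousOn.smul hf).intervalIntegrable

lemma sum_integral_cells [CompleteSpace H] {f : ℝ → H} (hm : IsGradedMesh γ T cγ Cγ k N t)
    (hf : ContinuousOn f (Icc 0 T)) {n : ℕ} (hn : n ≤ N) :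
    ∑ p ∈ Finset.Icc 1 n, ∫ s in (t (p - 1))..(t p), f s = ∫ s in (0 : ℝ)..(t n), f s := by
  induction n with
  | zero => simp [hm.start]
  | succ n ih =>
    rw [Finset.sum_Icc_succ_top (by omega), ih (by omega), Nat.add_sub_cancel,
      intervalIntegral.integral_add_adjacent_intervals]
    · refine ContinuousOn.intervalIntegrable ?_
      rw [uIcc_of_le (hm.nonneg (by omega))]
      exact hf.mono (Icc_subset_Icc le_rfl (hm.le_final (by omega)))
    · simpa using (continuousOn_cell hf hm hn).intervalIntegrable

lemma memoryDefect_eq [CompleteSpace H] (ha : 0 < a) (hm : IsGradedMesh γ T cγ Cγ k N t)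
    (hb : ContinuousOn b (Icc 0 T)) {n : ℕ} (hn : n ≤ N) :
    memoryDefect a t b n = (∫ s in (0 : ℝ)..(t n), abelKernel (a + 1) (t n - s) • b s)
      - ∑ p ∈ Finset.Icc 1 n, (abelKernel (a + 2) (t n - t (p - 1))
        - abelKernel (a + 2) (t n - t p)) • stage (fun i => b (t i)) p := by
  have hc := continuous_abelKernel_sub ha (t n)
  rw [memoryDefect, ← sum_integral_cells (f := fun s => abelKernel (a + 1) (t n - s) • b s) hm
    (hc.continuousOn.smul hb) hn,
    ← Finset.sum_sub_distrib]
  refine Finset.sum_congr rfl fun p hp => ?_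
  obtain ⟨h1, h2⟩ := Finset.mem_Icc.1 hp
  have hcb := continuousOn_cell hb hm (h2.trans hn)
  simp only [smul_sub]
  rw [intervalIntegral.integral_sub (intervalIntegrable_smul hc hcb)
    (intervalIntegrable_smul hc continuousOn_const),
    intervalIntegral.integral_smul_const, integral_abelKernel_sub_left (by linarith),
    show a + 1 + 1 = a + 2 by ring]

/-- The quadrature error of the memory term over a cell is an increment of `memoryDefect`. -/
lemma memory_error_eq [CompleteSpace H] (ha : 0 < a) (hT : 0 ≤ T)
    (hm : IsGradedMesh γ T cγ Cγ k N t) (hb : ContinuousOn b (Icc 0 T)) {n : ℕ} (h1 : 1 ≤ n)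
    (hn : n ≤ N) :
    (∫ r in (t (n - 1))..(t n), ∫ s in (0 : ℝ)..r, abelKernel a (r - s) • b s)
      - step t n • ∑ p ∈ Finset.Icc 1 n, (piWeight a t n p * step t p) • stage (fun i => b (t i)) p
      = memoryDefect a t b n - memoryDefect a t b (n - 1) := by
  have hlt := hm.increasing n h1 hn
  have hi := intervalIntegrable_fracInt ha hT hb
  have hi' : ∀ j, j ≤ N → IntervalIntegrable
      (fun r => ∫ s in (0 : ℝ)..r, abelKernel a (r - s) • b s) volume 0 (t j) := fun j hj =>
    hi.mono_set (by
      rw [uIcc_of_le (hm.nonneg hj), uIcc_of_le hT]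
      exact Icc_subset_Icc le_rfl (hm.le_final hj))
  rw [memoryDefect_eq ha hm hb hn, memoryDefect_eq ha hm hb (show n - 1 ≤ N by omega),
    ← integral_fracInt ha hb (hm.mem_Icc hn), ← integral_fracInt ha hb (hm.mem_Icc (by omega)),
    ← intervalIntegral.integral_interval_sub_left (hi' n hn) (hi' (n - 1) (by omega))]
  have hsum : step t n • ∑ p ∈ Finset.Icc 1 n,
      (piWeight a t n p * step t p) • stage (fun i => b (t i)) p
      = ∑ p ∈ Finset.Icc 1 n, (abelKernel (a + 2) (t n - t (p - 1))
        - abelKernel (a + 2) (t n - t p)) • stage (fun i => b (t i)) p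
      - ∑ p ∈ Finset.Icc 1 (n - 1), (abelKernel (a + 2) (t (n - 1) - t (p - 1))
        - abelKernel (a + 2) (t (n - 1) - t p)) • stage (fun i => b (t i)) p := by
    obtain ⟨j, rfl⟩ : ∃ j, n = j + 1 := ⟨n - 1, by omega⟩
    have h0 : abelKernel (a + 2) 0 = 0 := by
      rw [show a + 2 = a + 1 + 1 by ring]; exact abelKernel_add_one_zero (by linarith)
    have hself := piWeight_self ha hlt
    rw [Finset.sum_Icc_succ_top (by omega), Finset.sum_Icc_succ_top (by omega), smul_add,
      smul_smul, hself, sub_self, h0, sub_zero, add_sub_right_comm, Nat.add_sub_cancel,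
      ← Finset.sum_sub_distrib, Finset.smul_sum]
    congr 1
    refine Finset.sum_congr rfl fun p hp => ?_
    obtain ⟨hp1, hp2⟩ := Finset.mem_Icc.1 hp
    rw [smul_smul, piWeight_eq_of_lt ha (hm.mono (by omega) (by omega)) hlt
      (hm.increasing p hp1 (by omega)), sub_smul, Nat.add_sub_cancel]
  rw [hsum]
  abel

lemma memoryDefect_eq_sub [CompleteSpace H] (ha : 0 < a) (hm : IsGradedMesh γ T cγ Cγ k N t)
    (hb : ContinuousOn b (Icc 0 T)) {n : ℕ} (hn : n ≤ N) :
    memoryDefect a t b n = residualDefect a t b n - sawDefect a t b n := by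
  have hsaw : sawDefect a t b n
      = ∑ p ∈ Finset.Icc 1 n, sawWeight a (t n - t p) (step t p) • meshSlope b t p := by
    rcases Nat.eq_zero_or_pos n with rfl | h
    · simp [sawDefect]
    · have : Finset.Icc 1 n = insert 1 (Finset.Icc 2 n) := by ext; simp; omega
      rw [this, Finset.sum_insert (by simp), meshSlope, if_pos rfl, smul_zero, zero_add, sawDefect]
  rw [memoryDefect, residualDefect, hsaw, ← Finset.sum_sub_distrib]
  refine Finset.sum_congr rfl fun p hp => ?_
  obtain ⟨h1, h2⟩ := Finset.mem_Icc.1 hp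
  have hc := continuous_abelKernel_sub ha (t n)
  have hcb := continuousOn_cell hb hm (h2.trans hn)
  have key := integral_abelKernel_mul_saw (c := t n) ha (hm.increasing p h1 (h2.trans hn))
    (hm.mono h2 hn)
  rw [← step] at key
  have e : ∀ s, abelKernel (a + 1) (t n - s) • (b s - stage (fun i => b (t i)) p)
      = abelKernel (a + 1) (t n - s) • meshResidual b t p s
        + (abelKernel (a + 1) (t n - s) * (s - (t (p - 1) + t p) / 2)) • meshSlope b t p := by
    intro s
    rw [meshResidual, mul_smul, ← smul_add, sub_add_cancel]
  have hres : ContinuousOn (meshResidual b t p) (uIcc (t (p - 1)) (t p)) := by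
    refine (hcb.sub continuousOn_const).sub (ContinuousOn.smul (by fun_prop) continuousOn_const)
  have hw : Continuous fun s => abelKernel (a + 1) (t n - s) * (s - (t (p - 1) + t p) / 2) :=
    hc.mul (by fun_prop)
  simp only [e]
  rw [intervalIntegral.integral_add (intervalIntegrable_smul hc hres)
    (intervalIntegrable_smul hw continuousOn_const),
    intervalIntegral.integral_smul_const, key, neg_smul, ← sub_eq_add_neg]

lemma norm_integral_smul_le {h : ℝ → ℝ} {f : ℝ → H} {p q δ : ℝ} (hpq : p ≤ q)
    (hh : Continuous h) (hh0 : ∀ s ∈ Icc p q, 0 ≤ h s) (hf : ∀ s ∈ Icc p q, ‖f s‖ ≤ δ) :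
    ‖∫ s in p..q, h s • f s‖ ≤ δ * ∫ s in p..q, h s := by
  rw [← intervalIntegral.integral_const_mul]
  refine intervalIntegral.norm_integral_le_of_norm_le hpq (.of_forall fun s hs => ?_)
    ((continuous_const.mul hh).intervalIntegrable _ _)
  have hs' : s ∈ Icc p q := ⟨hs.1.le, hs.2⟩
  rw [norm_smul, Real.norm_of_nonneg (hh0 s hs'), mul_comm]
  exact mul_le_mul_of_nonneg_right (hf s hs') (hh0 s hs')

/-- Since `ω_{a+1}` is nonnegative and increasing, the increments of `residualDefect` are dominated
by those of the same expression with the residual replaced by its bound, and these telescope. -/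
lemma sum_norm_residualDefect_sub_le (ha : 0 < a) (hL : 0 ≤ L) (hα : 0 < α)
    (hm : IsGradedMesh γ T cγ Cγ k N t) (hb : IsGradedSmooth α T L b) {K : ℝ}
    (hK : ∀ x, 0 ≤ x → x ≤ T → abelKernel (a + 1) x ≤ K) :
    ∑ n ∈ Finset.Icc 1 N, ‖residualDefect a t b n - residualDefect a t b (n - 1)‖
      ≤ K * ∑ p ∈ Finset.Icc 1 N, step t p * residualBound α L t p := by
  set S : ℕ → ℝ := fun n => ∑ p ∈ Finset.Icc 1 n, residualBound α L t p *
    ∫ s in (t (p - 1))..(t p), abelKernel (a + 1) (t n - s) with hS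
  have hstep : ∀ n, 1 ≤ n → n ≤ N →
      ‖residualDefect a t b n - residualDefect a t b (n - 1)‖ ≤ S n - S (n - 1) := by
    intro n h1 hn
    obtain ⟨j, rfl⟩ : ∃ j, n = j + 1 := ⟨n - 1, by omega⟩
    rw [Nat.add_sub_cancel]
    simp only [residualDefect, hS]
    rw [Finset.sum_Icc_succ_top h1, Finset.sum_Icc_succ_top h1, add_sub_right_comm,
      add_sub_right_comm, ← Finset.sum_sub_distrib, ← Finset.sum_sub_distrib]
    refine (norm_add_le _ _).trans (add_le_add ?_ ?_)
    · refine norm_sum_le_of_le _ fun p hp => ?_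
      obtain ⟨hp1, hp2⟩ := Finset.mem_Icc.1 hp
      have hcb := continuousOn_cell (hb.continuousOn hα) hm (p := p) (by omega)
      have hres : ContinuousOn (meshResidual b t p) (uIcc (t (p - 1)) (t p)) :=
        (hcb.sub continuousOn_const).sub (ContinuousOn.smul (by fun_prop) continuousOn_const)
      have c1 := continuous_abelKernel_sub ha (t (j + 1))
      have c2 := continuous_abelKernel_sub ha (t j)
      rw [← intervalIntegral.integral_sub (intervalIntegrable_smul c1 hres)
        (intervalIntegrable_smul c2 hres), ← mul_sub,
        ← intervalIntegral.integral_sub (c1.intervalIntegrable _ _) (c2.intervalIntegrable _ _)]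
      simp only [← sub_smul]
      refine norm_integral_smul_le (hm.mono (by omega) (by omega)) (c1.sub c2) (fun s hs => ?_)
        fun s hs => norm_meshResidual_le hL hb hm hp1 (by omega) hs
      have g1 := hm.mono hp2 (by omega)
      have g2 := hm.mono (Nat.le_succ j) hn
      exact sub_nonneg.2 (abelKernel_mono (by linarith) (by linarith [hs.2]) (by linarith))
    · exact norm_integral_smul_le (hm.mono (by omega) hn) (continuous_abelKernel_sub ha _)
        (fun s hs => abelKernel_nonneg (by linarith) (by linarith [hs.2]))
        fun s hs => norm_meshResidual_le hL hb hm h1 hn hs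
  have hS0 : S 0 = 0 := by simp [hS]
  calc _ ≤ ∑ n ∈ Finset.Icc 1 N, (S n - S (n - 1)) := Finset.sum_le_sum fun n hn =>
        hstep n (Finset.mem_Icc.1 hn).1 (Finset.mem_Icc.1 hn).2
    _ = S N := by rw [sum_Icc_sub_pred, hS0, sub_zero]
    _ ≤ _ := by
      rw [Finset.mul_sum]
      refine Finset.sum_le_sum fun p hp => ?_
      obtain ⟨hp1, hp2⟩ := Finset.mem_Icc.1 hp
      have hI : ∫ s in (t (p - 1))..(t p), abelKernel (a + 1) (t N - s) ≤ K * step t p := by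
        have h := intervalIntegral.integral_mono_on (hm.mono (show p - 1 ≤ p by omega) hp2)
          ((continuous_abelKernel_sub ha (t N)).intervalIntegrable _ _)
          (continuous_const.intervalIntegrable (μ := volume) _ _ :
            IntervalIntegrable (fun _ => K) _ _ _) fun s hs => hK _
            (by linarith [hs.2, hm.mono hp2 le_rfl])
            (by linarith [hs.1, hm.final, hm.nonneg (show p - 1 ≤ N by omega)])
        rw [intervalIntegral.integral_const, smul_eq_mul, mul_comm] at h
        exact h
      calc _ ≤ residualBound α L t p * (K * step t p) :=
            mul_le_mul_of_nonneg_left hI (residualBound_nonneg hL hm hp1 hp2)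
        _ = _ := by ring

end Decomposition

/-! ### Variation of sawtooth sums -/

lemma sum_Icc_two_eq {E : Type*} [AddCommMonoid E] (f : ℕ → E) (j : ℕ) :
    ∑ p ∈ Finset.Icc 2 j, f p = ∑ p ∈ Finset.Icc 3 (j + 1), f (p - 1) := by
  rw [← Finset.Ico_add_one_right_eq_Icc, ← Finset.Ico_add_one_right_eq_Icc,
    ← Finset.sum_Ico_add' (fun p => f (p - 1)) 2 (j + 1) 1]
  simp

/-- Variation of `Z_n = ∑_{p ≤ n} c_{n,p} d_p`. The differences `c_{n,p} - c_{n-1,p-1}` along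
diagonals need not be small, but up to `ε_p c_{n,p}` they are nonpositive. As the bounds `D_p` for
`d_p` decrease, their contribution is controlled by the telescoping sum of
`Y_n = ∑_{p ≤ n} c_{n,p} D_p`. -/
lemma sum_norm_sub_le_of_diagonal {N : ℕ} {c : ℕ → ℕ → ℝ} {d : ℕ → H} {D ε η : ℕ → ℝ}
    (hc : ∀ n p, 2 ≤ p → p ≤ n → n ≤ N → 0 ≤ c n p)
    (hd : ∀ p, 2 ≤ p → p ≤ N → ‖d p‖ ≤ D p) (hD : ∀ p, 3 ≤ p → p ≤ N → D p ≤ D (p - 1))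
    (hdiag : ∀ n p, 3 ≤ p → p ≤ n → n ≤ N →
      |c n p - c (n - 1) (p - 1)| ≤ ε p * c n p + c (n - 1) (p - 1) - c n p)
    (hη2 : 2 * D 2 ≤ η 2)
    (hη : ∀ p, 3 ≤ p → p ≤ N → ‖d p - d (p - 1)‖ + ε p * D (p - 1) ≤ η p) :
    ∑ n ∈ Finset.Icc 1 N, ‖∑ p ∈ Finset.Icc 2 n, c n p • d p
        - ∑ p ∈ Finset.Icc 2 (n - 1), c (n - 1) p • d p‖
      ≤ ∑ p ∈ Finset.Icc 2 N, η p * ∑ n ∈ Finset.Icc p N, c n p := by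
  set Y : ℕ → ℝ := fun n => ∑ p ∈ Finset.Icc 2 n, c n p * D p with hY
  have hsplit : ∀ n, 2 ≤ n → Finset.Icc 2 n = insert 2 (Finset.Icc 3 n) := by
    intro n hn; ext; simp; omega
  have hn : ∀ n, 1 ≤ n → n ≤ N → ‖∑ p ∈ Finset.Icc 2 n, c n p • d p
        - ∑ p ∈ Finset.Icc 2 (n - 1), c (n - 1) p • d p‖
      ≤ Y (n - 1) - Y n + ∑ p ∈ Finset.Icc 2 n, c n p * η p := by
    intro n h1 hnN
    rcases h1.eq_or_lt with h | h
    · subst h; simp [hY]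
    obtain ⟨j, rfl⟩ : ∃ j, n = j + 1 := ⟨n - 1, by omega⟩
    rw [Nat.add_sub_cancel]
    have hYj : Y j = ∑ p ∈ Finset.Icc 3 (j + 1), c j (p - 1) * D (p - 1) :=
      sum_Icc_two_eq (fun p => c j p * D p) j
    have hYj1 : Y (j + 1) = c (j + 1) 2 * D 2 + ∑ p ∈ Finset.Icc 3 (j + 1), c (j + 1) p * D p := by
      simp only [hY]; rw [hsplit _ h, Finset.sum_insert (by simp)]
    rw [sum_Icc_two_eq (fun p => c j p • d p) j, hsplit _ h, Finset.sum_insert (by simp),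
      Finset.sum_insert (by simp), add_sub_assoc, ← Finset.sum_sub_distrib, hYj, hYj1]
    have hc2 := hc (j + 1) 2 le_rfl h hnN
    have e1 : ‖c (j + 1) 2 • d 2‖ ≤ c (j + 1) 2 * D 2 := by
      rw [norm_smul, Real.norm_of_nonneg hc2]
      exact mul_le_mul_of_nonneg_left (hd 2 le_rfl (by omega)) hc2
    have e2 : ‖∑ p ∈ Finset.Icc 3 (j + 1), (c (j + 1) p • d p - c j (p - 1) • d (p - 1))‖
        ≤ ∑ p ∈ Finset.Icc 3 (j + 1), (c (j + 1) p * η p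
          + (c j (p - 1) * D (p - 1) - c (j + 1) p * D p)) := by
      refine norm_sum_le_of_le _ fun p hp => ?_
      obtain ⟨hp3, hpj⟩ := Finset.mem_Icc.1 hp
      have hcp := hc (j + 1) p (by omega) hpj hnN
      have hdp := hd (p - 1) (by omega) (by omega)
      have hDp := hD p hp3 (by omega)
      have hdg := hdiag (j + 1) p hp3 hpj hnN
      have hηp := hη p hp3 (by omega)
      rw [Nat.add_sub_cancel] at hdg
      have e : c (j + 1) p • d p - c j (p - 1) • d (p - 1)
          = c (j + 1) p • (d p - d (p - 1)) + (c (j + 1) p - c j (p - 1)) • d (p - 1) := by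
        rw [smul_sub, sub_smul]; abel
      have b1 : ‖c (j + 1) p • (d p - d (p - 1))‖ = c (j + 1) p * ‖d p - d (p - 1)‖ := by
        rw [norm_smul, Real.norm_of_nonneg hcp]
      have b2 : ‖(c (j + 1) p - c j (p - 1)) • d (p - 1)‖
          ≤ (ε p * c (j + 1) p + c j (p - 1) - c (j + 1) p) * D (p - 1) := by
        rw [norm_smul, Real.norm_eq_abs]
        exact mul_le_mul hdg hdp (norm_nonneg _) ((abs_nonneg _).trans hdg)
      have b3 := mul_le_mul_of_nonneg_left hηp hcp
      have b4 := mul_le_mul_of_nonneg_left hDp hcp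
      rw [e]
      refine (norm_add_le _ _).trans ?_
      rw [b1]
      linarith
    replace e2 := e2.trans_eq (by rw [Finset.sum_add_distrib, Finset.sum_sub_distrib])
    have e3 := mul_le_mul_of_nonneg_left hη2 hc2
    refine (norm_add_le _ _).trans ?_
    linarith
  have htel : ∑ n ∈ Finset.Icc 1 N, (Y (n - 1) - Y n) = Y 0 - Y N := by
    have h := sum_Icc_sub_pred Y N
    rw [← neg_inj, ← Finset.sum_neg_distrib] at h
    simpa using h
  have hY0 : Y 0 = 0 := by simp [hY]
  have hYN : 0 ≤ Y N := Finset.sum_nonneg fun p hp => by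
    obtain ⟨h1, h2⟩ := Finset.mem_Icc.1 hp
    exact mul_nonneg (hc N p h1 h2 le_rfl) ((norm_nonneg _).trans (hd p h1 h2))
  calc _ ≤ ∑ n ∈ Finset.Icc 1 N, (Y (n - 1) - Y n + ∑ p ∈ Finset.Icc 2 n, c n p * η p) :=
        Finset.sum_le_sum fun n h => hn n (Finset.mem_Icc.1 h).1 (Finset.mem_Icc.1 h).2
    _ ≤ ∑ n ∈ Finset.Icc 1 N, ∑ p ∈ Finset.Icc 2 n, c n p * η p := by
        rw [Finset.sum_add_distrib, htel, hY0]; linarith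
    _ = ∑ p ∈ Finset.Icc 2 N, ∑ n ∈ Finset.Icc p N, c n p * η p := by
        refine Finset.sum_comm' fun n p => ?_
        simp only [Finset.mem_Icc]; omega
    _ = _ := by
        refine Finset.sum_congr rfl fun p _ => ?_
        rw [Finset.mul_sum]
        exact Finset.sum_congr rfl fun n _ => mul_comm _ _

section Saw

variable {a α γ T L cγ Cγ k : ℝ} {N : ℕ} {t : ℕ → ℝ} {b : ℝ → H}

/-- Columns of the sawtooth weights sum to `O(k_p²)`: since `k_p ≤ k_n`, the factor
`k_p ω_a(t_n - t_p)` is at most an increment of `ω_{a+1}(· - t_p)` over the `n`-th cell. -/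
lemma sum_sawWeight_le (ha : 0 < a) (ha1 : a ≤ 1) (hm : IsGradedMesh γ T cγ Cγ k N t) {K : ℝ}
    (hK : ∀ x, 0 ≤ x → x ≤ T → abelKernel (a + 1) x ≤ K) {p : ℕ} (hp : 2 ≤ p) (hpN : p ≤ N) :
    ∑ n ∈ Finset.Icc p N, sawWeight a (t n - t p) (step t p) ≤ 2 * K * step t p ^ 2 := by
  have hk := hm.step_pos (by omega) hpN
  have main : ∀ j, p ≤ j → j ≤ N → ∑ n ∈ Finset.Icc p j, sawWeight a (t n - t p) (step t p)
      ≤ step t p ^ 2 * (abelKernel (a + 1) (step t p) + abelKernel (a + 1) (t j - t p)) := by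
    intro j hj
    induction j, hj using Nat.le_induction with
    | base =>
      intro _
      rw [Finset.Icc_self, Finset.sum_singleton, sub_self, abelKernel_add_one_zero ha, add_zero]
      exact sawWeight_zero_le ha hk
    | succ j hj ih =>
      intro hjN
      have hx : step t (j + 1) ≤ t (j + 1) - t p := by
        rw [step, Nat.add_sub_cancel]; linarith [hm.mono hj (by omega)]
      have hk' := hm.step_pos (n := j + 1) (by omega) hjN
      have hkk : step t p ≤ step t (j + 1) := hm.step_le_step hp (by omega) hjN
      have h1 := sawWeight_le ha ha1 (hk'.trans_le hx) hk
      have h2 := mul_abelKernel_le_sub ha ha1 hk'.le hx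
      have h3 := abelKernel_nonneg ha (hk'.le.trans hx)
      have e : t (j + 1) - t p - step t (j + 1) = t j - t p := by
        rw [step, Nat.add_sub_cancel]; ring
      rw [e] at h2
      have h4 : step t p ^ 3 * abelKernel a (t (j + 1) - t p) ≤ step t p ^ 2 *
          (abelKernel (a + 1) (t (j + 1) - t p) - abelKernel (a + 1) (t j - t p)) := by
        calc _ = step t p ^ 2 * (step t p * abelKernel a (t (j + 1) - t p)) := by ring
          _ ≤ step t p ^ 2 * (step t (j + 1) * abelKernel a (t (j + 1) - t p)) :=
            mul_le_mul_of_nonneg_left (mul_le_mul_of_nonneg_right hkk h3) (sq_nonneg _)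
          _ ≤ _ := mul_le_mul_of_nonneg_left h2 (sq_nonneg _)
      rw [Finset.sum_Icc_succ_top (by omega)]
      linarith [ih (by omega)]
  have hst : step t p ≤ T := by
    simp only [step]
    linarith [hm.le_final hpN, hm.nonneg (show p - 1 ≤ N by omega)]
  have h1 := hK _ hk.le hst
  have h2 := hK (t N - t p) (by linarith [hm.mono hpN le_rfl])
    (by linarith [hm.final, hm.nonneg hpN])
  calc _ ≤ _ := main N hpN le_rfl
    _ ≤ step t p ^ 2 * (K + K) := mul_le_mul_of_nonneg_left (add_le_add h1 h2) (sq_nonneg _)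
    _ = _ := by ring

/-- Comparison of diagonal neighbours. As `k_{p-1} ≤ k_p ≤ k_n`, passing from `(n-1, p-1)` to `(n, p)`
decreases `sawWeight / k³`, so the weight itself grows by at most the factor `(k_p / k_{p-1})³`. -/
lemma abs_sawWeight_sub_le (ha : 0 < a) (ha1 : a ≤ 1) (hm : IsGradedMesh γ T cγ Cγ k N t)
    {n p : ℕ} (hp : 3 ≤ p) (hpn : p ≤ n) (hn : n ≤ N) :
    |sawWeight a (t n - t p) (step t p)
        - sawWeight a (t (n - 1) - t (p - 1)) (step t (p - 1))|
      ≤ 6 * ((step t p - step t (p - 1)) / step t p) * sawWeight a (t n - t p) (step t p)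
        + sawWeight a (t (n - 1) - t (p - 1)) (step t (p - 1))
        - sawWeight a (t n - t p) (step t p) := by
  have hk' : 0 < step t (p - 1) := hm.step_pos (by omega) (by omega)
  have hk : 0 < step t p := hm.step_pos (by omega) (by omega)
  have hkk : step t (p - 1) ≤ step t p := hm.step_le_step (by omega) (by omega) (by omega)
  have hkn : step t p ≤ step t n := hm.step_le_step (by omega) hpn hn
  have hx' : 0 ≤ t (n - 1) - t (p - 1) := sub_nonneg.2 (hm.mono (by omega) (by omega))
  have hxx : t (n - 1) - t (p - 1) ≤ t n - t p := by
    simp only [step] at hkn; linarith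
  have hmul := sawWeight_mul_le ha ha1 hx' hxx hk' hkk
  have hC : 0 ≤ sawWeight a (t n - t p) (step t p) := sawWeight_nonneg ha (by linarith) hk.le
  generalize sawWeight a (t n - t p) (step t p) = C at *
  generalize sawWeight a (t (n - 1) - t (p - 1)) (step t (p - 1)) = C' at *
  generalize step t p = κ at *
  generalize step t (p - 1) = κ' at *
  have hε : 0 ≤ 6 * ((κ - κ') / κ) * C := by
    have : 0 ≤ κ - κ' := by linarith
    positivity
  rw [abs_le]
  constructor
  · linarith
  · have h1 : C * (κ' / κ) ^ 3 ≤ C' := by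
      rw [div_pow, ← mul_div_assoc, div_le_iff₀ (by positivity)]
      exact hmul
    have h2 : (κ - κ') / κ = 1 - κ' / κ := by field_simp
    have hr1 : κ' / κ ≤ 1 := (div_le_one hk).2 hkk
    have hr0 : 0 ≤ κ' / κ := by positivity
    rw [h2]
    generalize κ' / κ = r at *
    have h3 : 1 - r ^ 3 ≤ 3 * (1 - r) := by nlinarith [mul_nonneg hr0 (sub_nonneg.2 hr1)]
    have h4 := mul_le_mul_of_nonneg_left h3 hC
    linarith

/-- The weight of the `p`-th cell in the bound for the variation of `sawDefect`. -/
def sawBound (α L : ℝ) (t : ℕ → ℝ) (p : ℕ) : ℝ :=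
  if p = 2 then 2 * (L * t 1 ^ (α - 1)) else
    2 * L * step t p * t (p - 2) ^ (α - 2)
      + 6 * ((step t p - step t (p - 1)) / step t p) * (L * t (p - 2) ^ (α - 1))

lemma sawBound_nonneg (hL : 0 ≤ L) (hm : IsGradedMesh γ T cγ Cγ k N t) {p : ℕ} (hp : 2 ≤ p)
    (hpN : p ≤ N) : 0 ≤ sawBound α L t p := by
  rw [sawBound]
  split_ifs with h
  · have := Real.rpow_nonneg (hm.nonneg (show 1 ≤ N by omega)) (α - 1)
    positivity
  · have h1 := Real.rpow_nonneg (hm.nonneg (show p - 2 ≤ N by omega)) (α - 1)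
    have h2 := Real.rpow_nonneg (hm.nonneg (show p - 2 ≤ N by omega)) (α - 2)
    have h3 := hm.step_pos (show 1 ≤ p by omega) hpN
    have h4 : 0 ≤ step t p - step t (p - 1) :=
      sub_nonneg.2 (hm.step_le_step (by omega) (by omega) hpN)
    positivity

lemma sum_norm_sawDefect_sub_le (ha : 0 < a) (ha1 : a ≤ 1) (hL : 0 ≤ L) (hα1 : α ≤ 1)
    (hm : IsGradedMesh γ T cγ Cγ k N t) (hb : IsGradedSmooth α T L b) {K : ℝ}
    (hK : ∀ x, 0 ≤ x → x ≤ T → abelKernel (a + 1) x ≤ K) :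
    ∑ n ∈ Finset.Icc 1 N, ‖sawDefect a t b n - sawDefect a t b (n - 1)‖
      ≤ 2 * K * ∑ p ∈ Finset.Icc 2 N, sawBound α L t p * step t p ^ 2 := by
  have h := sum_norm_sub_le_of_diagonal (N := N) (c := fun n p => sawWeight a (t n - t p) (step t p))
    (d := meshSlope b t) (D := fun p => L * t (p - 1) ^ (α - 1))
    (ε := fun p => 6 * ((step t p - step t (p - 1)) / step t p)) (η := sawBound α L t)
    (fun n p h2 hpn hn => sawWeight_nonneg ha (sub_nonneg.2 (hm.mono hpn hn))
      (hm.step_pos (by omega) (by omega)).le)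
    (fun p h2 hp => norm_meshSlope_le hb hm h2 hp)
    (fun p h3 hp => mul_le_mul_of_nonneg_left (Real.rpow_le_rpow_of_nonpos
      (hm.pos (by omega) (by omega)) (hm.mono (by omega) (by omega)) (by linarith)) hL)
    (fun n p h3 hpn hn => abs_sawWeight_sub_le ha ha1 hm h3 hpn hn)
    (by simp [sawBound])
    (fun p h3 hp => by
      rw [sawBound, if_neg (by omega), show p - 1 - 1 = p - 2 by omega]
      exact add_le_add (norm_meshSlope_sub_le hL hb hm h3 hp) le_rfl)
  refine h.trans ?_
  rw [Finset.mul_sum]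
  refine Finset.sum_le_sum fun p hp => ?_
  obtain ⟨h1, h2⟩ := Finset.mem_Icc.1 hp
  calc _ ≤ sawBound α L t p * (2 * K * step t p ^ 2) :=
        mul_le_mul_of_nonneg_left (sum_sawWeight_le ha ha1 hm hK h1 h2)
          (sawBound_nonneg hL hm h1 h2)
    _ = _ := by ring

/-- The accumulated quadrature error of the memory term. -/
theorem sum_norm_memoryDefect_sub_le [CompleteSpace H] (ha : 0 < a) (ha1 : a ≤ 1) (hL : 0 ≤ L)
    (hα : 0 < α) (hα1 : α ≤ 1) (hm : IsGradedMesh γ T cγ Cγ k N t) (hb : IsGradedSmooth α T L b)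
    {K : ℝ} (hK : ∀ x, 0 ≤ x → x ≤ T → abelKernel (a + 1) x ≤ K) :
    ∑ n ∈ Finset.Icc 1 N, ‖memoryDefect a t b n - memoryDefect a t b (n - 1)‖
      ≤ K * ∑ p ∈ Finset.Icc 1 N, step t p * residualBound α L t p
        + 2 * K * ∑ p ∈ Finset.Icc 2 N, sawBound α L t p * step t p ^ 2 := by
  refine le_trans ?_ (add_le_add (sum_norm_residualDefect_sub_le ha hL hα hm hb hK)
    (sum_norm_sawDefect_sub_le ha ha1 hL hα1 hm hb hK))
  rw [← Finset.sum_add_distrib]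
  refine Finset.sum_le_sum fun n hn => ?_
  obtain ⟨h1, h2⟩ := Finset.mem_Icc.1 hn
  rw [memoryDefect_eq_sub ha hm (hb.continuousOn hα) h2,
    memoryDefect_eq_sub ha hm (hb.continuousOn hα) (show n - 1 ≤ N by omega), sub_sub_sub_comm]
  exact norm_sub_le _ _

end Saw

/-! ### Sums over graded meshes -/

lemma sub_mul_rpow_le {β s t : ℝ} (hβ : β ≤ 0) (hβ1 : β + 1 ≠ 0) (hs : 0 < s) (hst : s < t) :
    (t - s) * t ^ β ≤ t ^ (β + 1) / (β + 1) - s ^ (β + 1) / (β + 1) := by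
  obtain ⟨ξ, hξ, h⟩ := exists_hasDerivAt_eq_slope (fun x => x ^ (β + 1) / (β + 1))
    (fun x => x ^ β) hst
    (fun x hx => ((Real.continuousAt_rpow_const x _ (Or.inl (hs.trans_le hx.1).ne')).div_const
      _).continuousWithinAt)
    (fun x hx => by
      have := (Real.hasDerivAt_rpow_const (x := x) (p := β + 1)
        (Or.inl (hs.trans hx.1).ne')).div_const (β + 1)
      rwa [add_sub_cancel_right, mul_div_cancel_left₀ _ hβ1] at this)
  have h0 : 0 < t - s := by linarith
  have h1 : t ^ (β + 1) / (β + 1) - s ^ (β + 1) / (β + 1) = (t - s) * ξ ^ β := by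
    rw [h]; field_simp
  rw [h1]
  exact mul_le_mul_of_nonneg_left
    (Real.rpow_le_rpow_of_nonpos (hs.trans hξ.1) hξ.2.le hβ) h0.le

lemma sub_div_le_log {s t : ℝ} (hs : 0 < s) (hst : s < t) :
    (t - s) * t ^ (-1 : ℝ) ≤ Real.log t - Real.log s := by
  have ht : 0 < t := hs.trans hst
  have h := Real.one_sub_inv_le_log_of_pos (div_pos ht hs)
  rw [Real.log_div ht.ne' hs.ne', inv_div] at h
  rw [Real.rpow_neg_one]
  calc (t - s) * t⁻¹ = 1 - s / t := by field_simp
    _ ≤ _ := h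

lemma sum_Icc_two_sub_pred (S : ℕ → ℝ) {N : ℕ} (hN : 1 ≤ N) :
    ∑ i ∈ Finset.Icc 2 N, (S i - S (i - 1)) = S N - S 1 := by
  induction N, hN using Nat.le_induction with
  | base => simp
  | succ n hn ih => rw [Finset.sum_Icc_succ_top (by omega), ih, Nat.add_sub_cancel]; ring

/-- A change of base point in a power costs a constant factor, whatever the sign of the exponent. -/
lemma rpow_le_max_mul_rpow {x y c e : ℝ} (hx : 0 < x) (hxy : x ≤ y) (hc : 0 < c)
    (hyc : y ≤ c * x) : x ^ e ≤ max 1 (c ^ (-e)) * y ^ e := by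
  have hy : 0 < y := hx.trans_le hxy
  have hye : 0 ≤ y ^ e := Real.rpow_nonneg hy.le _
  rcases le_total 0 e with he | he
  · calc x ^ e ≤ 1 * y ^ e := by rw [one_mul]; exact Real.rpow_le_rpow hx.le hxy he
      _ ≤ _ := mul_le_mul_of_nonneg_right (le_max_left _ _) hye
  · calc x ^ e = c ^ (-e) * (c * x) ^ e := by
          rw [Real.mul_rpow hc.le hx.le, ← mul_assoc, ← Real.rpow_add hc]; simp
      _ ≤ c ^ (-e) * y ^ e := mul_le_mul_of_nonneg_left
          (Real.rpow_le_rpow_of_nonpos hy hyc he) (Real.rpow_nonneg hc.le _)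
      _ ≤ _ := mul_le_mul_of_nonneg_right (le_max_right _ _) hye

section Sums

variable {α γ T cγ Cγ k : ℝ} {N : ℕ} {t : ℕ → ℝ}

namespace IsGradedMesh

lemma step_one (hm : IsGradedMesh γ T cγ Cγ k N t) : step t 1 = t 1 := by
  simp [step, hm.start]

lemma step_le_mul_rpow (hm : IsGradedMesh γ T cγ Cγ k N t) (hCγ : 0 < Cγ) {n : ℕ} (h1 : 1 ≤ n)
    (hn : n ≤ N) : step t n ≤ Cγ * k * t n ^ (1 - 1 / γ) :=
  (hm.step_le n h1 hn).trans (mul_le_mul_of_nonneg_left (min_le_right _ _)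
    (mul_pos hCγ hm.k_pos).le)

lemma first_le (hm : IsGradedMesh γ T cγ Cγ k N t) (hγ : 1 ≤ γ) (hCγ : 0 < Cγ) :
    t 1 ≤ (Cγ * k) ^ γ := by
  have hγ0 : 0 < γ := by linarith
  have ht1 : 0 < t 1 := hm.pos le_rfl hm.one_le
  have h := hm.step_le_mul_rpow hCγ le_rfl hm.one_le
  rw [hm.step_one, Real.rpow_sub ht1, Real.rpow_one, ← mul_div_assoc, le_div_iff₀
    (Real.rpow_pos_of_pos ht1 _), mul_comm (t 1)] at h
  have h2 := le_of_mul_le_mul_right h ht1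
  calc t 1 = (t 1 ^ (1 / γ)) ^ γ := by
        rw [← Real.rpow_mul ht1.le, one_div_mul_cancel hγ0.ne', Real.rpow_one]
    _ ≤ _ := Real.rpow_le_rpow (Real.rpow_nonneg ht1.le _) h2 hγ0.le

lemma first_rpow_le (hm : IsGradedMesh γ T cγ Cγ k N t) (hα : 0 < α) (hγ : 1 ≤ γ) (hCγ : 0 < Cγ) :
    t 1 ^ (1 + α) ≤ Cγ ^ (γ * (1 + α)) * k ^ (γ * (1 + α)) := by
  have ht1 : 0 < t 1 := hm.pos le_rfl hm.one_le
  rw [← Real.mul_rpow hCγ.le hm.k_pos.le, Real.rpow_mul (mul_pos hCγ hm.k_pos).le]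
  exact Real.rpow_le_rpow ht1.le (hm.first_le hγ hCγ) (by linarith)

lemma k_le (hm : IsGradedMesh γ T cγ Cγ k N t) (hγ : 1 ≤ γ) (hcγ : 0 < cγ) :
    k ≤ (T / cγ) ^ (1 / γ) := by
  have hγ0 : 0 < γ := by linarith
  have h1 : k ^ γ ≤ T / cγ := by
    rw [le_div_iff₀ hcγ, mul_comm]
    exact hm.first_ge.trans (hm.le_final hm.one_le)
  calc k = (k ^ γ) ^ (1 / γ) := by
        rw [← Real.rpow_mul hm.k_pos.le, mul_one_div_cancel hγ0.ne', Real.rpow_one]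
    _ ≤ _ := Real.rpow_le_rpow (Real.rpow_nonneg hm.k_pos.le _) h1 (by positivity)

end IsGradedMesh

/-- The two basic quantities, the contribution of the first interval and a Riemann sum of
`k² t^{α-2/γ}` over the others, are bounded by the error bound. The three regimes of the error
bound are those of the integral of `t^{α-2/γ}`. -/
lemma exists_first_and_sum_le (hα : 0 < α) (hγ : 1 ≤ γ) (hT : 0 < T) (hcγ : 0 < cγ)
    (hCγ : 0 < Cγ) {θ : ℝ} (hθ : 0 < θ) (hθ1 : θ < 1) :
    ∃ C : ℝ, 0 < C ∧ ∀ (k : ℝ) (N : ℕ) (t : ℕ → ℝ), IsGradedMesh γ T cγ Cγ k N t →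
      (γ = 2 / (1 + α) → t 1 ≤ θ * t N) →
      0 ≤ errorBound k α γ (t 1) (t N) ∧
      t 1 ^ (1 + α) ≤ C * errorBound k α γ (t 1) (t N) ∧
      k ^ 2 * ∑ p ∈ Finset.Icc 2 N, step t p * t p ^ (α - 2 / γ)
        ≤ C * errorBound k α γ (t 1) (t N) := by
  have hγ0 : 0 < γ := by linarith
  have hα1 : 0 < 1 + α := by linarith
  have hrel : γ * (α - 2 / γ + 1) = γ * (1 + α) - 2 := by field_simp; ring
  set β := α - 2 / γ with hβ
  have hC0 : 0 < Cγ ^ (γ * (1 + α)) := Real.rpow_pos_of_pos hCγ _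
  rcases lt_trichotomy γ (2 / (1 + α)) with h | h | h
  · have hlt : γ * (1 + α) < 2 := (lt_div_iff₀ hα1).1 h
    have hβ1 : β + 1 < 0 := by nlinarith
    refine ⟨Cγ ^ (γ * (1 + α)) + cγ ^ (β + 1) / (-(β + 1)), add_pos hC0
      (div_pos (Real.rpow_pos_of_pos hcγ _) (by linarith)), fun k N t hm _ => ?_⟩
    have hk := hm.k_pos
    have ht1 : 0 < t 1 := hm.pos le_rfl hm.one_le
    rw [errorBound, if_pos h]
    have hΞ : 0 ≤ k ^ (γ * (1 + α)) := Real.rpow_nonneg hk.le _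
    have hc : 0 ≤ cγ ^ (β + 1) / (-(β + 1)) :=
      div_nonneg (Real.rpow_nonneg hcγ.le _) (by linarith)
    refine ⟨hΞ, (hm.first_rpow_le hα hγ hCγ).trans
      (mul_le_mul_of_nonneg_right (by linarith) hΞ), ?_⟩
    have h1 : ∑ p ∈ Finset.Icc 2 N, step t p * t p ^ β ≤ t 1 ^ (β + 1) / (-(β + 1)) := by
      calc _ ≤ ∑ p ∈ Finset.Icc 2 N, (t p ^ (β + 1) / (β + 1) - t (p - 1) ^ (β + 1) / (β + 1)) := by
            refine Finset.sum_le_sum fun p hp => ?_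
            obtain ⟨hp2, hpN⟩ := Finset.mem_Icc.1 hp
            exact sub_mul_rpow_le (by linarith) hβ1.ne (hm.pos (by omega) (by omega))
              (hm.increasing p (by omega) hpN)
        _ = t N ^ (β + 1) / (β + 1) - t 1 ^ (β + 1) / (β + 1) :=
            sum_Icc_two_sub_pred (fun p => t p ^ (β + 1) / (β + 1)) hm.one_le
        _ ≤ _ := by
            have := div_nonpos_of_nonneg_of_nonpos
              (Real.rpow_nonneg (hm.nonneg (le_refl N)) (β + 1)) hβ1.le
            rw [div_neg]; linarith
    have h2 : t 1 ^ (β + 1) ≤ cγ ^ (β + 1) * k ^ (γ * (β + 1)) := by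
      rw [Real.rpow_mul hk.le, ← Real.mul_rpow hcγ.le (Real.rpow_nonneg hk.le _)]
      exact Real.rpow_le_rpow_of_nonpos (mul_pos hcγ (Real.rpow_pos_of_pos hk _)) hm.first_ge
        hβ1.le
    have h3 : k ^ 2 * k ^ (γ * (β + 1)) = k ^ (γ * (1 + α)) := by
      rw [← Real.rpow_natCast k 2, ← Real.rpow_add hk, hrel]; congr 1; push_cast; ring
    calc _ ≤ k ^ 2 * (cγ ^ (β + 1) * k ^ (γ * (β + 1)) / (-(β + 1))) :=
          mul_le_mul_of_nonneg_left (h1.trans (div_le_div_of_nonneg_right h2 (by linarith)))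
            (sq_nonneg k)
      _ = cγ ^ (β + 1) / (-(β + 1)) * (k ^ 2 * k ^ (γ * (β + 1))) := by ring
      _ ≤ _ := by rw [h3]; exact mul_le_mul_of_nonneg_right (by linarith) hΞ
  · have heq : γ * (1 + α) = 2 := by rw [h]; field_simp
    have hβ1 : β = -1 := by
      have : γ * (β + 1) = 0 := by rw [hrel, heq, sub_self]
      rcases mul_eq_zero.1 this with h0 | h0 <;> linarith
    have hlogθ : 0 < -Real.log θ := by linarith [Real.log_neg hθ hθ1]
    refine ⟨Cγ ^ (γ * (1 + α)) / (-Real.log θ) + 1, by positivity, fun k N t hm hθt => ?_⟩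
    have hk := hm.k_pos
    have ht1 : 0 < t 1 := hm.pos le_rfl hm.one_le
    have htN : 0 < t N := hm.pos hm.one_le le_rfl
    have hlog : -Real.log θ ≤ Real.log (t N / t 1) := by
      rw [← Real.log_inv]
      refine Real.log_le_log (inv_pos.2 hθ) ?_
      rw [le_div_iff₀ ht1, inv_mul_le_iff₀ hθ]
      exact hθt h
    rw [errorBound, if_neg (by linarith), if_pos h]
    have hΞ : 0 ≤ k ^ 2 * Real.log (t N / t 1) := mul_nonneg (sq_nonneg k) (by linarith)
    refine ⟨hΞ, ?_, ?_⟩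
    · have h1 := hm.first_rpow_le hα hγ hCγ
      have h2 : k ^ (γ * (1 + α)) = k ^ 2 := by rw [heq]; exact Real.rpow_two k
      rw [h2] at h1
      calc _ ≤ _ := h1
        _ = Cγ ^ (γ * (1 + α)) / (-Real.log θ) * (k ^ 2 * (-Real.log θ)) := by
            have h0 := hlogθ.ne'
            generalize -Real.log θ = l at h0
            field_simp
        _ ≤ Cγ ^ (γ * (1 + α)) / (-Real.log θ) * (k ^ 2 * Real.log (t N / t 1)) :=
            mul_le_mul_of_nonneg_left (mul_le_mul_of_nonneg_left hlog (sq_nonneg k))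
              (by positivity)
        _ ≤ _ := mul_le_mul_of_nonneg_right (by linarith) hΞ
    · have h1 : ∑ p ∈ Finset.Icc 2 N, step t p * t p ^ β ≤ Real.log (t N / t 1) := by
        calc _ ≤ ∑ p ∈ Finset.Icc 2 N, (Real.log (t p) - Real.log (t (p - 1))) := by
              refine Finset.sum_le_sum fun p hp => ?_
              obtain ⟨hp2, hpN⟩ := Finset.mem_Icc.1 hp
              rw [hβ1]
              exact sub_div_le_log (hm.pos (by omega) (by omega)) (hm.increasing p (by omega) hpN)
          _ = Real.log (t N) - Real.log (t 1) :=
              sum_Icc_two_sub_pred (fun p => Real.log (t p)) hm.one_le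
          _ = _ := (Real.log_div htN.ne' ht1.ne').symm
      have h2 : 0 ≤ Cγ ^ (γ * (1 + α)) / (-Real.log θ) := by positivity
      calc _ ≤ 1 * (k ^ 2 * Real.log (t N / t 1)) := by
            rw [one_mul]; exact mul_le_mul_of_nonneg_left h1 (sq_nonneg k)
        _ ≤ _ := mul_le_mul_of_nonneg_right (by linarith) hΞ
  · have hlt : 2 < γ * (1 + α) := (div_lt_iff₀ hα1).1 h
    have hβ1 : 0 < β + 1 := by
      have : 0 < γ * (β + 1) := by linarith
      exact pos_of_mul_pos_right this hγ0.le
    set k0 := (T / cγ) ^ (1 / γ) with hk0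
    have hk0p : 0 < k0 := by positivity
    refine ⟨Cγ ^ (γ * (1 + α)) * k0 ^ (γ * (1 + α) - 2) + (T ^ (β + 1) / (β + 1) + T ^ β * T),
      by positivity, fun k N t hm _ => ?_⟩
    have hk := hm.k_pos
    have ht1 : 0 < t 1 := hm.pos le_rfl hm.one_le
    rw [errorBound, if_neg (by linarith), if_neg h.ne']
    have hc1 : 0 ≤ Cγ ^ (γ * (1 + α)) * k0 ^ (γ * (1 + α) - 2) := by positivity
    have hc2 : 0 ≤ T ^ (β + 1) / (β + 1) := by positivity
    have hc3 : 0 ≤ T ^ β * T := by positivity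
    refine ⟨sq_nonneg k, ?_, ?_⟩
    · have h1 := hm.first_rpow_le hα hγ hCγ
      have h2 : k ^ (γ * (1 + α)) = k ^ (γ * (1 + α) - 2) * k ^ 2 := by
        rw [← Real.rpow_natCast k 2, ← Real.rpow_add hk]; congr 1; push_cast; ring
      have h3 : k ^ (γ * (1 + α) - 2) ≤ k0 ^ (γ * (1 + α) - 2) :=
        Real.rpow_le_rpow hk.le (hm.k_le hγ hcγ) (by linarith)
      rw [h2, ← mul_assoc] at h1
      refine h1.trans (mul_le_mul_of_nonneg_right ?_ (sq_nonneg k))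
      linarith [mul_le_mul_of_nonneg_left h3 hC0.le]
    · have h1 : ∑ p ∈ Finset.Icc 2 N, step t p * t p ^ β ≤ T ^ (β + 1) / (β + 1) + T ^ β * T := by
        rcases le_total β 0 with hβ0 | hβ0
        · calc _ ≤ ∑ p ∈ Finset.Icc 2 N,
                (t p ^ (β + 1) / (β + 1) - t (p - 1) ^ (β + 1) / (β + 1)) := by
                refine Finset.sum_le_sum fun p hp => ?_
                obtain ⟨hp2, hpN⟩ := Finset.mem_Icc.1 hp
                exact sub_mul_rpow_le hβ0 hβ1.ne' (hm.pos (by omega) (by omega))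
                  (hm.increasing p (by omega) hpN)
            _ = t N ^ (β + 1) / (β + 1) - t 1 ^ (β + 1) / (β + 1) :=
                sum_Icc_two_sub_pred (fun p => t p ^ (β + 1) / (β + 1)) hm.one_le
            _ ≤ T ^ (β + 1) / (β + 1) := by
                have g1 : 0 ≤ t 1 ^ (β + 1) / (β + 1) := by positivity
                have g2 := div_le_div_of_nonneg_right
                  (Real.rpow_le_rpow (hm.nonneg (le_refl N)) hm.final hβ1.le) hβ1.le
                linarith
            _ ≤ _ := by linarith
        · calc _ ≤ ∑ p ∈ Finset.Icc 2 N, T ^ β * (t p - t (p - 1)) := by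
                refine Finset.sum_le_sum fun p hp => ?_
                obtain ⟨hp2, hpN⟩ := Finset.mem_Icc.1 hp
                rw [mul_comm]
                exact mul_le_mul_of_nonneg_right (Real.rpow_le_rpow (hm.nonneg hpN)
                  (hm.le_final hpN) hβ0) (hm.step_pos (by omega) hpN).le
            _ = T ^ β * (t N - t 1) := by
                rw [← Finset.mul_sum, sum_Icc_two_sub_pred t hm.one_le]
            _ ≤ T ^ β * T := mul_le_mul_of_nonneg_left (by linarith [hm.final]) (by positivity)
            _ ≤ _ := by linarith
      rw [mul_comm]
      exact mul_le_mul_of_nonneg_right (by linarith) (sq_nonneg k)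

/-- Two of the three factors `k_p` are traded for `k t_p^{1-1/γ}`. The base point `x` is `t_{p-1}` or
`t_{p-2}`, which are comparable with `t_p`. -/
lemma step_cube_mul_le (hCγ : 0 < Cγ) (hm : IsGradedMesh γ T cγ Cγ k N t)
    {p : ℕ} (h1 : 1 ≤ p) (hp : p ≤ N) {x c : ℝ} (hx : 0 < x) (hxt : x ≤ t p) (hc : 0 < c)
    (htx : t p ≤ c * x) :
    step t p ^ 3 * x ^ (α - 2)
      ≤ max 1 (c ^ (-(α - 2))) * Cγ ^ 2 * (k ^ 2 * (step t p * t p ^ (α - 2 / γ))) := by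
  have hs := hm.step_pos h1 hp
  have htp := hm.pos h1 hp
  have g1 := rpow_le_max_mul_rpow (e := α - 2) hx hxt hc htx
  have g2 := hm.step_le_mul_rpow hCγ h1 hp
  have g3 : step t p ^ 2 ≤ (Cγ * k * t p ^ (1 - 1 / γ)) ^ 2 := by gcongr
  have e : (t p ^ (1 - 1 / γ)) ^ 2 * t p ^ (α - 2) = t p ^ (α - 2 / γ) := by
    rw [← Real.rpow_natCast, ← Real.rpow_mul htp.le, ← Real.rpow_add htp]
    congr 1; push_cast; ring
  have h0 : 0 ≤ max 1 (c ^ (-(α - 2))) := le_trans zero_le_one (le_max_left _ _)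
  calc step t p ^ 3 * x ^ (α - 2) ≤ step t p ^ 3 * (max 1 (c ^ (-(α - 2))) * t p ^ (α - 2)) :=
        mul_le_mul_of_nonneg_left g1 (by positivity)
    _ = (step t p * max 1 (c ^ (-(α - 2))) * t p ^ (α - 2)) * step t p ^ 2 := by ring
    _ ≤ (step t p * max 1 (c ^ (-(α - 2))) * t p ^ (α - 2)) * (Cγ * k * t p ^ (1 - 1 / γ)) ^ 2 :=
        mul_le_mul_of_nonneg_left g3 (by positivity)
    _ = max 1 (c ^ (-(α - 2))) * Cγ ^ 2 * (k ^ 2 * (step t p *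
          ((t p ^ (1 - 1 / γ)) ^ 2 * t p ^ (α - 2)))) := by ring
    _ = _ := by rw [e]

lemma step_mul_step_sub_mul_le (hCγ : 0 < Cγ) (hm : IsGradedMesh γ T cγ Cγ k N t)
    {p : ℕ} (h3 : 3 ≤ p) (hp : p ≤ N) :
    step t p * (step t p - step t (p - 1)) * t (p - 2) ^ (α - 1)
      ≤ max 1 ((Cγ ^ 2) ^ (-(α - 1))) * max 1 (Cγ ^ (-(1 - 2 / γ))) * Cγ *
        (k ^ 2 * (step t p * t p ^ (α - 2 / γ))) := by
  have hs := hm.step_pos (by omega) hp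
  have htp := hm.pos (by omega) hp
  have ht1 : 0 < t (p - 1) := hm.pos (by omega) (by omega)
  have ht2 : 0 < t (p - 2) := hm.pos (by omega) (by omega)
  have r1 := hm.ratio_le p (by omega) hp
  have r2 := hm.ratio_le (p - 1) (by omega) (by omega)
  rw [show p - 1 - 1 = p - 2 by omega] at r2
  have r3 : t p ≤ Cγ ^ 2 * t (p - 2) := by
    calc _ ≤ _ := r1
      _ ≤ Cγ * (Cγ * t (p - 2)) := mul_le_mul_of_nonneg_left r2 hCγ.le
      _ = _ := by ring
  have g1 := rpow_le_max_mul_rpow (e := α - 1) ht2 (hm.mono (by omega) hp) (by positivity) r3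
  have g2 := rpow_le_max_mul_rpow (e := 1 - 2 / γ) ht1 (hm.mono (by omega) hp) hCγ r1
  have g3 := hm.step_diff_le (p - 1) (by omega) (by omega)
  have g0 := hm.step_mono (p - 1) (by omega) (by omega)
  rw [show p - 1 + 1 = p by omega] at g3 g0
  have e : t p ^ (1 - 2 / γ) * t p ^ (α - 1) = t p ^ (α - 2 / γ) := by
    rw [← Real.rpow_add htp]; congr 1; ring
  generalize max 1 ((Cγ ^ 2) ^ (-(α - 1))) = m1 at *
  have hm2 : 0 ≤ max 1 (Cγ ^ (-(1 - 2 / γ))) := le_trans zero_le_one (le_max_left _ _)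
  generalize max 1 (Cγ ^ (-(1 - 2 / γ))) = m2 at *
  have hk := hm.k_pos
  have g4 : step t p - step t (p - 1) ≤ Cγ * k ^ 2 * (m2 * t p ^ (1 - 2 / γ)) :=
    g3.trans (mul_le_mul_of_nonneg_left g2 (by positivity))
  calc step t p * (step t p - step t (p - 1)) * t (p - 2) ^ (α - 1)
      ≤ step t p * (Cγ * k ^ 2 * (m2 * t p ^ (1 - 2 / γ))) * (m1 * t p ^ (α - 1)) := by
        refine mul_le_mul (mul_le_mul_of_nonneg_left g4 hs.le) g1
          (Real.rpow_nonneg ht2.le _) ?_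
        have := Real.rpow_nonneg htp.le (1 - 2 / γ)
        positivity
    _ = m1 * m2 * Cγ * (k ^ 2 * (step t p * (t p ^ (1 - 2 / γ) * t p ^ (α - 1)))) := by ring
    _ = _ := by rw [e]

/-- All consistency errors are bounded by the error bound. -/
theorem exists_mesh_sums_le (hα : 0 < α) (hγ : 1 ≤ γ) (hT : 0 < T) (hcγ : 0 < cγ)
    (hCγ : 0 < Cγ) {θ : ℝ} (hθ : 0 < θ) (hθ1 : θ < 1) :
    ∃ C : ℝ, 0 < C ∧ ∀ (k : ℝ) (N : ℕ) (t : ℕ → ℝ), IsGradedMesh γ T cγ Cγ k N t →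
      (γ = 2 / (1 + α) → t 1 ≤ θ * t N) →
      0 ≤ errorBound k α γ (t 1) (t N) ∧
      t 1 ^ (1 + α) ≤ C * errorBound k α γ (t 1) (t N) ∧
      (∑ p ∈ Finset.Icc 2 N, step t p ^ 3 * t (p - 1) ^ (α - 2)
        ≤ C * errorBound k α γ (t 1) (t N)) ∧
      ∀ L : ℝ, 0 ≤ L →
        (∑ p ∈ Finset.Icc 1 N, step t p * residualBound α L t p
          ≤ L * (C * errorBound k α γ (t 1) (t N))) ∧
        (∑ p ∈ Finset.Icc 2 N, sawBound α L t p * step t p ^ 2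
          ≤ L * (C * errorBound k α γ (t 1) (t N))) := by
  obtain ⟨C₀, hC₀, h₀⟩ := exists_first_and_sum_le (α := α) hα hγ hT hcγ hCγ hθ hθ1
  set m1 := max 1 (Cγ ^ (-(α - 2))) * Cγ ^ 2 with hm1
  set m2 := max 1 ((Cγ ^ 2) ^ (-(α - 2))) * Cγ ^ 2 with hm2
  set m3 := max 1 ((Cγ ^ 2) ^ (-(α - 1))) * max 1 (Cγ ^ (-(1 - 2 / γ))) * Cγ with hm3
  have pm1 : 0 < m1 := by positivity
  have pm2 : 0 < m2 := by positivity
  have pm3 : 0 < m3 := by positivity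
  set m4 := 2 * m2 + 6 * m3 with hm4
  have pm4 : 0 < m4 := by positivity
  refine ⟨(1 + m1 + m4 + 2 * Cγ ^ 2) * C₀, by positivity, fun k N t hm hθt => ?_⟩
  obtain ⟨hΞ, hfirst, hsum⟩ := h₀ k N t hm hθt
  set Ξ := errorBound k α γ (t 1) (t N) with hΞd
  have hk := hm.k_pos
  have ht1 : 0 < t 1 := hm.pos le_rfl hm.one_le
  have hCΞ : 0 ≤ C₀ * Ξ := by positivity
  have weaken : ∀ {m : ℝ}, m ≤ 1 + m1 + m4 + 2 * Cγ ^ 2 →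
      m * (C₀ * Ξ) ≤ (1 + m1 + m4 + 2 * Cγ ^ 2) * C₀ * Ξ := fun h => by
    rw [mul_assoc]; exact mul_le_mul_of_nonneg_right h hCΞ
  have pC : 0 < Cγ ^ 2 := by positivity
  have hcube : ∑ p ∈ Finset.Icc 2 N, step t p ^ 3 * t (p - 1) ^ (α - 2) ≤ m1 * (C₀ * Ξ) := by
    calc _ ≤ ∑ p ∈ Finset.Icc 2 N, m1 * (k ^ 2 * (step t p * t p ^ (α - 2 / γ))) := by
          refine Finset.sum_le_sum fun p hp => ?_
          obtain ⟨h2, hpN⟩ := Finset.mem_Icc.1 hp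
          exact step_cube_mul_le hCγ hm (by omega) hpN (hm.pos (by omega) (by omega))
            (hm.mono (by omega) hpN) hCγ (hm.ratio_le p h2 hpN)
      _ = m1 * (k ^ 2 * ∑ p ∈ Finset.Icc 2 N, step t p * t p ^ (α - 2 / γ)) := by
          rw [Finset.mul_sum, Finset.mul_sum]
      _ ≤ _ := mul_le_mul_of_nonneg_left hsum pm1.le
  refine ⟨hΞ, ?_, hcube.trans (weaken (by linarith)), fun L hL => ⟨?_, ?_⟩⟩
  · refine le_trans ?_ (weaken (m := 1) (by linarith))
    rwa [one_mul]
  · have hins : Finset.Icc 1 N = insert 1 (Finset.Icc 2 N) := by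
      have := hm.one_le
      ext; simp; omega
    have e1 : step t 1 * residualBound α L t 1 = L * t 1 ^ (1 + α) := by
      rw [residualBound, if_pos rfl, hm.step_one, add_comm, Real.rpow_add_one ht1.ne']; ring
    have e2 : ∑ p ∈ Finset.Icc 2 N, step t p * residualBound α L t p
        = L * ∑ p ∈ Finset.Icc 2 N, step t p ^ 3 * t (p - 1) ^ (α - 2) := by
      rw [Finset.mul_sum]
      refine Finset.sum_congr rfl fun p hp => ?_
      obtain ⟨h2, hpN⟩ := Finset.mem_Icc.1 hp
      rw [residualBound, if_neg (by omega)]; ring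
    rw [hins, Finset.sum_insert (by simp), e1, e2, ← mul_add]
    refine mul_le_mul_of_nonneg_left (le_trans (add_le_add hfirst hcube) ?_) hL
    have := weaken (m := 1 + m1) (by linarith)
    linarith
  · have hterm : ∀ p ∈ Finset.Icc 2 N, sawBound α L t p * step t p ^ 2
        ≤ L * (m4 * (k ^ 2 * (step t p * t p ^ (α - 2 / γ))))
          + if p = 2 then L * (2 * Cγ ^ 2 * t 1 ^ (1 + α)) else 0 := by
      intro p hp
      obtain ⟨h2, hpN⟩ := Finset.mem_Icc.1 hp
      have hs := hm.step_pos (by omega) hpN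
      have htp := hm.pos (by omega) hpN
      rcases h2.eq_or_lt with h | h
      · subst h
        rw [if_pos rfl, sawBound, if_pos rfl]
        have g1 : step t 2 ≤ Cγ * t 1 := by
          have := hm.ratio_le 2 le_rfl hpN
          rw [step]; simp only [Nat.add_one_sub_one] at *; linarith
        have g2 : step t 2 ^ 2 ≤ (Cγ * t 1) ^ 2 := by gcongr
        have g3 : t 1 ^ (1 + α) = t 1 ^ (α - 1) * t 1 ^ 2 := by
          rw [← Real.rpow_natCast (t 1) 2, ← Real.rpow_add ht1]; congr 1; push_cast; ring
        have g4 : 0 ≤ 2 * (L * t 1 ^ (α - 1)) := by positivity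
        have g5 : 0 ≤ L * (m4 * (k ^ 2 * (step t 2 * t 2 ^ (α - 2 / γ)))) := by positivity
        have g6 := mul_le_mul_of_nonneg_left g2 g4
        rw [g3]
        linarith
      · have r1 := hm.ratio_le p (by omega) hpN
        have r2 := hm.ratio_le (p - 1) (by omega) (by omega)
        rw [show p - 1 - 1 = p - 2 by omega] at r2
        have r3 : t p ≤ Cγ ^ 2 * t (p - 2) := by
          calc _ ≤ _ := r1
            _ ≤ Cγ * (Cγ * t (p - 2)) := mul_le_mul_of_nonneg_left r2 hCγ.le
            _ = _ := by ring
        have g1 := step_cube_mul_le (α := α) hCγ hm (by omega) hpN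
          (hm.pos (show 1 ≤ p - 2 by omega) (by omega)) (hm.mono (by omega) hpN) pC r3
        have g2 := step_mul_step_sub_mul_le (α := α) hCγ hm h hpN
        rw [if_neg (by omega), sawBound, if_neg (by omega), add_zero]
        have e : (2 * L * step t p * t (p - 2) ^ (α - 2)
            + 6 * ((step t p - step t (p - 1)) / step t p) * (L * t (p - 2) ^ (α - 1)))
              * step t p ^ 2
            = L * (2 * (step t p ^ 3 * t (p - 2) ^ (α - 2))
              + 6 * (step t p * (step t p - step t (p - 1)) * t (p - 2) ^ (α - 1))) := by
          field_simp
        rw [e]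
        refine mul_le_mul_of_nonneg_left ?_ hL
        rw [hm4, add_mul]
        linarith
    have hite : ∑ p ∈ Finset.Icc 2 N, (if p = 2 then L * (2 * Cγ ^ 2 * t 1 ^ (1 + α)) else 0)
        ≤ L * (2 * Cγ ^ 2 * t 1 ^ (1 + α)) := by
      rw [Finset.sum_ite_eq']
      split_ifs
      · exact le_rfl
      · positivity
    calc _ ≤ _ := Finset.sum_le_sum hterm
      _ ≤ L * (m4 * (k ^ 2 * ∑ p ∈ Finset.Icc 2 N, step t p * t p ^ (α - 2 / γ)))
          + L * (2 * Cγ ^ 2 * t 1 ^ (1 + α)) := by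
          rw [Finset.sum_add_distrib]
          refine add_le_add (le_of_eq ?_) hite
          rw [Finset.mul_sum, Finset.mul_sum, Finset.mul_sum]
      _ ≤ L * (m4 * (C₀ * Ξ)) + L * (2 * Cγ ^ 2 * (C₀ * Ξ)) := by gcongr
      _ = L * ((m4 + 2 * Cγ ^ 2) * (C₀ * Ξ)) := by ring
      _ ≤ _ := mul_le_mul_of_nonneg_left (weaken (by linarith)) hL

end Sums

/-! ### Positivity of the discrete memory operators -/

lemma sum_sum_inner_app_nonneg [CompleteSpace H] {A B : H →ₗ.[ℝ] H} {M : ℝ}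
    (hB : IsDominated A B M) {s : ℕ → H} (hs : ∀ p, s p ∈ B.domain) (I : Finset ℕ) (c : ℕ → ℝ) :
    0 ≤ ∑ n ∈ I, ∑ p ∈ I, c n * c p * ⟪app B (s p), s n⟫_ℝ := by
  have hmem : ∀ p ∈ I, c p • s p ∈ B.domain := fun p _ => B.domain.smul_mem _ (hs p)
  have h := hB.nonneg (∑ p ∈ I, c p • s p) (sum_mem hmem)
  rw [app_sum B hmem, inner_sum] at h
  refine h.trans_eq (Finset.sum_congr rfl fun n _ => ?_)
  rw [sum_inner]
  refine Finset.sum_congr rfl fun p _ => ?_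
  rw [app_smul B _ (hs p), real_inner_smul_left, real_inner_smul_right]
  ring

/-- The discrete fractional integral of `B s` is nonnegative when tested with `s` and summed. -/
lemma sum_inner_memory_nonneg [CompleteSpace H] {A B : H →ₗ.[ℝ] H} {M a : ℝ} (ha : 0 < a)
    (ha1 : a < 1) (hB : IsDominated A B M) {t : ℕ → ℝ} {m : ℕ}
    (ht : ∀ n, 1 ≤ n → n ≤ m → t (n - 1) < t n) {s : ℕ → H}
    (hs : ∀ p, 1 ≤ p → p ≤ m → s p ∈ A.domain) :
    0 ≤ ∑ n ∈ Finset.Icc 1 m, ⟪step t n • ∑ p ∈ Finset.Icc 1 n,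
      (piWeight a t n p * step t p) • app B (s p), s n⟫_ℝ := by
  set s' : ℕ → H := fun p => if 1 ≤ p ∧ p ≤ m then s p else 0 with hs'
  have hs'm : ∀ p, s' p ∈ B.domain := by
    intro p
    simp only [hs']
    split_ifs with h
    · exact hB.domain_le (hs p h.1 h.2)
    · exact B.domain.zero_mem
  have heq : ∀ p, 1 ≤ p → p ≤ m → s' p = s p := fun p h1 h2 => if_pos ⟨h1, h2⟩
  have h := sum_piWeight_mul_nonneg ha ha1 ht (fun n p => ⟪app B (s' p), s' n⟫_ℝ)
    (fun n p => by rw [app_symm hB.selfAdjoint (hs'm p) (hs'm n), real_inner_comm])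
    (fun c => sum_sum_inner_app_nonneg hB hs'm _ c)
  refine h.trans_eq (Finset.sum_congr rfl fun n hn => ?_)
  obtain ⟨h1, h2⟩ := Finset.mem_Icc.1 hn
  rw [real_inner_smul_left, sum_inner, Finset.mul_sum]
  refine Finset.sum_congr rfl fun p hp => ?_
  obtain ⟨h3, h4⟩ := Finset.mem_Icc.1 hp
  rw [real_inner_smul_left, heq p h3 (by omega), heq n h1 h2]
  ring

/-! ### The equation for `v = e^{κ t} u` and its integrated form -/

section Integrated

variable {m : ℕ} {A : H →ₗ.[ℝ] H} {B : Fin m → H →ₗ.[ℝ] H} {a : Fin m → ℝ}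
  {α κ T M lam : ℝ} {f u : ℝ → H} {u₀ : H}

lemma continuousOn_untemper (hu : ContinuousOn u (Icc 0 T)) :
    ContinuousOn (untemper κ u) (Icc 0 T) := by
  have : Continuous fun t : ℝ => Real.exp (κ * t) := by fun_prop
  exact this.continuousOn.smul hu

lemma untemper_mem {D : Submodule ℝ H} {t : ℝ} (h : u t ∈ D) : untemper κ u t ∈ D :=
  D.smul_mem _ h

/-- The exponential weights cancel: `v` solves the equation with the untempered Abel kernels. -/
lemma hasDerivAt_untemper (hB : ∀ j, A.domain ≤ (B j).domain)
    (hu : IsSolution A B a κ T f u₀ u) {t : ℝ} (ht : t ∈ Ioo 0 T) :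
    HasDerivAt (untemper κ u) (κ • untemper κ u t + untemper κ f t - app A (untemper κ u t)
      - ∑ j, ∫ s in (0 : ℝ)..t, abelKernel (a j) (t - s) • app (B j) (untemper κ u s)) t := by
  have h1 : HasDerivAt (fun t : ℝ => Real.exp (κ * t)) (Real.exp (κ * t) * κ) t := by
    simpa using ((hasDerivAt_id t).const_mul κ).exp
  have h2 := h1.smul (hu.equation t ht)
  have hint : ∀ j, Real.exp (κ * t) • (∫ s in (0 : ℝ)..t, temperedKernel κ (a j) (t - s) •
      app (B j) (u s))
      = ∫ s in (0 : ℝ)..t, abelKernel (a j) (t - s) • app (B j) (untemper κ u s) := by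
    intro j
    rw [← intervalIntegral.integral_smul]
    refine intervalIntegral.integral_congr_ae (.of_forall fun s hs => ?_)
    rw [uIoc_of_le ht.1.le] at hs
    have hmem : u s ∈ (B j).domain := hB j (hu.mem_domain s ⟨hs.1, hs.2.trans_lt ht.2⟩)
    rw [untemper, app_smul _ _ hmem, smul_smul, smul_smul]
    congr 1
    have e : Real.exp (κ * t) * Real.exp (-κ * (t - s)) = Real.exp (κ * s) := by
      rw [← Real.exp_add]; congr 1; ring
    rw [temperedKernel, abelKernel, ← e]
    ring
  convert! h2 using 1
  rw [smul_sub, smul_sub, Finset.smul_sum]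
  simp only [hint]
  rw [untemper, untemper, app_smul A _ (hu.mem_domain t ht), smul_smul, mul_comm κ]
  abel

lemma intervalIntegrable_deriv [CompleteSpace H] (hA : IsElliptic A lam) (hlam : 0 < lam)
    (hα : 0 < α) (hT : 0 ≤ T) {v : ℝ → H} (hv : IsRegularSolution A α T M v) :
    IntervalIntegrable (deriv v) volume 0 T := by
  have hb : IntervalIntegrable (fun t : ℝ => 1 / lam * (M * t ^ (α - 1))) volume 0 T :=
    ((intervalIntegral.intervalIntegrable_rpow' (by linarith : -1 < α - 1)).const_mul M).const_mul _
  rw [intervalIntegrable_iff_integrableOn_Ioo_of_le hT] at hb ⊢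
  refine hb.mono' (ContinuousOn.aestronglyMeasurable (fun t ht =>
    (hv.differentiable t ht).2.continuousAt.continuousWithinAt) measurableSet_Ioo)
    ((ae_restrict_iff' measurableSet_Ioo).2 (.of_forall fun t ht => ?_))
  exact (hA.norm_le hlam (hv.mem_domain t ht).1).trans
    (mul_le_mul_of_nonneg_left (norm_app_deriv_le hv ht) (by positivity))

/-- The equation integrated over a subinterval. -/
lemma integral_source_eq [CompleteSpace H] (hA : IsElliptic A lam) (hlam : 0 < lam) (hα : 0 < α)
    (hT : 0 < T) (hB : ∀ j, A.domain ≤ (B j).domain) (ha : ∀ j, 0 < a j)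
    (hu : IsSolution A B a κ T f u₀ u) (hv : IsRegularSolution A α T M (untemper κ u))
    (hcA : ContinuousOn (fun t => app A (untemper κ u t)) (Icc 0 T))
    (hcB : ∀ j, ContinuousOn (fun t => app (B j) (untemper κ u t)) (Icc 0 T))
    {x y : ℝ} (hx : 0 ≤ x) (hxy : x ≤ y) (hy : y ≤ T) :
    ∫ s in x..y, untemper κ f s = untemper κ u y - untemper κ u x
      - κ • (∫ s in x..y, untemper κ u s) + (∫ s in x..y, app A (untemper κ u s))
      + ∑ j, ∫ r in x..y, ∫ s in (0 : ℝ)..r, abelKernel (a j) (r - s) •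
          app (B j) (untemper κ u s) := by
  set v := untemper κ u with hvdef
  have hcv : ContinuousOn v (Icc 0 T) := continuousOn_untemper hu.continuousOn
  have hsub : uIcc x y ⊆ uIcc 0 T := by
    rw [uIcc_of_le hxy, uIcc_of_le hT.le]; exact Icc_subset_Icc hx hy
  have hsub' : uIcc x y ⊆ Icc 0 T := by rwa [uIcc_of_le hT.le] at hsub
  have i1 : IntervalIntegrable (deriv v) volume x y :=
    (intervalIntegrable_deriv hA hlam hα hT.le hv).mono_set hsub
  have i2 : IntervalIntegrable (fun s => κ • v s) volume x y :=
    ((hcv.mono hsub').const_smul κ).intervalIntegrable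
  have i3 : IntervalIntegrable (fun s => app A (v s)) volume x y :=
    (hcA.mono hsub').intervalIntegrable
  have i4 : ∀ j, IntervalIntegrable (fun r => ∫ s in (0 : ℝ)..r, abelKernel (a j) (r - s) •
      app (B j) (v s)) volume x y := fun j =>
    (intervalIntegrable_fracInt (ha j) hT.le (hcB j)).mono_set hsub
  have i5 : IntervalIntegrable (fun r => ∑ j, ∫ s in (0 : ℝ)..r, abelKernel (a j) (r - s) •
      app (B j) (v s)) volume x y := by
    have := IntervalIntegrable.sum Finset.univ (fun j _ => i4 j)
    simpa only [Finset.sum_fn] using this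
  have hftc : ∫ s in x..y, deriv v s = v y - v x :=
    intervalIntegral.integral_eq_sub_of_hasDerivAt_of_le hxy (hcv.mono (Icc_subset_Icc hx hy))
      (fun s hs => (hv.differentiable s ⟨hx.trans_lt hs.1, hs.2.trans_le hy⟩).1.hasDerivAt) i1
  have hcongr : ∫ s in x..y, untemper κ f s = ∫ s in x..y, (deriv v s - κ • v s + app A (v s)
      + ∑ j, ∫ q in (0 : ℝ)..s, abelKernel (a j) (s - q) • app (B j) (v q)) := by
    rw [intervalIntegral.integral_of_le hxy, intervalIntegral.integral_of_le hxy,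
      integral_Ioc_eq_integral_Ioo, integral_Ioc_eq_integral_Ioo]
    refine setIntegral_congr_fun measurableSet_Ioo fun s hs => ?_
    have h := (hasDerivAt_untemper hB hu (t := s) ⟨hx.trans_lt hs.1, hs.2.trans_le hy⟩).deriv
    rw [h]
    abel
  rw [hcongr, intervalIntegral.integral_add ((i1.sub i2).add i3) i5,
    intervalIntegral.integral_add (i1.sub i2) i3, intervalIntegral.integral_sub i1 i2, hftc,
    intervalIntegral.integral_smul, intervalIntegral.integral_finsetSum fun j _ => i4 j]

end Integrated

/-! ### Consistency -/

section Consistency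

variable {α γ T L M cγ Cγ k : ℝ} {N : ℕ} {t : ℕ → ℝ}

lemma norm_cell_error_le [CompleteSpace H] (hα : 0 < α) (hL : 0 ≤ L) {b : ℝ → H}
    (hb : IsGradedSmooth α T L b) (hm : IsGradedMesh γ T cγ Cγ k N t) {n : ℕ} (h1 : 1 ≤ n)
    (hn : n ≤ N) :
    ‖(∫ s in (t (n - 1))..(t n), b s) - step t n • stage (fun i => b (t i)) n‖
      ≤ step t n * residualBound α L t n := by
  have hcb := continuousOn_cell (hb.continuousOn hα) hm hn
  have hle := hm.mono (show n - 1 ≤ n by omega) hn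
  have hlin : Continuous fun s : ℝ => s - (t (n - 1) + t n) / 2 := by fun_prop
  have hmid : ∫ s in (t (n - 1))..(t n), (s - (t (n - 1) + t n) / 2) = 0 := by
    rw [intervalIntegral.integral_sub intervalIntegral.intervalIntegrable_id
      (continuous_const.intervalIntegrable _ _), integral_id, intervalIntegral.integral_const,
      smul_eq_mul]
    ring
  have e : (∫ s in (t (n - 1))..(t n), b s) - step t n • stage (fun i => b (t i)) n
      = ∫ s in (t (n - 1))..(t n), meshResidual b t n s := by
    have i1 : IntervalIntegrable (fun s => b s - stage (fun i => b (t i)) n) volume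
        (t (n - 1)) (t n) := (hcb.sub continuousOn_const).intervalIntegrable
    simp only [meshResidual]
    rw [intervalIntegral.integral_sub i1 (intervalIntegrable_smul hlin continuousOn_const),
      intervalIntegral.integral_smul_const, hmid, zero_smul, sub_zero,
      intervalIntegral.integral_sub hcb.intervalIntegrable
        (continuous_const.intervalIntegrable _ _), intervalIntegral.integral_const]
    rfl
  rw [e]
  have h := norm_integral_smul_le (h := fun _ => 1) (f := meshResidual b t n) hle continuous_const
    (fun _ _ => zero_le_one) fun s hs => norm_meshResidual_le hL hb hm h1 hn hs
  simp only [one_smul, intervalIntegral.integral_const, smul_eq_mul, mul_one] at h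
  rw [mul_comm]
  exact h

/-- No integrability is needed, as the integral of a non-integrable function is `0`. -/
lemma integral_le_of_le_const {f : ℝ → ℝ} {x y c : ℝ} (hxy : x ≤ y) (hc : 0 ≤ c)
    (hf : ∀ s ∈ Ioo x y, f s ≤ c) : ∫ s in x..y, f s ≤ c * (y - x) := by
  by_cases h : IntervalIntegrable f volume x y
  · have := intervalIntegral.integral_mono_on_of_le_Ioo hxy h
      (continuous_const.intervalIntegrable (μ := volume) x y) hf
    rw [intervalIntegral.integral_const, smul_eq_mul] at this
    linarith
  · rw [intervalIntegral.integral_undef h]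
    exact mul_nonneg hc (by linarith)

lemma sum_norm_source_error_le (hα : 0 < α) (hα1 : α < 1) (hM : 0 ≤ M) {g : ℝ → H} {G : ℕ → H}
    (hg : IsRegularSource α T M g) (hm : IsGradedMesh γ T cγ Cγ k N t)
    (hG : IsSourceQuadrature M N t g G) :
    ∑ n ∈ Finset.Icc 1 N, ‖step t n • G n - ∫ s in (t (n - 1))..(t n), g s‖
      ≤ M ^ 2 * (t 1 ^ (1 + α)
        + ∑ n ∈ Finset.Icc 2 N, step t n ^ 3 * t (n - 1) ^ (α - 2)) := by
  have ht1 : 0 < t 1 := hm.pos le_rfl hm.one_le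
  have hins : Finset.Icc 1 N = insert 1 (Finset.Icc 2 N) := by
    have := hm.one_le
    ext; simp; omega
  rw [hins, Finset.sum_insert (by simp), mul_add, Finset.mul_sum]
  refine add_le_add ?_ (Finset.sum_le_sum fun n hn => ?_)
  · have h1 : ∫ s in (t 0)..(t 1), s * ‖deriv g s‖ ≤ M * t 1 ^ α * (t 1 - t 0) := by
      refine integral_le_of_le_const (by rw [hm.start]; exact ht1.le) (by positivity) fun s hs => ?_
      rw [hm.start] at hs
      have hsT : s < T := hs.2.trans_le (hm.le_final hm.one_le)
      have h2 := hg.bound s ⟨hs.1, hsT⟩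
      have h3 := Real.rpow_le_rpow hs.1.le hs.2.le hα.le
      have h4 : 0 ≤ s ^ 2 * ‖deriv (deriv g) s‖ := by positivity
      linarith [mul_le_mul_of_nonneg_left h3 hM]
    rw [hm.start, sub_zero] at h1
    have h2 := hG.first
    rw [hm.start] at h2
    simp only [Nat.sub_self, hm.start]
    refine h2.trans ?_
    rw [add_comm 1 α, Real.rpow_add_one ht1.ne']
    linarith [mul_le_mul_of_nonneg_left h1 hM]
  · obtain ⟨h2, hnN⟩ := Finset.mem_Icc.1 hn
    have ht' : 0 < t (n - 1) := hm.pos (by omega) (by omega)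
    have h1 : ∫ s in (t (n - 1))..(t n), ‖deriv (deriv g) s‖
        ≤ M * t (n - 1) ^ (α - 2) * (t n - t (n - 1)) := by
      refine integral_le_of_le_const (hm.mono (by omega) hnN) (by positivity) fun s hs => ?_
      have hs0 : 0 < s := ht'.trans hs.1
      have hsT : s < T := hs.2.trans_le (hm.le_final hnN)
      have h2 := hg.bound s ⟨hs0, hsT⟩
      have h3 := Real.rpow_le_rpow_of_nonpos ht' hs.1.le (by linarith : α - 2 ≤ 0)
      have h4 : 0 ≤ s * ‖deriv g s‖ := by positivity
      have e : s ^ α = s ^ 2 * s ^ (α - 2) := by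
        rw [← Real.rpow_natCast s 2, ← Real.rpow_add hs0]; congr 1; push_cast; ring
      have h5 : s ^ 2 * ‖deriv (deriv g) s‖ ≤ s ^ 2 * (M * s ^ (α - 2)) := by
        rw [e] at h2; linarith
      have h6 := le_of_mul_le_mul_left h5 (by positivity)
      linarith [mul_le_mul_of_nonneg_left h3 hM]
    refine (hG.next n h2 hnN).trans ?_
    rw [← step] at h1
    have h3 := mul_le_mul_of_nonneg_left h1 (by positivity : 0 ≤ M * step t n ^ 2)
    linarith

end Consistency

/-! ### The error estimate -/

lemma norm_retemper_sub_le {κ : ℝ} (hκ : 0 ≤ κ) {t : ℕ → ℝ} {n : ℕ} (ht : 0 ≤ t n) (V : ℕ → H)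
    (u : ℝ → H) : ‖retemper κ t V n - u (t n)‖ ≤ ‖V n - untemper κ u (t n)‖ := by
  have e : retemper κ t V n - u (t n)
      = Real.exp (-κ * t n) • (V n - untemper κ u (t n)) := by
    rw [retemper, untemper, smul_sub, smul_smul, ← Real.exp_add]
    simp
  have h1 : Real.exp (-κ * t n) ≤ 1 := by
    rw [Real.exp_le_one_iff]
    have := mul_nonneg hκ ht
    linarith
  rw [e, norm_smul, Real.norm_of_nonneg (Real.exp_pos _).le]
  exact mul_le_of_le_one_left (norm_nonneg _) h1

/-- The local residual of the exact solution in the scheme, in its four parts: source quadrature,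
elliptic term, memory terms, and the term from the exponential weight. -/
def schemeResidual {m : ℕ} (A : H →ₗ.[ℝ] H) (B : Fin m → H →ₗ.[ℝ] H) (a : Fin m → ℝ) (κ : ℝ)
    (t : ℕ → ℝ) (g v : ℝ → H) (G : ℕ → H) (n : ℕ) : H :=
  (step t n • G n - ∫ s in (t (n - 1))..(t n), g s)
    + ((∫ s in (t (n - 1))..(t n), app A (v s))
      - step t n • stage (fun i => app A (v (t i))) n)
    + (∑ j, (memoryDefect (a j) t (fun s => app (B j) (v s)) n
      - memoryDefect (a j) t (fun s => app (B j) (v s)) (n - 1)))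
    - κ • ((∫ s in (t (n - 1))..(t n), v s) - step t n • stage (fun i => v (t i)) n)

/-- The equation for the error `V^n - v(t_n)`. -/
lemma error_equation [CompleteSpace H] {m : ℕ} {A : H →ₗ.[ℝ] H} {B : Fin m → H →ₗ.[ℝ] H}
    {a : Fin m → ℝ} {α κ γ T M lam cγ Cγ k : ℝ} {f u : ℝ → H} {u₀ : H} {N : ℕ} {t : ℕ → ℝ}
    {G V : ℕ → H} (hA : IsElliptic A lam) (hlam : 0 < lam) (hα : 0 < α) (hT : 0 < T)
    (hB : ∀ j, A.domain ≤ (B j).domain) (ha : ∀ j, 0 < a j)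
    (hu : IsSolution A B a κ T f u₀ u) (hv : IsRegularSolution A α T M (untemper κ u))
    (hmem : ∀ s ∈ Icc 0 T, untemper κ u s ∈ A.domain)
    (hcA : ContinuousOn (fun t => app A (untemper κ u t)) (Icc 0 T))
    (hcB : ∀ j, ContinuousOn (fun t => app (B j) (untemper κ u t)) (Icc 0 T))
    (hm : IsGradedMesh γ T cγ Cγ k N t) (hV : IsDiscreteSolution A B a κ N t G u₀ V)
    {n : ℕ} (h1 : 1 ≤ n) (hn : n ≤ N) {e : ℕ → H}
    (he : e = fun i => V i - untemper κ u (t i)) :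
    e n - e (n - 1) + (step t n • app A (stage e n)
      + ∑ j, step t n • ∑ p ∈ Finset.Icc 1 n, (piWeight (a j) t n p * step t p) •
        app (B j) (stage e p)) - (κ * step t n) • stage e n
      = schemeResidual A B a κ t (untemper κ f) (untemper κ u) G n := by
  have hk : step t n ≠ 0 := (hm.step_pos h1 hn).ne'
  set v := untemper κ u with hvd
  have hVm : ∀ i, 1 ≤ i → i ≤ n → V i ∈ A.domain := fun i g1 g2 =>
    hV.mem_domain i g1 (g2.trans hn)
  have hvm : ∀ i, 1 ≤ i → i ≤ n → v (t i) ∈ A.domain := fun i g1 g2 =>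
    hmem _ (hm.mem_Icc (g2.trans hn))
  have hstage : ∀ p, stage e p = stage V p - stage (fun i => v (t i)) p := fun p => by
    rw [he]; exact stage_sub V (fun i => v (t i)) p
  have hD : ∀ p, 1 ≤ p → p ≤ n → stage V p ∈ A.domain := fun p g1 g2 =>
    stage_mem g1 fun i i1 i2 => hVm i i1 (i2.trans g2)
  have hD' : ∀ p, 1 ≤ p → p ≤ n → stage (fun i => v (t i)) p ∈ A.domain := fun p g1 g2 =>
    stage_mem g1 fun i i1 i2 => hvm i i1 (i2.trans g2)
  have hAe : app A (stage e n) = app A (stage V n) - stage (fun i => app A (v (t i))) n := by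
    rw [hstage, app_sub A (hD n h1 le_rfl) (hD' n h1 le_rfl), app_stage A h1 hvm]
  have hBe : ∀ j, step t n • ∑ p ∈ Finset.Icc 1 n, (piWeight (a j) t n p * step t p) •
        app (B j) (stage e p)
      = step t n • discreteFracInt (a j) t (B j) V n - step t n • ∑ p ∈ Finset.Icc 1 n,
        (piWeight (a j) t n p * step t p) • stage (fun i => app (B j) (v (t i))) p := by
    intro j
    rw [discreteFracInt, ← smul_sub, ← Finset.sum_sub_distrib]
    congr 1
    refine Finset.sum_congr rfl fun p hp => ?_
    obtain ⟨g1, g2⟩ := Finset.mem_Icc.1 hp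
    rw [hstage, app_sub _ (hB j (hD p g1 g2)) (hB j (hD' p g1 g2)), smul_sub,
      app_stage (B j) g1 fun i i1 i2 => hB j (hvm i i1 (i2.trans g2))]
  have hscheme : V n - V (n - 1) + step t n • app A (stage V n)
      + ∑ j, step t n • discreteFracInt (a j) t (B j) V n - (κ * step t n) • stage V n
      = step t n • G n := by
    rw [← hV.equation n h1 hn, smul_sub, smul_add, smul_add, smul_smul, mul_one_div_cancel hk,
      one_smul, Finset.smul_sum, smul_smul, mul_comm κ]
  have hexact := integral_source_eq hA hlam hα hT hB ha hu hv hcA hcB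
    (hm.nonneg (show n - 1 ≤ N by omega)) (hm.mono (by omega) hn) (hm.le_final hn)
  have hmemory : ∀ j, memoryDefect (a j) t (fun s => app (B j) (v s)) n
      - memoryDefect (a j) t (fun s => app (B j) (v s)) (n - 1)
      = (∫ r in (t (n - 1))..(t n), ∫ s in (0 : ℝ)..r, abelKernel (a j) (r - s) •
          app (B j) (v s)) - step t n • ∑ p ∈ Finset.Icc 1 n,
        (piWeight (a j) t n p * step t p) • stage (fun i => app (B j) (v (t i))) p := fun j =>
    (memory_error_eq (ha j) hT.le hm (hcB j) h1 hn).symm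
  rw [schemeResidual, hexact, ← hscheme, hAe, hstage]
  simp only [hBe, hmemory, Finset.sum_sub_distrib]
  rw [he]
  simp only [smul_sub, mul_smul]
  abel

lemma sum_inner_operator_nonneg [CompleteSpace H] {m : ℕ} {A : H →ₗ.[ℝ] H}
    {B : Fin m → H →ₗ.[ℝ] H} {a : Fin m → ℝ} {M lam : ℝ} (hlam : 0 ≤ lam) (hA : IsElliptic A lam)
    (hB : ∀ j, IsDominated A (B j) M) (ha : ∀ j, 0 < a j ∧ a j < 1) {t : ℕ → ℝ} {l : ℕ}
    (ht : ∀ n, 1 ≤ n → n ≤ l → t (n - 1) < t n) {s : ℕ → H}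
    (hs : ∀ p, 1 ≤ p → p ≤ l → s p ∈ A.domain) :
    0 ≤ ∑ n ∈ Finset.Icc 1 l, ⟪step t n • app A (s n) + ∑ j, step t n • ∑ p ∈ Finset.Icc 1 n,
      (piWeight (a j) t n p * step t p) • app (B j) (s p), s n⟫_ℝ := by
  simp only [inner_add_left, sum_inner, Finset.sum_add_distrib]
  refine add_nonneg (Finset.sum_nonneg fun n hn => ?_) ?_
  · obtain ⟨h1, h2⟩ := Finset.mem_Icc.1 hn
    rw [real_inner_smul_left]
    exact mul_nonneg (sub_nonneg.2 (ht n h1 h2).le)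
      ((mul_nonneg hlam (sq_nonneg _)).trans (hA.lower_bound _ (hs n h1 h2)))
  · rw [Finset.sum_comm]
    exact Finset.sum_nonneg fun j _ =>
      sum_inner_memory_nonneg (ha j).1 (ha j).2 (hB j) ht hs

/-- Consistency: the residuals of the exact solution sum up to at most the error bound. -/
lemma sum_norm_schemeResidual_le [CompleteSpace H] {m : ℕ} {A : H →ₗ.[ℝ] H}
    {B : Fin m → H →ₗ.[ℝ] H} {a : Fin m → ℝ} {α κ γ T M cγ Cγ k : ℝ} {N : ℕ} {t : ℕ → ℝ}
    {G : ℕ → H} {g v : ℝ → H} {K C Ξ LA LB L₁ : ℝ} (hα : 0 < α) (hα1 : α < 1) (hκ : 0 ≤ κ)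
    (hM : 0 ≤ M) (hK0 : 0 ≤ K) (hLA : 0 ≤ LA) (hLB : 0 ≤ LB) (hL₁ : 0 ≤ L₁)
    (ha : ∀ j, 0 < a j ∧ a j < 1)
    (hK : ∀ a x : ℝ, 0 < a → a < 1 → 0 ≤ x → x ≤ T → abelKernel (a + 1) x ≤ K)
    (hbA : IsGradedSmooth α T LA fun t => app A (v t))
    (hbB : ∀ j, IsGradedSmooth α T LB fun t => app (B j) (v t))
    (hb₁ : IsGradedSmooth α T L₁ v) (hg : IsRegularSource α T M g)
    (hm : IsGradedMesh γ T cγ Cγ k N t) (hG : IsSourceQuadrature M N t g G)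
    (hfirst : t 1 ^ (1 + α) ≤ C * Ξ)
    (hcube : ∑ p ∈ Finset.Icc 2 N, step t p ^ 3 * t (p - 1) ^ (α - 2) ≤ C * Ξ)
    (hres : ∀ L : ℝ, 0 ≤ L →
      ∑ p ∈ Finset.Icc 1 N, step t p * residualBound α L t p ≤ L * (C * Ξ))
    (hsaw : ∀ L : ℝ, 0 ≤ L →
      ∑ p ∈ Finset.Icc 2 N, sawBound α L t p * step t p ^ 2 ≤ L * (C * Ξ)) :
    ∑ n ∈ Finset.Icc 1 N, ‖schemeResidual A B a κ t g v G n‖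
      ≤ (2 * M ^ 2 + LA + m * (3 * K * LB) + κ * L₁) * (C * Ξ) := by
  have cell : ∀ {L : ℝ} {b : ℝ → H}, 0 ≤ L → IsGradedSmooth α T L b →
      ∑ n ∈ Finset.Icc 1 N, ‖(∫ s in (t (n - 1))..(t n), b s)
        - step t n • stage (fun i => b (t i)) n‖ ≤ L * (C * Ξ) := fun hL hb =>
    (Finset.sum_le_sum fun n hn => norm_cell_error_le hα hL hb hm (Finset.mem_Icc.1 hn).1
      (Finset.mem_Icc.1 hn).2).trans (hres _ hL)
  have b1 := sum_norm_source_error_le hα hα1 hM hg hm hG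
  have b2 := cell hLA hbA
  have b3 : ∀ j, ∑ n ∈ Finset.Icc 1 N, ‖memoryDefect (a j) t (fun s => app (B j) (v s)) n
      - memoryDefect (a j) t (fun s => app (B j) (v s)) (n - 1)‖ ≤ 3 * K * LB * (C * Ξ) := by
    intro j
    refine (sum_norm_memoryDefect_sub_le (ha j).1 (ha j).2.le hLB hα hα1.le hm (hbB j)
      fun x hx hxT => hK (a j) x (ha j).1 (ha j).2 hx hxT).trans ?_
    have h1 := mul_le_mul_of_nonneg_left (hres LB hLB) hK0
    have h2 := mul_le_mul_of_nonneg_left (hsaw LB hLB) (by positivity : 0 ≤ 2 * K)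
    linarith
  have b4 := cell hL₁ hb₁
  have htri : ∀ n ∈ Finset.Icc 1 N, ‖schemeResidual A B a κ t g v G n‖
      ≤ ‖step t n • G n - ∫ s in (t (n - 1))..(t n), g s‖
        + ‖(∫ s in (t (n - 1))..(t n), app A (v s))
          - step t n • stage (fun i => app A (v (t i))) n‖
        + (∑ j, ‖memoryDefect (a j) t (fun s => app (B j) (v s)) n
          - memoryDefect (a j) t (fun s => app (B j) (v s)) (n - 1)‖)
        + κ * ‖(∫ s in (t (n - 1))..(t n), v s) - step t n • stage (fun i => v (t i)) n‖ := by
    intro n _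
    rw [schemeResidual]
    refine (norm_sub_le _ _).trans (add_le_add ((norm_add_le _ _).trans
      (add_le_add (norm_add_le _ _) (norm_sum_le _ _))) (le_of_eq ?_))
    rw [norm_smul, Real.norm_of_nonneg hκ]
  refine (Finset.sum_le_sum htri).trans ?_
  rw [Finset.sum_add_distrib, Finset.sum_add_distrib, Finset.sum_add_distrib, ← Finset.mul_sum,
    Finset.sum_comm]
  have b5 : ∑ j : Fin m, ∑ n ∈ Finset.Icc 1 N,
      ‖memoryDefect (a j) t (fun s => app (B j) (v s)) n
        - memoryDefect (a j) t (fun s => app (B j) (v s)) (n - 1)‖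
      ≤ m * (3 * K * LB * (C * Ξ)) := by
    refine (Finset.sum_le_sum fun j _ => b3 j).trans_eq ?_
    simp
  have b6 := mul_le_mul_of_nonneg_left b4 hκ
  have b7 := mul_le_mul_of_nonneg_left (add_le_add hfirst hcube) (sq_nonneg M)
  linarith

end

end TemperedVolterra

theorem theorem4p7 (m : ℕ) (α κ γ T : ℝ) (hα : 0 < α) (hα1 : α < 1) (hκ : 0 ≤ κ) (hγ : 1 ≤ γ)
    (hT : 0 < T) (cγ Cγ lam M θ : ℝ) (hcγ : 0 < cγ) (hCγ : 0 < Cγ) (hlam : 0 < lam) (hM : 0 < M)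
    (hθ : 0 < θ) (hθ1 : θ < 1) :
    ∃ C : ℝ, 0 < C ∧
      ∀ (H : Type u) [NormedAddCommGroup H] [InnerProductSpace ℝ H] [CompleteSpace H]
        (A : H →ₗ.[ℝ] H) (B : Fin m → H →ₗ.[ℝ] H) (a : Fin m → ℝ) (f u : ℝ → H) (u₀ : H),
        TemperedVolterra.IsElliptic A lam →
        (∀ j, TemperedVolterra.IsDominated A (B j) M) →
        (∀ j, 0 < a j ∧ a j < 1) →
        IsLeast (Set.range a) α →
        TemperedVolterra.IsSolution A B a κ T f u₀ u →
        TemperedVolterra.IsRegularSolution A α T M (TemperedVolterra.untemper κ u) →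
        TemperedVolterra.IsRegularSource α T M (TemperedVolterra.untemper κ f) →
        ∀ (k : ℝ) (N : ℕ) (t : ℕ → ℝ) (G V : ℕ → H),
          TemperedVolterra.IsGradedMesh γ T cγ Cγ k N t →
          (∀ n, 1 ≤ n → n ≤ N → κ * TemperedVolterra.step t n ≤ θ) →
          (γ = 2 / (1 + α) → t 1 ≤ θ * t N) →
          TemperedVolterra.IsSourceQuadrature M N t (TemperedVolterra.untemper κ f) G →
          TemperedVolterra.IsDiscreteSolution A B a κ N t G u₀ V →
          ∀ n, 1 ≤ n → n ≤ N →
            ‖V n - TemperedVolterra.untemper κ u (t n)‖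
                ≤ C * TemperedVolterra.errorBound k α γ (t 1) (t N) ∧
            ‖TemperedVolterra.retemper κ t V n - u (t n)‖
                ≤ C * TemperedVolterra.errorBound k α γ (t 1) (t N) := by
  open TemperedVolterra in
  obtain ⟨C, hC, hmesh⟩ := exists_mesh_sums_le (α := α) hα hγ hT hcγ hCγ hθ hθ1
  obtain ⟨K, hK0, hK⟩ := exists_abelKernel_add_one_le T
  have hθ' : 0 < 1 - θ := by linarith
  refine ⟨2 / (1 - θ) * Real.exp (3 * κ * T / (1 - θ)) * ((2 * M ^ 2 + 1 * (M / α)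
    + m * (3 * K * (M * (M / α))) + κ * (1 / lam * (M / α))) * C), by positivity, ?_⟩
  intro H _ _ _ A B a f u u₀ hA hB ha _ hu hv hg k N t G V hm hκθ hθt hG hV n h1 hn
  have hmemI : ∀ s ∈ Ioo 0 T, untemper κ u s ∈ A.domain := fun s hs =>
    untemper_mem (hu.mem_domain s hs)
  have hcv : ContinuousOn (untemper κ u) (Icc 0 T) := continuousOn_untemper hu.continuousOn
  have hmem : ∀ s ∈ Icc 0 T, untemper κ u s ∈ A.domain := fun s hs =>
    mem_domain_of_mem_Icc hA.selfAdjoint hα hM.le hT hcv hmemI hv hs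
  have hBd : ∀ j, A.domain ≤ (B j).domain := fun j => (hB j).domain_le
  have hbA : IsGradedSmooth α T (1 * (M / α)) fun s => app A (untemper κ u s) :=
    isGradedSmooth_comp hA.selfAdjoint hα hα1 hM.le hcv hmem hv zero_le_one
      (fun x hx y hy => app_sub A hx hy) (fun c x hx => app_smul A c hx)
      (fun x _ => (one_mul _).ge)
  have hbB : ∀ j, IsGradedSmooth α T (M * (M / α)) fun s => app (B j) (untemper κ u s) := fun j =>
    isGradedSmooth_comp hA.selfAdjoint hα hα1 hM.le hcv hmem hv hM.le
      (fun x hx y hy => app_sub _ (hBd j hx) (hBd j hy)) (fun c x hx => app_smul _ c (hBd j hx))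
      (fun x hx => (hB j).norm_app_le hA.selfAdjoint hM.le hx)
  have hb₁ : IsGradedSmooth α T (1 / lam * (M / α)) (untemper κ u) :=
    isGradedSmooth_comp (F := id) hA.selfAdjoint hα hα1 hM.le hcv hmem hv (by positivity)
      (fun _ _ _ _ => rfl) (fun _ _ _ => rfl) (fun x hx => hA.norm_le hlam hx)
  obtain ⟨hΞ, hfirst, hcube, hsums⟩ := hmesh k N t hm hθt
  have hcons := sum_norm_schemeResidual_le (B := B) (K := K) (κ := κ) hα hα1 hκ hM.le hK0.le
    (by positivity) (by positivity) (by positivity) ha hK hbA hbB hb₁ hg hm hG hfirst hcube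
    (fun L hL => (hsums L hL).1) (fun L hL => (hsums L hL).2)
  set e : ℕ → H := fun i => V i - untemper κ u (t i) with he
  have he0 : e 0 = 0 := by
    simp only [he, hV.initial, untemper, hm.start, hu.initial]
    simp
  have hes : ∀ p, 1 ≤ p → p ≤ N → stage e p ∈ A.domain := fun p p1 pN =>
    stage_mem p1 fun i i1 ip => sub_mem (hV.mem_domain i i1 (ip.trans pN))
      (hmem _ (hm.mem_Icc (ip.trans pN)))
  have hstab := norm_le_sum_norm_residual hκ hθ1 hm.start hm.final hm.increasing hκθ he0
    (fun i i1 iN => error_equation hA hlam hα hT hBd (fun j => (ha j).1) hu hv hmem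
      (hbA.continuousOn hα) (fun j => (hbB j).continuousOn hα) hm hV i1 iN he)
    (fun l _ lN => sum_inner_operator_nonneg hlam.le hA hB ha
      (fun i i1 il => hm.increasing i i1 (il.trans lN)) fun p p1 pl => hes p p1 (pl.trans lN))
    h1 hn
  have hfinal : ‖V n - untemper κ u (t n)‖ ≤ 2 / (1 - θ) * Real.exp (3 * κ * T / (1 - θ)) *
      ((2 * M ^ 2 + 1 * (M / α) + m * (3 * K * (M * (M / α))) + κ * (1 / lam * (M / α))) * C) *
      errorBound k α γ (t 1) (t N) := by
    refine hstab.trans ((mul_le_mul_of_nonneg_left hcons (by positivity)).trans_eq ?_)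
    ring
  exact ⟨hfinal, (norm_retemper_sub_le hκ (hm.nonneg hn) V u).trans hfinal⟩
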